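/- **Product laws on $\mathbb{R}$.** Fix a dyadic partition of unity: even nonnegative functions $\chi\in\mathcal D(\mathbb R)$, $\varphi\in\mathcal D(\mathbb R\setminus\{0\})$ with $\chi(\xi)+\sum_{q\ge 0}\varphi(2^{-q}\xi)=1$ for all $\xi\in\mathbb R$. For a (complex-valued) tempered distribution $u$ on $\mathbb R$ put $\Delta_{-1}u=\chi(D)u$, $\Delta_q u=\varphi(2^{-q}D)u$ for $q\ge 0$, and $S_qu=\sum_{j=-1}^{q-1}\Delta_ju$. The Besov space $B^s_{p,r}$ is the set of tempered distributions $u$ whose norm $\|u\|_{B^s_{p,r}}=\big\|\big(2^{qs}\|\Delta_qu\|_{L^p}\big)_{q\ge -1}\big\|_{\ell^r}$ is finite, and $H^s$ ($s\in\mathbb R$) is the $L^2$-based Sobolev space with norm $\|(1+D^2)^{s/2}u\|_{L^2}$. An intersection of two spaces carries the sum of the two norms. The product $uv$ of two tempered distributions is understood through Bony's decomposition $$uv=T_uv+T_vu+R(u,v),\qquad T_uv=\sum_{q}S_{q-1}u\,\Delta_qv,\qquad R(u,v)=\sum_{|q-q'|\le 1}\Delta_qu\,\Delta_{q'}v,$$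 and is said to exist if, for every dyadic partition of unity, the three series converge in $\mathcal S'(\mathbb R)$, the total being the same for all partitions. The product $(u,v)\mapsto uv$ exists and is bilinear and continuous (that is, $\|uv\|\le C\|u\|\,\|v\|$ with $C$ depending only on the partition used in the norms and on $s,s',\varepsilon$) a) from $H^s\times(B^{1/2}_{2,\infty}\cap L^\infty)$ to $H^s$ whenever $|s|<\frac12$; b) from $H^s\times B^{s+\varepsilon}_{\infty,\infty}$ to $H^s$ whenever $s\ge 0$ and $\varepsilon>0$; c) from $H^s\times H^{s'}$ to $H^{s+s'-\frac12}$ whenever $s,s'<\frac12$ and $s+s'>0$; d) from $(H^s\cap L^\infty)\times(H^s\cap L^\infty)$ to $H^s\cap L^\infty$ whenever $s\ge 0$, and from $H^s\times H^s$ to $H^s$ whenever $s>\frac12$; that is, these spaces are algebras. In all these cases $uv$ is the usual pointwise product $x\mapsto u(x)v(x)$ whenever $u$ is an $L^2$ function and $v$ is an $L^2$ or an $L^\infty$ function; in particular this is the product of the algebras in d). -/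

import Mathlib

open MeasureTheory FourierTransform TemperedDistribution
open scoped SchwartzMap ENNReal NNReal

noncomputable section

namespace ProductLaws

/-! ### Dyadic partitions of unity and frequency blocks -/

/-- A dyadic partition of unity on the frequency line: `χ ∈ 𝒟(ℝ)` and `φ ∈ 𝒟(ℝ \ {0})` are even,
nonnegative, and `χ(ξ) + ∑_{q ≥ 0} φ(2^{-q} ξ) = 1` for every `ξ`. -/
structure DyadicPartition where
  χ : ℝ → ℝ
  φ : ℝ → ℝ
  contDiff_χ : ContDiff ℝ (⊤ : ℕ∞) χ
  contDiff_φ : ContDiff ℝ (⊤ : ℕ∞) φ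
  compact_χ : HasCompactSupport χ
  compact_φ : HasCompactSupport φ
  zero_notMem : (0 : ℝ) ∉ tsupport φ
  even_χ : ∀ ξ, χ (-ξ) = χ ξ
  even_φ : ∀ ξ, φ (-ξ) = φ ξ
  nonneg_χ : ∀ ξ, 0 ≤ χ ξ
  nonneg_φ : ∀ ξ, 0 ≤ φ ξ
  sum_eq : ∀ ξ, HasSum (fun q : ℕ ↦ φ ((2 : ℝ)⁻¹ ^ q * ξ)) (1 - χ ξ)

namespace DyadicPartition

variable (P : DyadicPartition)

/-- The symbol of the `k`-th block. All dyadic indices are shifted by one: the index `k : ℕ` stands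
for the dyadic index `q = k - 1 ≥ -1`, so that `k = 0` is the low frequency block `χ(D)` and
`k = q + 1` is the block `φ(2^{-q} D)`. -/
def symbol : ℕ → ℝ → ℂ
  | 0 => fun ξ ↦ (P.χ ξ : ℂ)
  | q + 1 => fun ξ ↦ (P.φ ((2 : ℝ)⁻¹ ^ q * ξ) : ℂ)

theorem contDiff_symbol (k : ℕ) : ContDiff ℝ (⊤ : ℕ∞) (P.symbol k) := by
  cases k with
  | zero => exact Complex.ofRealCLM.contDiff.comp P.contDiff_χ
  | succ q =>
    exact Complex.ofRealCLM.contDiff.comp (P.contDiff_φ.comp (contDiff_const.mul contDiff_id))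

theorem hasCompactSupport_symbol (k : ℕ) : HasCompactSupport (P.symbol k) := by
  cases k with
  | zero => exact P.compact_χ.comp_left (g := Complex.ofReal) Complex.ofReal_zero
  | succ q =>
    have h : HasCompactSupport (fun ξ : ℝ ↦ P.φ ((2 : ℝ)⁻¹ ^ q * ξ)) := by
      simpa [smul_eq_mul] using P.compact_φ.comp_smul (c := (2 : ℝ)⁻¹ ^ q) (by positivity)
    exact h.comp_left (g := Complex.ofReal) Complex.ofReal_zero

/-- The symbol of the `k`-th block, as a Schwartz function. -/
def symbolS (k : ℕ) : 𝓢(ℝ, ℂ) :=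
  (P.hasCompactSupport_symbol k).toSchwartzMap (P.contDiff_symbol k)

/-- The `k`-th frequency block `Δ_{k-1} u` of a tempered distribution `u`, a Fourier multiplier. -/
def block (k : ℕ) : 𝓢'(ℝ, ℂ) →L[ℂ] 𝓢'(ℝ, ℂ) :=
  fourierMultiplierCLM ℂ (P.symbol k)

/-- The smooth function that represents the distribution `P.block k u`, i.e. the convolution of `u`
with the inverse Fourier transform `h` of the symbol: `x ↦ ⟨u, y ↦ h(x - y)⟩`.
Note that `h(x - y) = (𝓕 symbol)(y - x)`. -/
def blockFun (k : ℕ) (u : 𝓢'(ℝ, ℂ)) (x : ℝ) : ℂ :=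
  u (SchwartzMap.compSubConstCLM ℂ x (𝓕 (P.symbolS k)))

/-- `lowFun n u` is the smooth function that represents the sum of the first `n` blocks of `u`.
With the shift of indices, `S_q u = ∑_{j=-1}^{q-1} Δ_j u` is `lowFun (q + 1) u`. -/
def lowFun (n : ℕ) (u : 𝓢'(ℝ, ℂ)) (x : ℝ) : ℂ :=
  ∑ j ∈ Finset.range n, P.blockFun j u x

end DyadicPartition

/-! ### Products of tempered distributions through Bony's decomposition -/

/-- `t` is the paraproduct `T_u v = ∑_{q ≥ -1} S_{q-1} u Δ_q v` (the series converges in `𝓢'`).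
Here `k = q + 1`, and `S_{q-1} u` is the sum of the first `k - 1` blocks of `u`
(it vanishes for `k = 0` and `k = 1`). -/
def IsParaproduct (P : DyadicPartition) (u v t : 𝓢'(ℝ, ℂ)) : Prop :=
  HasSum (fun k : ℕ ↦ smulLeftCLM ℂ (P.lowFun (k - 1) u) (P.block k v)) t

/-- `r` is the remainder `R(u, v) = ∑_{|q - q'| ≤ 1} Δ_q u Δ_{q'} v` (the series converges
in `𝓢'`). -/
def IsRemainder (P : DyadicPartition) (u v r : 𝓢'(ℝ, ℂ)) : Prop :=
  HasSum (fun i : {i : ℕ × ℕ // i.1 ≤ i.2 + 1 ∧ i.2 ≤ i.1 + 1} ↦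
    smulLeftCLM ℂ (P.blockFun i.1.1 u) (P.block i.1.2 v)) r

/-- `w` is the product of the tempered distributions `u` and `v`: for every dyadic partition of
unity the three series in Bony's decomposition converge in `𝓢'` and
`w = T_u v + T_v u + R(u, v)`. -/
def IsProduct (u v w : 𝓢'(ℝ, ℂ)) : Prop :=
  ∀ P : DyadicPartition, ∃ t₁ t₂ r : 𝓢'(ℝ, ℂ),
    IsParaproduct P u v t₁ ∧ IsParaproduct P v u t₂ ∧ IsRemainder P u v r ∧ w = t₁ + t₂ + r

/-- Agreement with the pointwise product: if `u` is (given by) an `L²` function `f` and `v` is an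
`L²` or an `L^∞` function `g`, then `w` is the function `f g`. -/
def AgreesWithPointwise (u v w : 𝓢'(ℝ, ℂ)) : Prop :=
  ∀ f : Lp ℂ 2 (volume : Measure ℝ), u = f →
    (∀ g : Lp ℂ 2 (volume : Measure ℝ), v = g → ∀ ψ : 𝓢(ℝ, ℂ), w ψ = ∫ x, ψ x * (f x * g x)) ∧
    (∀ g : Lp ℂ ∞ (volume : Measure ℝ), v = g → ∀ ψ : 𝓢(ℝ, ℂ), w ψ = ∫ x, ψ x * (f x * g x))

/-! ### Norms and spaces -/

section Lp

variable (p : ℝ≥0∞) [Fact (1 ≤ p)]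

/-- The `L^p` norm of a tempered distribution, `∞` if it is not given by an `L^p` function. -/
def normLp (u : 𝓢'(ℝ, ℂ)) : ℝ≥0∞ :=
  ⨅ (f : Lp ℂ p (volume : Measure ℝ)) (_ : u = f), ‖f‖ₑ

theorem normLp_coe_le (f : Lp ℂ p (volume : Measure ℝ)) : normLp p (f : 𝓢'(ℝ, ℂ)) ≤ ‖f‖ₑ :=
  iInf₂_le (f := fun (g : Lp ℂ p (volume : Measure ℝ))
    (_ : (f : 𝓢'(ℝ, ℂ)) = g) ↦ ‖g‖ₑ) f rfl

theorem normLp_lt_top_iff {u : 𝓢'(ℝ, ℂ)} :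
    normLp p u < ∞ ↔ ∃ f : Lp ℂ p (volume : Measure ℝ), u = f := by
  constructor
  · intro h
    simp only [normLp, iInf_lt_iff] at h
    obtain ⟨f, hf, -⟩ := h
    exact ⟨f, hf⟩
  · rintro ⟨f, rfl⟩
    exact (normLp_coe_le p f).trans_lt enorm_lt_top

theorem normLp_zero : normLp p (0 : 𝓢'(ℝ, ℂ)) = 0 := by
  have h : ((0 : Lp ℂ p (volume : Measure ℝ)) : 𝓢'(ℝ, ℂ)) = 0 := by
    rw [← Lp.toTemperedDistributionCLM_apply, map_zero]
  have := normLp_coe_le p (0 : Lp ℂ p (volume : Measure ℝ))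
  rw [h] at this
  simpa using this

theorem normLp_add_le (u v : 𝓢'(ℝ, ℂ)) : normLp p (u + v) ≤ normLp p u + normLp p v := by
  simp only [normLp, ENNReal.iInf_add, ENNReal.add_iInf]
  refine le_iInf₂ fun g hg ↦ le_iInf₂ fun f hf ↦ ?_
  have h : u + v = ((f + g : Lp ℂ p (volume : Measure ℝ)) : 𝓢'(ℝ, ℂ)) := by
    rw [← Lp.toTemperedDistributionCLM_apply, map_add, hf, hg]
    rfl
  exact (iInf₂_le (f + g) h).trans (enorm_add_le f g)

theorem normLp_smul_le (c : ℂ) (u : 𝓢'(ℝ, ℂ)) : normLp p (c • u) ≤ (‖c‖₊ : ℝ≥0∞) * normLp p u := by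
  by_cases hu : ∃ f : Lp ℂ p (volume : Measure ℝ), u = f
  · have key : ∀ f : Lp ℂ p (volume : Measure ℝ), u = f →
        normLp p (c • u) ≤ (‖c‖₊ : ℝ≥0∞) * ‖f‖ₑ := by
      intro f hf
      have h : c • u = ((c • f : Lp ℂ p (volume : Measure ℝ)) : 𝓢'(ℝ, ℂ)) := by
        rw [← Lp.toTemperedDistributionCLM_apply, map_smul, hf]
        rfl
      refine (iInf₂_le (c • f) h).trans (le_of_eq ?_)
      rw [enorm_smul]
      rfl
    obtain ⟨f, hf⟩ := hu
    have hinj : ∀ g : Lp ℂ p (volume : Measure ℝ), u = g → g = f := by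
      intro g hg
      have := LinearMap.ker_eq_bot.mp
        (Lp.ker_toTemperedDistributionCLM_eq_bot (F := ℂ) (μ := (volume : Measure ℝ)) (p := p))
      exact this (hg.symm.trans hf)
    have hval : ‖f‖ₑ ≤ normLp p u := le_iInf₂ fun g hg ↦ by rw [hinj g hg]
    exact (key f hf).trans (mul_le_mul_right hval _)
  · rcases eq_or_ne c 0 with rfl | hc
    · have h0 : (0 : ℂ) • u = 0 := by ext; simp
      rw [h0, normLp_zero]
      exact bot_le
    · have : normLp p u = ∞ := by
        by_contra h
        exact hu ((normLp_lt_top_iff p).1 (lt_top_iff_ne_top.2 h))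
      rw [this, ENNReal.mul_top (ENNReal.coe_ne_zero.2 (nnnorm_ne_zero_iff.2 hc))]
      exact le_top

/-- The space `L^p(ℝ)` as a space of tempered distributions. -/
def LpSpace : Submodule ℂ 𝓢'(ℝ, ℂ) where
  carrier := {u | normLp p u < ∞}
  zero_mem' := by simp [normLp_zero]
  add_mem' := fun {u v} hu hv ↦ (normLp_add_le p u v).trans_lt (ENNReal.add_lt_top.2 ⟨hu, hv⟩)
  smul_mem' := fun c u hu ↦
    (normLp_smul_le p c u).trans_lt (ENNReal.mul_lt_top ENNReal.coe_lt_top hu)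

end Lp

/-- The norm of the Sobolev space `H^s(ℝ)`: the `L²` norm of `(1 + D²)^{s/2} u`. -/
def sobolevNorm (s : ℝ) (u : 𝓢'(ℝ, ℂ)) : ℝ≥0∞ :=
  normLp 2 (besselPotential ℝ ℂ s u)

/-- The Sobolev space `H^s(ℝ)`. -/
def SobolevSpace (s : ℝ) : Submodule ℂ 𝓢'(ℝ, ℂ) where
  carrier := {u | MemSobolev s 2 u}
  zero_mem' := memSobolev_fun_zero ℝ ℂ s 2
  add_mem' := fun hu hv ↦ hu.add hv
  smul_mem' := fun c _ hu ↦ hu.smul c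

theorem mem_sobolevSpace_iff {s : ℝ} {u : 𝓢'(ℝ, ℂ)} :
    u ∈ SobolevSpace s ↔ sobolevNorm s u < ∞ :=
  (normLp_lt_top_iff 2).symm

section Besov

variable (P : DyadicPartition) (s : ℝ) (p r : ℝ≥0∞) [Fact (1 ≤ p)]

/-- The sequence `2^{qs} ‖Δ_q u‖_{L^p}`, `q = k - 1 ≥ -1`. -/
def besovSeq (u : 𝓢'(ℝ, ℂ)) (k : ℕ) : ℝ≥0∞ :=
  ENNReal.ofReal ((2 : ℝ) ^ (((k : ℝ) - 1) * s)) * normLp p (P.block k u)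

/-- The norm of the Besov space `B^s_{p,r}(ℝ)`: the `ℓ^r` norm of `besovSeq`. -/
def besovNorm (u : 𝓢'(ℝ, ℂ)) : ℝ≥0∞ :=
  eLpNorm (besovSeq P s p u) r Measure.count

theorem besovNorm_add_le [hr : Fact (1 ≤ r)] (u v : 𝓢'(ℝ, ℂ)) :
    besovNorm P s p r (u + v) ≤ besovNorm P s p r u + besovNorm P s p r v := by
  refine le_trans (eLpNorm_mono_enorm (g := besovSeq P s p u + besovSeq P s p v) fun k ↦ ?_)
    (eLpNorm_add_le (measurable_of_countable _).aestronglyMeasurable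
      (measurable_of_countable _).aestronglyMeasurable hr.out)
  simp only [enorm_eq_self, Pi.add_apply, besovSeq, ← mul_add, map_add]
  gcongr
  exact normLp_add_le p _ _

theorem besovNorm_smul_le (c : ℂ) (u : 𝓢'(ℝ, ℂ)) :
    besovNorm P s p r (c • u) ≤ (‖c‖₊ : ℝ≥0∞) * besovNorm P s p r u := by
  refine eLpNorm_le_nnreal_smul_eLpNorm_of_ae_le_mul' (Filter.Eventually.of_forall fun k ↦ ?_) r
  simp only [enorm_eq_self, besovSeq, map_smul]
  rw [mul_left_comm]
  gcongr
  exact normLp_smul_le p c _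

/-- The Besov space `B^s_{p,r}(ℝ)`. -/
def BesovSpace [Fact (1 ≤ r)] : Submodule ℂ 𝓢'(ℝ, ℂ) where
  carrier := {u | besovNorm P s p r u < ∞}
  zero_mem' := by
    have := besovNorm_smul_le P s p r 0 0
    have h0 : (0 : ℂ) • (0 : 𝓢'(ℝ, ℂ)) = 0 := by ext; simp
    rw [h0, nnnorm_zero, ENNReal.coe_zero, zero_mul] at this
    exact this.trans_lt ENNReal.zero_lt_top
  add_mem' := fun {u v} hu hv ↦
    (besovNorm_add_le P s p r u v).trans_lt (ENNReal.add_lt_top.2 ⟨hu, hv⟩)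
  smul_mem' := fun c u hu ↦
    (besovNorm_smul_le P s p r c u).trans_lt (ENNReal.mul_lt_top ENNReal.coe_lt_top hu)

end Besov

/-- The product `(u, v) ↦ u v` is well defined and bilinear continuous from `X × Y` to `Z`, where
the spaces `X`, `Y`, `Z` carry the norms `NX`, `NY`, `NZ`. -/
def ProductContinuous (X : Submodule ℂ 𝓢'(ℝ, ℂ)) (NX : 𝓢'(ℝ, ℂ) → ℝ≥0∞)
    (Y : Submodule ℂ 𝓢'(ℝ, ℂ)) (NY : 𝓢'(ℝ, ℂ) → ℝ≥0∞)
    (Z : Submodule ℂ 𝓢'(ℝ, ℂ)) (NZ : 𝓢'(ℝ, ℂ) → ℝ≥0∞) : Prop :=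
  ∃ B : X →ₗ[ℂ] Y →ₗ[ℂ] Z,
    (∀ (u : X) (v : Y), IsProduct u v (B u v)) ∧
    (∀ (u : X) (v : Y), AgreesWithPointwise u v (B u v)) ∧
    ∃ C : ℝ≥0, ∀ (u : X) (v : Y), NZ (B u v) ≤ C * NX u * NY v

end ProductLaws

end

/-! Everything rests on duality: a functional w on Schwartz space with |w(ψ)| ≤ C‖𝓕⁻ψ‖ in
L²(⟨ξ⟩^{-2s}dξ) is an element of H^s of norm at most C (`exists_sobolev_of_bound`). So each law
reduces to bounds on trilinear forms ∫ F G ψ, where F and G are the smooth functions that represent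
blocks, or sums of blocks, of u and v. For an arbitrary partition the spectra separate only after a
gap of M octaves. Bony's series are therefore compared with `farSum`, a paraproduct with gap M, and
`nearSum`, the pairs of blocks at distance at most M. A bound on farSum(u,v) + farSum(v,u) + 3
nearSum gives both the convergence of the three series (`exists_isProductAt`) and the estimate of
the total (`IsProductAt.enorm_apply_le`).

Independence of the partition: Bony's three index sets exhaust the squares of pairs of blocks, so
w(ψ) = lim ∫ S_n u S_n v ψ (`IsProductAt.tendsto`). This limit is then described without the
partition: as an absolutely convergent convolution integral (c, H^s with s > 1/2, and two L²
functions, which covers H^s ∩ L^∞), as ∫ f g ψ with f in L² and g bounded (b), or as a limit of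
products of L² functions (a). The same formula gives agreement with the pointwise product, and
uniqueness gives bilinearity.

The estimates for c) and for H^s with s > 1/2 bound ∫∫ |U(ξ) V(η) 𝓕⁻ψ(ξ+η)|. In c) the two largest
of the frequencies ξ, η, ξ+η are comparable, so the weights collapse to ⟨x⟩^{-p}⟨y⟩^{p-1/2} with x
the smallest and y a larger one. For p < 1/2 this kernel is square integrable in x uniformly in y,
and Cauchy–Schwarz concludes. For s > 1/2 the function ⟨x⟩^{-s} is itself square integrable.

For H^s ∩ L^∞ the operators S_n are uniformly bounded on L^∞, their kernels being dilates of a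
single one. The product S_{k-M}g Δ_k u has spectrum in an annulus of size 2^k, which allows every s.
The near-diagonal products have spectrum only in a ball of size 2^k, which needs s > 0; for s = 0
the inequality ‖fg‖₂ ≤ ‖f‖₂‖g‖_∞ suffices. In b) the terms not covered by the paraproduct by g are
summed with Δ_k g = O(2^{-k(s+ε)}) in L^∞ against a loss 2^{ks} from ψ.

In a) the boundedness of v is used only for the paraproduct by v. All other pairs of blocks have ⟨ξ⟩
≲ ⟨η⟩, and their sum is controlled on the frequency side by the L² tails of the Fourier transform of
v (`exists_lintegral_tail_besov_le`, `exists_lintegral_tail_le`). The argument is used for s and,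
with ξ and ξ+η exchanged, for -s; this is where |s| < 1/2 enters. -/

noncomputable section

namespace ProductLaws

/-! ### Weighted `L²` norms and Fourier representatives -/

/-- The weight `1 + ξ²`. -/
def jap (ξ : ℝ) : ℝ := 1 + ξ ^ 2

theorem one_le_jap (ξ : ℝ) : 1 ≤ jap ξ := by unfold jap; nlinarith [sq_nonneg ξ]

theorem jap_pos (ξ : ℝ) : 0 < jap ξ := zero_lt_one.trans_le (one_le_jap ξ)

theorem jap_neg (ξ : ℝ) : jap (-ξ) = jap ξ := by simp [jap]

theorem continuous_jap : Continuous jap := by unfold jap; fun_prop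

/-- The power `(1 + ξ²)^r` as an extended nonnegative real. -/
def jw (r : ℝ) (ξ : ℝ) : ℝ≥0∞ := ENNReal.ofReal (jap ξ ^ r)

@[fun_prop]
theorem measurable_jw (r : ℝ) : Measurable (jw r) := by
  unfold jw
  exact ((continuous_jap.measurable).pow_const r).ennreal_ofReal

theorem jw_add (r t ξ : ℝ) : jw (r + t) ξ = jw r ξ * jw t ξ := by
  rw [jw, Real.rpow_add (jap_pos ξ), ENNReal.ofReal_mul (Real.rpow_nonneg (jap_pos ξ).le _)]; rfl

theorem jw_zero (ξ : ℝ) : jw 0 ξ = 1 := by simp [jw]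

theorem jw_neg_mul (r ξ : ℝ) : jw (-r) ξ * jw r ξ = 1 := by
  rw [← jw_add, neg_add_cancel, jw_zero]

theorem jw_sq (r ξ : ℝ) : jw r ξ ^ 2 = jw (2 * r) ξ := by
  rw [sq, ← jw_add, two_mul]

theorem jw_even (r ξ : ℝ) : jw r (-ξ) = jw r ξ := by rw [jw, jap_neg]; rfl

theorem jw_mono {r t : ℝ} (h : r ≤ t) (ξ : ℝ) : jw r ξ ≤ jw t ξ :=
  ENNReal.ofReal_le_ofReal (Real.rpow_le_rpow_of_exponent_le (one_le_jap ξ) h)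

/-- The `L²` norm of a nonnegative function. -/
def n2 {α : Type*} [MeasurableSpace α] (μ : Measure α) (f : α → ℝ≥0∞) : ℝ≥0∞ :=
  (∫⁻ x, f x ^ 2 ∂μ) ^ (1 / 2 : ℝ)

section n2

variable {α : Type*} [MeasurableSpace α] {μ : Measure α}

theorem n2_sq (f : α → ℝ≥0∞) : n2 μ f ^ 2 = ∫⁻ x, f x ^ 2 ∂μ := by
  rw [n2, ← ENNReal.rpow_natCast, ← ENNReal.rpow_mul]; norm_num

theorem n2_mono {f g : α → ℝ≥0∞} (h : ∀ x, f x ≤ g x) : n2 μ f ≤ n2 μ g := by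
  unfold n2
  gcongr with x
  exact h x

theorem n2_le_of_sq_le {f : α → ℝ≥0∞} {C : ℝ≥0∞} (h : ∫⁻ x, f x ^ 2 ∂μ ≤ C ^ 2) :
    n2 μ f ≤ C := by
  rw [← n2_sq] at h
  exact (ENNReal.pow_le_pow_left_iff two_ne_zero).1 h

theorem n2_const_mul {C : ℝ≥0∞} (hC : C ≠ ∞) (f : α → ℝ≥0∞) :
    n2 μ (fun x ↦ C * f x) = C * n2 μ f := by
  have h : n2 μ (fun x ↦ C * f x) ^ 2 = (C * n2 μ f) ^ 2 := by
    rw [mul_pow, n2_sq, n2_sq, ← lintegral_const_mul' _ _ (ENNReal.pow_ne_top hC)]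
    simp only [mul_pow]
  exact (ENNReal.pow_right_strictMono two_ne_zero).injective h

theorem lintegral_mul_le_n2 {f g : α → ℝ≥0∞} (hf : AEMeasurable f μ) (hg : AEMeasurable g μ) :
    ∫⁻ x, f x * g x ∂μ ≤ n2 μ f * n2 μ g := by
  have := ENNReal.lintegral_mul_le_Lp_mul_Lq μ (p := 2) (q := 2)
    (by constructor <;> norm_num) hf hg
  simpa [n2] using this

theorem n2_eq_eLpNorm {F : α → ℂ} : n2 μ (fun x ↦ ‖F x‖ₑ) = eLpNorm F 2 μ := by
  rw [eLpNorm_eq_lintegral_rpow_enorm_toReal (by norm_num) (by norm_num), n2]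
  simp

/-- The Cauchy–Schwarz inequality for series. -/
theorem tsum_mul_le_sqrt {x y : ℕ → ℝ≥0∞} :
    ∑' k, x k * y k ≤ (∑' k, x k ^ 2) ^ (1 / 2 : ℝ) * (∑' k, y k ^ 2) ^ (1 / 2 : ℝ) := by
  have := lintegral_mul_le_n2 (μ := Measure.count) (f := x) (g := y)
    (measurable_of_countable _).aemeasurable (measurable_of_countable _).aemeasurable
  simpa [n2, lintegral_count] using this

end n2

/-- The norm of a nonnegative function in the weighted space `L²((1 + ξ²)^s dξ)`. -/
def wN (s : ℝ) (f : ℝ → ℝ≥0∞) : ℝ≥0∞ := n2 volume (fun ξ ↦ jw (s / 2) ξ * f ξ)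

theorem wN_sq (s : ℝ) (f : ℝ → ℝ≥0∞) : wN s f ^ 2 = ∫⁻ ξ, jw s ξ * f ξ ^ 2 := by
  simp only [wN, n2_sq, mul_pow, jw_sq]
  congr! 3
  ring_nf

theorem wN_mono {s t : ℝ} (h : s ≤ t) {f g : ℝ → ℝ≥0∞} (hfg : ∀ ξ, f ξ ≤ g ξ) :
    wN s f ≤ wN t g :=
  n2_mono fun ξ ↦ mul_le_mul' (jw_mono (by linarith) ξ) (hfg ξ)

theorem wN_zero_eq (f : ℝ → ℝ≥0∞) : wN 0 f = n2 volume f := by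
  simp [wN, jw_zero]

/-- The symbol of the Bessel potential of order `s`. -/
def besselSymbol (s : ℝ) : ℝ → ℂ := fun x ↦ ((1 + ‖x‖ ^ 2) ^ (s / 2) : ℝ)

theorem hasTemperateGrowth_besselSymbol (s : ℝ) : (besselSymbol s).HasTemperateGrowth := by
  unfold besselSymbol
  fun_prop

theorem enorm_besselSymbol (s ξ : ℝ) : ‖besselSymbol s ξ‖ₑ = jw (s / 2) ξ := by
  rw [besselSymbol, ← ofReal_norm, Complex.norm_real, Real.norm_of_nonneg (by positivity),
    Real.norm_eq_abs, sq_abs]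
  rfl

theorem besselSymbol_mul_neg (s : ℝ) : besselSymbol s * besselSymbol (-s) = fun _ ↦ 1 := by
  ext x
  simp only [besselSymbol, Pi.mul_apply, ← Complex.ofReal_mul]
  rw [← Real.rpow_add (by positivity)]
  simp [neg_div]

theorem wN_schwartz_lt_top (s : ℝ) (ψ : 𝓢(ℝ, ℂ)) : wN s (fun ξ ↦ ‖ψ ξ‖ₑ) < ∞ := by
  have hg := hasTemperateGrowth_besselSymbol s
  have h : wN s (fun ξ ↦ ‖ψ ξ‖ₑ)
      = eLpNorm (SchwartzMap.smulLeftCLM ℂ (besselSymbol s) ψ) 2 volume := by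
    rw [← n2_eq_eLpNorm]
    unfold wN
    congr 1
    ext ξ
    rw [SchwartzMap.smulLeftCLM_apply_apply hg, enorm_smul, enorm_besselSymbol]
  rw [h]
  exact (SchwartzMap.memLp (SchwartzMap.smulLeftCLM ℂ (besselSymbol s) ψ) 2 volume).2

theorem enorm_fourier_eq (f : Lp ℂ 2 (volume : Measure ℝ)) : ‖𝓕 f‖ₑ = ‖f‖ₑ := by
  rw [← ofReal_norm, ← ofReal_norm, Lp.norm_fourier_eq]

theorem normLp_coe (p : ℝ≥0∞) [Fact (1 ≤ p)] (f : Lp ℂ p (volume : Measure ℝ)) :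
    normLp p (f : 𝓢'(ℝ, ℂ)) = ‖f‖ₑ := by
  refine le_antisymm (normLp_coe_le p f) (le_iInf₂ fun g hg ↦ ?_)
  have := LinearMap.ker_eq_bot.mp
    (Lp.ker_toTemperedDistributionCLM_eq_bot (F := ℂ) (μ := (volume : Measure ℝ)) (p := p))
  rw [this hg]

/-- The function `U` represents the Fourier transform of the tempered distribution `u`. -/
structure FourierRep (u : 𝓢'(ℝ, ℂ)) (U : ℝ → ℂ) : Prop where
  measurable : Measurable U
  integrable : ∀ φ : 𝓢(ℝ, ℂ), Integrable (fun ξ ↦ U ξ * φ ξ)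
  rep : ∀ φ : 𝓢(ℝ, ℂ), u φ = ∫ ξ, U ξ * 𝓕⁻ φ ξ

theorem integrable_lp_mul_schwartz {p : ℝ≥0∞} [hp : Fact (1 ≤ p)]
    (f : Lp ℂ p (volume : Measure ℝ)) (φ : 𝓢(ℝ, ℂ)) : Integrable (fun ξ ↦ f ξ * φ ξ) := by
  have := ENNReal.HolderConjugate.inv_one_sub_inv' hp.out
  exact (Lp.memLp f).integrable_mul (φ.memLp _ volume) (p := p) (q := (1 - p⁻¹)⁻¹)

/-- The Bessel potential multiplies the Fourier transform by the nowhere vanishing weight ⟨ξ⟩^s.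
Dividing the L² transform F of the potential by this weight represents 𝓕 u, and Plancherel turns the
Sobolev norm into a weighted L² norm. -/
theorem exists_fourierRep {s : ℝ} {u : 𝓢'(ℝ, ℂ)} (hu : u ∈ SobolevSpace s) :
    ∃ U, FourierRep u U ∧ wN s (fun ξ ↦ ‖U ξ‖ₑ) = sobolevNorm s u := by
  obtain ⟨f, hf⟩ := hu
  have hF : smulLeftCLM ℂ (besselSymbol s) (𝓕 u)
      = (𝓕 f : Lp ℂ 2 (volume : Measure ℝ)) := by
    rw [← Lp.fourier_toTemperedDistribution_eq, ← hf,
      fourier_besselPotential_eq_smulLeftCLM_fourier_apply]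
    rfl
  set F : Lp ℂ 2 (volume : Measure ℝ) := 𝓕 f
  set g := besselSymbol s
  set g' := besselSymbol (-s)
  have hg : g.HasTemperateGrowth := hasTemperateGrowth_besselSymbol s
  have hg' : g'.HasTemperateGrowth := hasTemperateGrowth_besselSymbol (-s)
  have hgg : g * g' = fun _ ↦ 1 := besselSymbol_mul_neg s
  have hu' : 𝓕 u = smulLeftCLM ℂ g' (F : 𝓢'(ℝ, ℂ)) := by
    rw [← hF, smulLeftCLM_smulLeftCLM_apply hg hg', hgg]
    simp
  refine ⟨fun ξ ↦ g' ξ * F ξ, ⟨?_, ?_, ?_⟩, ?_⟩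
  · exact hg'.1.continuous.measurable.mul (Lp.stronglyMeasurable F).measurable
  · intro φ
    have := integrable_lp_mul_schwartz F (SchwartzMap.smulLeftCLM ℂ g' φ)
    refine this.congr (Filter.Eventually.of_forall fun ξ ↦ ?_)
    simp only [SchwartzMap.smulLeftCLM_apply_apply hg', smul_eq_mul]
    ring
  · intro φ
    have h1 : u φ = (𝓕 u) (𝓕⁻ φ) := by
      rw [TemperedDistribution.fourier_apply, FourierTransform.fourier_fourierInv_eq]
    rw [h1, hu', smulLeftCLM_apply_apply, Lp.toTemperedDistribution_apply]
    congr 1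
    ext ξ
    simp only [SchwartzMap.smulLeftCLM_apply_apply hg', smul_eq_mul]
    ring
  · rw [sobolevNorm, hf, normLp_coe, ← enorm_fourier_eq, Lp.enorm_def, ← n2_eq_eLpNorm]
    unfold wN
    congr 1
    ext ξ
    have : (g ξ * g' ξ) = 1 := congrFun hgg ξ
    rw [← enorm_besselSymbol, ← enorm_mul, ← mul_assoc, this, one_mul]

/-- A linear functional on Schwartz space that is bounded in a negative Sobolev norm is given by an
element of the dual Sobolev space. -/
theorem exists_sobolev_of_bound {s : ℝ} (L : 𝓢(ℝ, ℂ) →ₗ[ℂ] ℂ) (C : ℝ≥0)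
    (hL : ∀ ψ, ‖L ψ‖ₑ ≤ C * wN (-s) (fun ξ ↦ ‖𝓕⁻ ψ ξ‖ₑ)) :
    ∃ w : 𝓢'(ℝ, ℂ), (∀ ψ, w ψ = L ψ) ∧ w ∈ SobolevSpace s ∧ sobolevNorm s w ≤ C := by
  set g := besselSymbol s
  set g' := besselSymbol (-s)
  have hg : g.HasTemperateGrowth := hasTemperateGrowth_besselSymbol s
  have hg' : g'.HasTemperateGrowth := hasTemperateGrowth_besselSymbol (-s)
  have hgg : g * g' = fun _ ↦ 1 := besselSymbol_mul_neg s
  -- `A` is the Fourier multiplier that cancels the weight in the hypothesis: `L ∘ A` is bounded in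
  -- the unweighted L² norm.
  let A : 𝓢(ℝ, ℂ) →ₗ[ℂ] 𝓢(ℝ, ℂ) :=
    { toFun := fun φ ↦ 𝓕 (SchwartzMap.smulLeftCLM ℂ g (𝓕⁻ φ))
      map_add' := fun a b ↦ by simp [FourierTransform.fourier_add, FourierTransform.fourierInv_add]
      map_smul' := fun c a ↦ by
        simp [FourierTransform.fourier_smul, FourierTransform.fourierInv_smul] }
  have hA : ∀ φ, ‖L (A φ)‖ ≤ C * ‖SchwartzMap.toLpCLM ℂ ℂ 2 (volume : Measure ℝ) φ‖ := by
    intro φ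
    have h1 : wN (-s) (fun ξ ↦ ‖𝓕⁻ (A φ) ξ‖ₑ) = ‖φ.toLp 2 volume‖ₑ := by
      have h2 : ‖φ.toLp 2 volume‖ₑ = ‖(𝓕⁻ φ).toLp 2 (volume : Measure ℝ)‖ₑ := by
        rw [← SchwartzMap.toLp_fourierInv_eq, ← enorm_fourier_eq (𝓕⁻ _),
          FourierTransform.fourier_fourierInv_eq]
      rw [h2, Lp.enorm_def, eLpNorm_congr_ae ((𝓕⁻ φ).coeFn_toLp 2 volume), ← n2_eq_eLpNorm]
      unfold wN
      congr 1
      ext ξ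
      have : (g ξ * g' ξ) = 1 := congrFun hgg ξ
      rw [← enorm_besselSymbol, ← enorm_mul]
      simp only [A, LinearMap.coe_mk, AddHom.coe_mk, FourierTransform.fourierInv_fourier_eq,
        SchwartzMap.smulLeftCLM_apply_apply hg, smul_eq_mul]
      rw [← mul_assoc, mul_comm (g' ξ), this, one_mul]
    have h3 := hL (A φ)
    rw [h1] at h3
    have h4 := ENNReal.toReal_mono (by finiteness) h3
    simpa using h4
  -- Schwartz functions are dense in L², so `L ∘ A` extends and the Riesz theorem applies.
  set ℓ : Lp ℂ 2 (volume : Measure ℝ) →L[ℂ] ℂ :=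
    (L ∘ₗ A).extendOfNorm (SchwartzMap.toLpCLM ℂ ℂ 2 (volume : Measure ℝ)).toLinearMap with hℓ
  have hdense : DenseRange (SchwartzMap.toLpCLM ℂ ℂ 2 (volume : Measure ℝ)) :=
    SchwartzMap.denseRange_toLpCLM (E := ℝ) (F := ℂ) (p := 2)
    (μ := volume) ENNReal.ofNat_ne_top
  have hℓ1 : ∀ φ : 𝓢(ℝ, ℂ), ℓ (φ.toLp 2 volume) = L (A φ) := fun φ ↦
    LinearMap.extendOfNorm_eq hdense ⟨C, hA⟩ φ
  have hℓ2 : ‖ℓ‖ ≤ C := LinearMap.opNorm_extendOfNorm_le hdense C.2 hA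
  -- The pairing of distributions is bilinear while the inner product is sesquilinear, hence the
  -- conjugate of the Riesz vector.
  set h : Lp ℂ 2 (volume : Measure ℝ) := star ((InnerProductSpace.toDual ℂ _).symm ℓ) with hh
  have hnorm : ‖h‖ ≤ C := by
    have h1 : ‖h‖ = ‖(InnerProductSpace.toDual ℂ (Lp ℂ 2 (volume : Measure ℝ))).symm ℓ‖ := by
      rw [hh, Lp.norm_def, Lp.norm_def, eLpNorm_congr_ae (Lp.coeFn_star _)]
      simp
    rw [h1, LinearIsometryEquiv.norm_map]
    exact hℓ2
  have hrep : ∀ φ : 𝓢(ℝ, ℂ), (h : 𝓢'(ℝ, ℂ)) φ = L (A φ) := by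
    intro φ
    rw [← hℓ1, ← InnerProductSpace.toDual_symm_apply, L2.inner_def, Lp.toTemperedDistribution_apply]
    apply integral_congr_ae
    filter_upwards [φ.coeFn_toLp 2 volume,
      Lp.coeFn_star ((InnerProductSpace.toDual ℂ _).symm ℓ)] with x hx hx2
    rw [hx, hh, hx2]
    simp
  refine ⟨besselPotential ℝ ℂ (-s) h, ?_, ?_, ?_⟩
  · intro ψ
    rw [besselPotential, fourierMultiplierCLM_apply_apply, hrep]
    congr 1
    simp only [A, LinearMap.coe_mk, AddHom.coe_mk, FourierTransform.fourierInv_fourier_eq]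
    change 𝓕 (SchwartzMap.smulLeftCLM ℂ g (SchwartzMap.smulLeftCLM ℂ g' (𝓕⁻ ψ))) = ψ
    rw [SchwartzMap.smulLeftCLM_smulLeftCLM_apply hg hg', hgg]
    simp
  · refine ⟨h, ?_⟩
    simp
  · rw [sobolevNorm, besselPotential_besselPotential_apply]
    simp only [neg_add_cancel, besselPotential_zero, ContinuousLinearMap.coe_id', id_eq, normLp_coe]
    rw [← ofReal_norm, ← ENNReal.ofReal_coe_nnreal]
    exact ENNReal.ofReal_le_ofReal hnorm

end ProductLaws

end

noncomputable section

namespace ProductLaws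

/-! ### Regular distributions and the functions that represent their blocks -/

/-- The character `t ↦ e^{2πit}`. -/
def ech (t : ℝ) : ℂ := (Real.fourierChar t : ℂ)

theorem ech_add (s t : ℝ) : ech (s + t) = ech s * ech t := by
  simp [ech, AddChar.map_add_eq_mul]

@[simp] theorem norm_ech (t : ℝ) : ‖ech t‖ = 1 := Circle.norm_coe _

@[fun_prop]
theorem continuous_ech : Continuous ech :=
  continuous_subtype_val.comp Real.continuous_fourierChar

theorem fourierInv_apply (W : ℝ → ℂ) (x : ℝ) : 𝓕⁻ W x = ∫ ξ, ech (x * ξ) * W ξ := by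
  rw [Real.fourierInv_eq]
  rfl

theorem fourier_apply (W : ℝ → ℂ) (x : ℝ) : 𝓕 W x = ∫ ξ, ech (-(x * ξ)) * W ξ := by
  rw [Real.fourier_eq]
  rfl

theorem schwartz_fourierInv_apply (φ : 𝓢(ℝ, ℂ)) (x : ℝ) :
    (𝓕⁻ φ) x = ∫ ξ, ech (x * ξ) * φ ξ := by
  rw [← fourierInv_apply, SchwartzMap.fourierInv_coe]

theorem schwartz_fourier_apply (φ : 𝓢(ℝ, ℂ)) (x : ℝ) :
    (𝓕 φ) x = ∫ ξ, ech (-(x * ξ)) * φ ξ := by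
  rw [← fourier_apply, SchwartzMap.fourier_coe]

theorem integrable_ech_mul {W : ℝ → ℂ} (hW : Integrable W) (x : ℝ) :
    Integrable (fun ξ ↦ ech (x * ξ) * W ξ) := by
  refine hW.bdd_mul (c := 1) ?_ ?_
  · exact (continuous_ech.comp (by fun_prop)).aestronglyMeasurable
  · exact Filter.Eventually.of_forall fun ξ ↦ (norm_ech _).le

theorem norm_fourierInv_le (W : ℝ → ℂ) (x : ℝ) : ‖𝓕⁻ W x‖ ≤ ∫ ξ, ‖W ξ‖ := by
  rw [fourierInv_apply]
  refine (norm_integral_le_integral_norm _).trans (le_of_eq ?_)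
  simp

theorem continuous_fourierInv {W : ℝ → ℂ} (hW : Integrable W) : Continuous (𝓕⁻ W) := by
  have : 𝓕⁻ W = fun x ↦ ∫ ξ, ech (x * ξ) * W ξ := funext fun x ↦ fourierInv_apply W x
  rw [this]
  refine continuous_of_dominated (bound := fun ξ ↦ ‖W ξ‖) (fun x ↦ ?_) (fun x ↦ ?_) hW.norm ?_
  · exact (integrable_ech_mul hW x).aestronglyMeasurable
  · exact Filter.Eventually.of_forall fun ξ ↦ by simp
  · exact Filter.Eventually.of_forall fun ξ ↦ by fun_prop

theorem integrable_ech_mul_prod {W φ : ℝ → ℂ} (hW : Integrable W) (hφ : Integrable φ) :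
    Integrable (fun p : ℝ × ℝ ↦ ech (p.1 * p.2) * (W p.2 * φ p.1)) (volume.prod volume) := by
  have h : Integrable (fun p : ℝ × ℝ ↦ φ p.1 * W p.2) (volume.prod volume) := hφ.mul_prod hW
  refine (h.bdd_mul (c := 1) (f := fun p : ℝ × ℝ ↦ ech (p.1 * p.2)) ?_ ?_).congr ?_
  · exact (continuous_ech.comp (by fun_prop)).aestronglyMeasurable
  · exact Filter.Eventually.of_forall fun ξ ↦ (norm_ech _).le
  · exact Filter.Eventually.of_forall fun p ↦ by simp only; ring

/-- The inverse Fourier transform is self-adjoint. -/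
theorem integral_fourierInv_mul_comm {W φ : ℝ → ℂ} (hW : Integrable W) (hφ : Integrable φ) :
    ∫ ξ, W ξ * 𝓕⁻ φ ξ = ∫ x, 𝓕⁻ W x * φ x := by
  simp only [fourierInv_apply, ← integral_const_mul, ← integral_mul_const]
  rw [integral_integral_swap]
  · congr 1
    ext x
    congr 1
    ext ξ
    rw [mul_comm x ξ]
    ring
  · refine (integrable_ech_mul_prod hφ hW).congr (Filter.Eventually.of_forall fun p ↦ ?_)
    simp only [Function.uncurry]
    ring

/-- The trilinear form `∫ 𝓕⁻W₁ 𝓕⁻W₂ ψ` on the frequency side. -/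
theorem integral_fourierInv_mul_mul {W₁ W₂ : ℝ → ℂ} (h₁ : Integrable W₁) (h₂ : Integrable W₂)
    (ψ : 𝓢(ℝ, ℂ)) :
    ∫ x, 𝓕⁻ W₁ x * 𝓕⁻ W₂ x * ψ x = ∫ ξ, ∫ η, W₁ ξ * W₂ η * 𝓕⁻ ψ (ξ + η) := by
  have hb : Integrable (fun x ↦ 𝓕⁻ W₂ x * ψ x) :=
    ψ.integrable.bdd_mul (c := ∫ ξ, ‖W₂ ξ‖) (continuous_fourierInv h₂).aestronglyMeasurable
      (Filter.Eventually.of_forall fun x ↦ norm_fourierInv_le W₂ x)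
  have h := integral_fourierInv_mul_comm h₁ hb
  simp only [mul_assoc] at h ⊢
  rw [← h]
  congr 1
  ext ξ
  rw [integral_const_mul]
  congr 1
  rw [fourierInv_apply]
  have hc : Integrable (fun x ↦ ech (ξ * x) * ψ x) := integrable_ech_mul ψ.integrable ξ
  have h' := integral_fourierInv_mul_comm h₂ hc
  rw [show (∫ x, ech (ξ * x) * (𝓕⁻ W₂ x * ψ x)) = ∫ x, 𝓕⁻ W₂ x * (ech (ξ * x) * ψ x) by
    congr 1; ext x; ring, ← h']
  congr 1
  ext η
  rw [fourierInv_apply, schwartz_fourierInv_apply]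
  congr 2
  ext x
  rw [← mul_assoc, ← ech_add]
  congr 2
  ring

/-- The smooth function `x ↦ ⟨u, κ(· - x)⟩`. -/
def genFun (κ : 𝓢(ℝ, ℂ)) (u : 𝓢'(ℝ, ℂ)) (x : ℝ) : ℂ := u (SchwartzMap.compSubConstCLM ℂ x κ)

theorem genFun_sum_left {ι : Type*} (s : Finset ι) (κ : ι → 𝓢(ℝ, ℂ)) (u : 𝓢'(ℝ, ℂ)) (x : ℝ) :
    genFun (∑ i ∈ s, κ i) u x = ∑ i ∈ s, genFun (κ i) u x := by
  simp [genFun]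

theorem genFun_add_right (κ : 𝓢(ℝ, ℂ)) (u v : 𝓢'(ℝ, ℂ)) (x : ℝ) :
    genFun κ (u + v) x = genFun κ u x + genFun κ v x := rfl

theorem genFun_smul_right (κ : 𝓢(ℝ, ℂ)) (c : ℂ) (u : 𝓢'(ℝ, ℂ)) (x : ℝ) :
    genFun κ (c • u) x = c * genFun κ u x := rfl

/-- A distribution whose regularizations are functions of temperate growth that represent it. -/
structure Regular (u : 𝓢'(ℝ, ℂ)) : Prop where
  growth : ∀ κ : 𝓢(ℝ, ℂ), (genFun κ u).HasTemperateGrowth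
  rep : ∀ θ φ : 𝓢(ℝ, ℂ), u (𝓕 (SchwartzMap.smulLeftCLM ℂ θ (𝓕⁻ φ))) =
    ∫ x, genFun (𝓕 θ) u x * φ x

theorem Regular.add {u v : 𝓢'(ℝ, ℂ)} (hu : Regular u) (hv : Regular v) : Regular (u + v) where
  growth κ := (hu.growth κ).add (hv.growth κ)
  rep θ φ := by
    have h (u : 𝓢'(ℝ, ℂ)) (hu : Regular u) : Integrable (fun x ↦ genFun (𝓕 θ) u x * φ x) := by
      have := (SchwartzMap.smulLeftCLM ℂ (genFun (𝓕 θ) u) φ).integrable (μ := volume)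
      simpa [SchwartzMap.smulLeftCLM_apply (hu.growth _)] using this
    rw [show (u + v) (𝓕 (SchwartzMap.smulLeftCLM ℂ θ (𝓕⁻ φ))) =
      u (𝓕 (SchwartzMap.smulLeftCLM ℂ θ (𝓕⁻ φ))) + v (𝓕 (SchwartzMap.smulLeftCLM ℂ θ (𝓕⁻ φ)))
      from rfl, hu.rep, hv.rep, ← integral_add (h u hu) (h v hv)]
    simp [genFun_add_right, add_mul]

/-- A family of bounded functions that is closed under differentiation consists of functions of
temperate growth. -/
theorem hasTemperateGrowth_of_class (S : Set (ℝ → ℂ)) (hb : ∀ F ∈ S, ∃ C, ∀ x, ‖F x‖ ≤ C)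
    (hd : ∀ F ∈ S, ∃ G ∈ S, ∀ x, HasDerivAt F (G x) x) (F : ℝ → ℂ) (hF : F ∈ S) :
    F.HasTemperateGrowth := by
  have hi : ∀ n : ℕ, ∀ F ∈ S, iteratedDeriv n F ∈ S := by
    intro n
    induction n with
    | zero => intro F hF; simpa using hF
    | succ n ih =>
      intro F hF
      obtain ⟨G, hG, hFG⟩ := hd F hF
      rw [iteratedDeriv_succ', show deriv F = G from funext fun x ↦ (hFG x).deriv]
      exact ih G hG
  refine ⟨?_, fun n ↦ ?_⟩
  · refine contDiff_of_differentiable_iteratedDeriv fun n _ ↦ ?_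
    obtain ⟨G, -, hG⟩ := hd _ (hi n F hF)
    exact fun x ↦ (hG x).differentiableAt
  · obtain ⟨C, hC⟩ := hb _ (hi n F hF)
    exact ⟨0, C, fun x ↦ by simpa [norm_iteratedFDeriv_eq_norm_iteratedDeriv] using hC x⟩

theorem fourierInv_compSubConst (κ : 𝓢(ℝ, ℂ)) (x ξ : ℝ) :
    𝓕⁻ (SchwartzMap.compSubConstCLM ℂ x κ) ξ = ech (x * ξ) * 𝓕⁻ κ ξ := by
  rw [schwartz_fourierInv_apply, schwartz_fourierInv_apply, ← integral_const_mul,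
    ← integral_sub_right_eq_self (fun y ↦ ech (x * ξ) * (ech (ξ * y) * κ y)) x]
  congr 1
  ext y
  rw [SchwartzMap.compSubConstCLM_apply, ← mul_assoc, ← ech_add]
  congr 2
  ring

theorem FourierRep.genFun_eq {u : 𝓢'(ℝ, ℂ)} {U : ℝ → ℂ} (h : FourierRep u U) (κ : 𝓢(ℝ, ℂ))
    (x : ℝ) : genFun κ u x = 𝓕⁻ (fun ξ ↦ U ξ * 𝓕⁻ κ ξ) x := by
  rw [genFun, h.rep, fourierInv_apply]
  congr 1
  ext ξ
  rw [fourierInv_compSubConst]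
  ring

/-- The regularizations are the functions 𝓕⁻(Uθ) with θ Schwartz. They are bounded because Uθ is
integrable, and differentiation replaces θ by 2πiξθ, so the family is closed under derivatives. The
representation formula is Fubini. -/
theorem FourierRep.regular {u : 𝓢'(ℝ, ℂ)} {U : ℝ → ℂ} (h : FourierRep u U) : Regular u where
  growth κ := by
    refine hasTemperateGrowth_of_class {F | ∃ θ : 𝓢(ℝ, ℂ), F = 𝓕⁻ (fun ξ ↦ U ξ * θ ξ)} ?_ ?_ _
      ⟨𝓕⁻ κ, funext (h.genFun_eq κ)⟩
    · rintro _ ⟨θ, rfl⟩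
      exact ⟨_, norm_fourierInv_le _⟩
    · rintro _ ⟨θ, rfl⟩
      have hg : (fun ξ : ℝ ↦ (2 * Real.pi * Complex.I * (ξ : ℂ) : ℂ)).HasTemperateGrowth := by
        fun_prop
      refine ⟨_, ⟨SchwartzMap.smulLeftCLM ℂ (fun ξ : ℝ ↦ (2 * Real.pi * Complex.I * (ξ : ℂ) : ℂ)) θ,
        rfl⟩, fun x ↦ ?_⟩
      have hg1 : (fun ξ : ℝ ↦ (ξ : ℂ)).HasTemperateGrowth := by fun_prop
      have h1 := h.integrable (SchwartzMap.smulLeftCLM ℂ (fun ξ : ℝ ↦ (ξ : ℂ)) θ)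
      have h2 : Integrable (fun ξ : ℝ ↦ ξ • (U ξ * θ ξ)) := by
        refine h1.congr (Filter.Eventually.of_forall fun ξ ↦ ?_)
        simp only [SchwartzMap.smulLeftCLM_apply_apply hg1, smul_eq_mul, Complex.real_smul]
        ring
      have h3 := (Real.hasDerivAt_fourier (h.integrable θ) h2 (-x)).scomp x (hasDerivAt_neg x)
      have h4 : 𝓕 (fun ξ ↦ U ξ * θ ξ) ∘ Neg.neg = 𝓕⁻ (fun ξ ↦ U ξ * θ ξ) := by
        ext y
        rw [Real.fourierInv_eq_fourier_neg]
        rfl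
      rw [h4] at h3
      refine h3.congr_deriv ?_
      rw [Real.fourierInv_eq_fourier_neg, neg_smul, one_smul, fourier_apply, fourier_apply,
        ← integral_neg]
      congr 1
      ext ξ
      simp only [SchwartzMap.smulLeftCLM_apply_apply hg, smul_eq_mul]
      ring
  rep θ φ := by
    rw [h.rep, FourierTransform.fourierInv_fourier_eq]
    simp only [h.genFun_eq, FourierTransform.fourierInv_fourier_eq]
    rw [← integral_fourierInv_mul_comm (h.integrable θ) φ.integrable]
    congr 1
    ext ξ
    rw [SchwartzMap.smulLeftCLM_apply_apply θ.hasTemperateGrowth, ← SchwartzMap.fourierInv_coe]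
    simp only [smul_eq_mul]
    ring

end ProductLaws

end

noncomputable section

namespace ProductLaws

/-! ### Bounded functions -/

theorem ae_enorm_le_Linfty (g : Lp ℂ ∞ (volume : Measure ℝ)) : ∀ᵐ y, ‖g y‖ₑ ≤ ‖g‖ₑ := by
  rw [Lp.enorm_def, eLpNorm_exponent_top]
  exact ae_le_eLpNormEssSup

theorem ae_norm_le_Linfty (g : Lp ℂ ∞ (volume : Measure ℝ)) : ∀ᵐ y, ‖g y‖ ≤ ‖g‖ := by
  filter_upwards [ae_enorm_le_Linfty g] with y hy
  rwa [enorm_le_iff_norm_le] at hy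

theorem genFun_Linfty (κ : 𝓢(ℝ, ℂ)) (g : Lp ℂ ∞ (volume : Measure ℝ)) (x : ℝ) :
    genFun κ (g : 𝓢'(ℝ, ℂ)) x = ∫ y, g y * κ (y - x) := by
  rw [genFun, Lp.toTemperedDistribution_apply]
  congr 1
  ext y
  simp [mul_comm]

theorem enorm_genFun_Linfty_le (κ : 𝓢(ℝ, ℂ)) (g : Lp ℂ ∞ (volume : Measure ℝ)) (x : ℝ) :
    ‖genFun κ (g : 𝓢'(ℝ, ℂ)) x‖ₑ ≤ ‖g‖ₑ * ∫⁻ y, ‖κ y‖ₑ := by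
  rw [genFun_Linfty]
  refine (enorm_integral_le_lintegral_enorm _).trans ?_
  rw [← lintegral_sub_right_eq_self (fun y ↦ ‖κ y‖ₑ) x,
    ← lintegral_const_mul' _ _ enorm_ne_top]
  refine lintegral_mono_ae ?_
  filter_upwards [ae_enorm_le_Linfty g] with y hy
  rw [enorm_mul]
  gcongr

theorem norm_genFun_Linfty_le (κ : 𝓢(ℝ, ℂ)) (g : Lp ℂ ∞ (volume : Measure ℝ)) (x : ℝ) :
    ‖genFun κ (g : 𝓢'(ℝ, ℂ)) x‖ ≤ ‖g‖ * ∫ y, ‖κ y‖ := by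
  rw [genFun_Linfty]
  refine (norm_integral_le_integral_norm _).trans ?_
  rw [← integral_sub_right_eq_self (fun y ↦ ‖κ y‖) x, ← integral_const_mul]
  refine integral_mono_ae ?_ ?_ ?_
  · exact (integrable_lp_mul_schwartz g (SchwartzMap.compSubConstCLM ℂ x κ)).norm
  · exact (SchwartzMap.compSubConstCLM ℂ x κ).integrable.norm.const_mul _
  · filter_upwards [ae_norm_le_Linfty g] with y hy
    rw [norm_mul]
    gcongr

theorem schwartz_norm_le_inv_one_add_sq (κ : 𝓢(ℝ, ℂ)) :
    ∃ C, 0 ≤ C ∧ ∀ y, ‖κ y‖ ≤ C * (1 + y ^ 2)⁻¹ := by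
  obtain ⟨C₀, h₀, hC₀⟩ := κ.decay 0 0
  obtain ⟨C₂, h₂, hC₂⟩ := κ.decay 2 0
  refine ⟨C₀ + C₂, by positivity, fun y ↦ ?_⟩
  have h0 := hC₀ y
  have h2 := hC₂ y
  simp only [pow_zero, norm_iteratedFDeriv_zero, one_mul, Real.norm_eq_abs, sq_abs] at h0 h2
  rw [← div_eq_mul_inv, le_div_iff₀ (by positivity)]
  linarith

/-- Differentiation under the integral sign: κ' decays like 1/(1+y²), and near x its translates
share an integrable majorant. -/
theorem hasDerivAt_genFun_Linfty (κ : 𝓢(ℝ, ℂ)) (g : Lp ℂ ∞ (volume : Measure ℝ)) (x : ℝ) :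
    HasDerivAt (genFun κ (g : 𝓢'(ℝ, ℂ)))
      (genFun (-SchwartzMap.derivCLM ℂ ℂ κ) (g : 𝓢'(ℝ, ℂ)) x) x := by
  obtain ⟨C, hC0, hC⟩ := schwartz_norm_le_inv_one_add_sq (SchwartzMap.derivCLM ℂ ℂ κ)
  have h1 : genFun κ (g : 𝓢'(ℝ, ℂ)) = fun x ↦ ∫ y, g y * κ (y - x) := funext (genFun_Linfty κ g)
  rw [h1, genFun_Linfty]
  -- For |z - x| < 1 one has (y - x)² ≤ 2(y - z)² + 2, which gives the factor 3.
  have hb : ∀ x z y : ℝ, z ∈ Metric.ball x 1 → (1 + (y - z) ^ 2)⁻¹ ≤ 3 * (1 + (y - x) ^ 2)⁻¹ := by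
    intro x z y hz
    rw [Metric.mem_ball, Real.dist_eq] at hz
    rw [← div_eq_mul_inv, inv_le_comm₀ (by positivity) (by positivity), inv_div,
      div_le_iff₀ (by norm_num)]
    have h2 := sq_abs (z - x) 
    have h3 : (z - x) ^ 2 ≤ 1 := by rw [← h2]; nlinarith [abs_nonneg (z - x)]
    nlinarith [sq_nonneg (2 * (y - z) - (z - x))]
  refine (hasDerivAt_integral_of_dominated_loc_of_deriv_le (μ := volume)
    (F := fun x y ↦ g y * κ (y - x))
    (F' := fun x y ↦ g y * (-SchwartzMap.derivCLM ℂ ℂ κ) (y - x))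
    (bound := fun y ↦ ‖g‖ * (C * (3 * (1 + (y - x) ^ 2)⁻¹))) (s := Metric.ball x 1)
    (Metric.ball_mem_nhds x one_pos) ?_ ?_ ?_ ?_ ?_ ?_).2
  · exact Filter.Eventually.of_forall fun z ↦
      (integrable_lp_mul_schwartz g (SchwartzMap.compSubConstCLM ℂ z κ)).aestronglyMeasurable
  · exact integrable_lp_mul_schwartz g (SchwartzMap.compSubConstCLM ℂ x κ)
  · exact (integrable_lp_mul_schwartz g (SchwartzMap.compSubConstCLM ℂ x
      (-SchwartzMap.derivCLM ℂ ℂ κ))).aestronglyMeasurable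
  · filter_upwards [ae_norm_le_Linfty g] with y hy z hz
    rw [norm_mul]
    gcongr
    rw [neg_apply, norm_neg]
    refine (hC _).trans ?_
    gcongr
    exact hb x z y hz
  · exact (((integrable_inv_one_add_sq.comp_sub_right x).const_mul 3).const_mul C).const_mul ‖g‖
  · refine Filter.Eventually.of_forall fun y z _ ↦ ?_
    have h2 := (κ.hasDerivAt (y - z)).scomp z ((hasDerivAt_id z).const_sub y)
    refine (h2.const_mul (g y)).congr_deriv ?_
    simp

theorem schwartz_fourier_mul_fourierInv (θ φ : 𝓢(ℝ, ℂ)) (y : ℝ) :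
    𝓕 (SchwartzMap.smulLeftCLM ℂ θ (𝓕⁻ φ)) y = ∫ x, 𝓕 θ (y - x) * φ x := by
  have h : Integrable (fun ξ ↦ ech (-(y * ξ)) * θ ξ) := by
    simpa only [neg_mul] using integrable_ech_mul θ.integrable (-y)
  have h' := integral_fourierInv_mul_comm h φ.integrable
  rw [schwartz_fourier_apply]
  simp only [SchwartzMap.smulLeftCLM_apply_apply θ.hasTemperateGrowth, smul_eq_mul,
    SchwartzMap.fourierInv_coe, ← mul_assoc]
  rw [h']
  congr 1
  ext x
  congr 1
  rw [fourierInv_apply, schwartz_fourier_apply]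
  congr 1
  ext ξ
  rw [← mul_assoc, ← ech_add]
  congr 2
  ring

theorem integrable_convolution_prod {g : ℝ → ℂ} (hg : AEStronglyMeasurable g) {N : ℝ}
    (hN : ∀ᵐ y, ‖g y‖ ≤ N) {κ φ : ℝ → ℂ} (hκ : Integrable κ) (hφ : Integrable φ) :
    Integrable (fun p : ℝ × ℝ ↦ g p.1 * (κ (p.1 - p.2) * φ p.2)) (volume.prod volume) := by
  have h := hφ.convolution_integrand (ContinuousLinearMap.mul ℂ ℂ) hκ (μ := volume) (ν := volume)
  refine Integrable.bdd_mul (c := N) (f := fun p : ℝ × ℝ ↦ g p.1) (by simpa [mul_comm] using h) ?_ ?_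
  · exact hg.comp_fst
  · exact Measure.quasiMeasurePreserving_fst.ae hN

/-- The Fourier transform of a bounded function need not be a function, so the argument stays on the
physical side: regularizations are convolutions with Schwartz kernels, and their derivatives are
convolutions of the same kind. -/
theorem regular_Linfty (g : Lp ℂ ∞ (volume : Measure ℝ)) : Regular (g : 𝓢'(ℝ, ℂ)) where
  growth κ := by
    refine hasTemperateGrowth_of_class (Set.range fun κ ↦ genFun κ (g : 𝓢'(ℝ, ℂ))) ?_ ?_ _ ⟨κ, rfl⟩
    · rintro _ ⟨κ, rfl⟩
      exact ⟨_, norm_genFun_Linfty_le κ g⟩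
    · rintro _ ⟨κ, rfl⟩
      exact ⟨_, ⟨_, rfl⟩, hasDerivAt_genFun_Linfty κ g⟩
  rep θ φ := by
    rw [Lp.toTemperedDistribution_apply]
    simp only [schwartz_fourier_mul_fourierInv, smul_eq_mul, genFun_Linfty,
      ← integral_mul_const]
    rw [integral_integral_swap]
    · congr! 4
      ring
    · refine (integrable_convolution_prod (Lp.aestronglyMeasurable g) (ae_norm_le_Linfty g)
        (𝓕 θ).integrable φ.integrable).congr (Filter.Eventually.of_forall fun p ↦ ?_)
      simp only [Function.uncurry]
      ring

end ProductLaws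

end

noncomputable section

namespace ProductLaws

namespace DyadicPartition

variable (P : DyadicPartition)

/-! ### Symbols of a dyadic partition -/

/-- The symbol of the `k`-th block as a real function. -/
def symR : ℕ → ℝ → ℝ
  | 0 => P.χ
  | q + 1 => fun ξ ↦ P.φ ((2 : ℝ)⁻¹ ^ q * ξ)

/-- The sum of the first `n` symbols. -/
def lowR (n : ℕ) (ξ : ℝ) : ℝ := ∑ j ∈ Finset.range n, P.symR j ξ

/-- The sum of the first `n` symbols as a Schwartz function. -/
def lowS (n : ℕ) : 𝓢(ℝ, ℂ) := ∑ j ∈ Finset.range n, P.symbolS j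

theorem symbol_eq (k : ℕ) (ξ : ℝ) : P.symbol k ξ = (P.symR k ξ : ℂ) := by
  cases k <;> rfl

theorem symbolS_apply (k : ℕ) (ξ : ℝ) : P.symbolS k ξ = (P.symR k ξ : ℂ) := P.symbol_eq k ξ

theorem lowS_apply (n : ℕ) (ξ : ℝ) : P.lowS n ξ = (P.lowR n ξ : ℂ) := by
  simp [lowS, lowR, symbolS_apply]

theorem symR_nonneg (k : ℕ) (ξ : ℝ) : 0 ≤ P.symR k ξ := by
  cases k
  · exact P.nonneg_χ ξ
  · exact P.nonneg_φ _

theorem continuous_symR (k : ℕ) : Continuous (P.symR k) := by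
  cases k
  · exact P.contDiff_χ.continuous
  · exact P.contDiff_φ.continuous.comp (by fun_prop)

theorem continuous_lowR (n : ℕ) : Continuous (P.lowR n) :=
  continuous_finsetSum _ fun j _ ↦ P.continuous_symR j

theorem hasSum_symR (ξ : ℝ) : HasSum (fun k ↦ P.symR k ξ) 1 := by
  have := P.sum_eq ξ
  rw [← hasSum_nat_add_iff' 1]
  simpa [symR] using this

theorem lowR_zero (ξ : ℝ) : P.lowR 0 ξ = 0 := by simp [lowR]

theorem lowR_add_one (n : ℕ) (ξ : ℝ) : P.lowR (n + 1) ξ = P.lowR n ξ + P.symR n ξ :=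
  Finset.sum_range_succ _ _

theorem lowR_mono {m n : ℕ} (h : m ≤ n) (ξ : ℝ) : P.lowR m ξ ≤ P.lowR n ξ :=
  Finset.sum_le_sum_of_subset_of_nonneg (Finset.range_mono h) fun k _ _ ↦ P.symR_nonneg k ξ

theorem lowR_le_one (n : ℕ) (ξ : ℝ) : P.lowR n ξ ≤ 1 :=
  sum_le_hasSum _ (fun k _ ↦ P.symR_nonneg k ξ) (P.hasSum_symR ξ)

theorem lowR_nonneg (n : ℕ) (ξ : ℝ) : 0 ≤ P.lowR n ξ :=
  Finset.sum_nonneg fun k _ ↦ P.symR_nonneg k ξ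

theorem symR_le_one (k : ℕ) (ξ : ℝ) : P.symR k ξ ≤ 1 := by
  have h1 := P.lowR_le_one (k + 1) ξ
  have h2 := P.lowR_nonneg k ξ
  rw [lowR_add_one] at h1
  linarith

theorem tendsto_lowR (ξ : ℝ) : Filter.Tendsto (fun n ↦ P.lowR n ξ) Filter.atTop (nhds 1) :=
  (P.hasSum_symR ξ).tendsto_sum_nat

/-- The partition identity at ξ/2 is the identity at ξ with its first annular term removed;
subtracting the two isolates φ(ξ). -/
theorem φ_eq (ξ : ℝ) : P.φ ξ = P.χ (2⁻¹ * ξ) - P.χ ξ := by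
  have h1 := P.sum_eq (2⁻¹ * ξ)
  have h2 := (hasSum_nat_add_iff' 1).2 (P.sum_eq ξ)
  have h3 : (fun q : ℕ ↦ P.φ ((2 : ℝ)⁻¹ ^ (q + 1) * ξ))
      = fun q : ℕ ↦ P.φ ((2 : ℝ)⁻¹ ^ q * (2⁻¹ * ξ)) := by
    ext q
    rw [pow_succ, mul_assoc]
  rw [h3] at h2
  have := h1.unique h2
  simp at this
  linarith

/-- By `φ_eq` the sum telescopes. Hence all nonzero low frequency symbols are dilates of χ, which is
the source of every bound uniform in n. -/
theorem lowR_succ_eq (n : ℕ) (ξ : ℝ) : P.lowR (n + 1) ξ = P.χ ((2 : ℝ)⁻¹ ^ n * ξ) := by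
  induction n with
  | zero => simp [lowR, symR]
  | succ n ih =>
    rw [lowR_add_one, ih]
    simp only [symR]
    rw [φ_eq, ← mul_assoc, ← pow_succ']
    ring

theorem blockFun_eq_genFun (k : ℕ) (u : 𝓢'(ℝ, ℂ)) (x : ℝ) :
    P.blockFun k u x = genFun (𝓕 (P.symbolS k)) u x := rfl

theorem lowFun_eq_genFun (n : ℕ) (u : 𝓢'(ℝ, ℂ)) (x : ℝ) :
    P.lowFun n u x = genFun (𝓕 (P.lowS n)) u x := by
  have : 𝓕 (P.lowS n) = ∑ j ∈ Finset.range n, 𝓕 (P.symbolS j) :=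
    map_sum (fourierCLM ℂ 𝓢(ℝ, ℂ)) _ _
  rw [this, genFun_sum_left]
  rfl

/-- The kernels for n ≥ 1 are L¹-normalized dilates of one kernel and have the same L¹ norm; for n =
0 the kernel is zero. -/
theorem lintegral_fourier_lowS_le (n : ℕ) :
    ∫⁻ y, ‖𝓕 (P.lowS n) y‖ₑ ≤ ∫⁻ y, ‖𝓕 (P.symbolS 0) y‖ₑ := by
  cases n with
  | zero =>
    have : 𝓕 (P.lowS 0) = 0 := map_zero (fourierCLM ℂ 𝓢(ℝ, ℂ))
    simp [this]
  | succ n =>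
    set c : ℝ := (2 : ℝ)⁻¹ ^ n with hc
    have hc0 : 0 < c := by positivity
    have h : ∀ y, 𝓕 (P.lowS (n + 1)) y = c⁻¹ * 𝓕 (P.symbolS 0) (c⁻¹ * y) := by
      intro y
      rw [schwartz_fourier_apply, schwartz_fourier_apply]
      have := Measure.integral_comp_mul_left
        (fun ξ ↦ ech (-(c⁻¹ * y * ξ)) * P.symbolS 0 ξ) c
      rw [abs_of_pos (inv_pos.2 hc0), Complex.real_smul] at this
      rw [← this]
      congr 1
      ext ξ
      rw [lowS_apply, lowR_succ_eq, symbolS_apply]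
      congr 2
      field_simp
    refine le_of_eq ?_
    rw [← ofReal_integral_norm_eq_lintegral_enorm (𝓕 (P.lowS (n + 1))).integrable,
      ← ofReal_integral_norm_eq_lintegral_enorm (𝓕 (P.symbolS 0)).integrable]
    congr 1
    simp only [h, norm_mul]
    rw [integral_const_mul, Measure.integral_comp_mul_left (fun y ↦ ‖𝓕 (P.symbolS 0) y‖) c⁻¹]
    rw [inv_inv, abs_of_pos hc0, Complex.norm_real, norm_inv, Real.norm_of_nonneg hc0.le,
      smul_eq_mul, inv_mul_cancel_left₀ hc0.ne']

/-- The norm of the operators `S_n` on bounded functions. -/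
def lowConst : ℝ≥0∞ := ∫⁻ y, ‖𝓕 (P.symbolS 0) y‖ₑ

theorem lowConst_lt_top : P.lowConst < ∞ := (𝓕 (P.symbolS 0)).integrable.2

theorem enorm_lowFun_le (n : ℕ) (g : Lp ℂ ∞ (volume : Measure ℝ)) (x : ℝ) :
    ‖P.lowFun n (g : 𝓢'(ℝ, ℂ)) x‖ₑ ≤ P.lowConst * ‖g‖ₑ := by
  rw [lowFun_eq_genFun, mul_comm]
  exact (enorm_genFun_Linfty_le _ _ _).trans (mul_le_mul_right (P.lintegral_fourier_lowS_le n) _)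

theorem enorm_blockFun_le (k : ℕ) (g : Lp ℂ ∞ (volume : Measure ℝ)) (x : ℝ) :
    ‖P.blockFun k (g : 𝓢'(ℝ, ℂ)) x‖ₑ ≤ 2 * P.lowConst * ‖g‖ₑ := by
  have h : P.blockFun k (g : 𝓢'(ℝ, ℂ)) x
      = P.lowFun (k + 1) (g : 𝓢'(ℝ, ℂ)) x - P.lowFun k (g : 𝓢'(ℝ, ℂ)) x := by
    simp [lowFun, Finset.sum_range_succ]
  rw [h, two_mul, add_mul]
  exact (enorm_sub_le).trans (add_le_add (P.enorm_lowFun_le _ g x) (P.enorm_lowFun_le _ g x))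

/-- Constants that describe the supports of the symbols of a dyadic partition. -/
structure Scales (a b : ℝ) (M : ℕ) : Prop where
  pos_a : 0 < a
  pos_b : 0 < b
  two_le : 2 ≤ M
  -- After M octaves the outer radius of a low frequency ball is at most a quarter of the inner
  -- radius of an annulus, so adding the low frequency cannot push the sum out of a slightly larger
  -- annulus.
  gap : 4 * b ≤ a * 2 ^ M
  symR_upper : ∀ k ξ, P.symR k ξ ≠ 0 → |ξ| ≤ b * 2 ^ k
  symR_lower : ∀ k ξ, k ≠ 0 → P.symR k ξ ≠ 0 → a * 2 ^ k ≤ |ξ|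
  lowR_eq_one : ∀ n ξ, n ≠ 0 → |ξ| ≤ a * 2 ^ n → P.lowR n ξ = 1
  lowR_upper : ∀ n ξ, P.lowR n ξ ≠ 0 → |ξ| ≤ b * 2 ^ n

/-- The function φ vanishes on some interval around 0. All its dilates φ(2^{-q}·) with q ≥ 0 vanish
there too, which forces χ = 1 near 0. Compactness of the support of χ and dilation do the rest. -/
theorem exists_scales : ∃ a b M, P.Scales a b M := by
  obtain ⟨a, ha, hφ⟩ : ∃ a > 0, ∀ ξ, |ξ| < a → P.φ ξ = 0 := by
    have h : (tsupport P.φ)ᶜ ∈ nhds (0 : ℝ) := (isClosed_tsupport _).isOpen_compl.mem_nhds P.zero_notMem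
    obtain ⟨a, ha, hs⟩ := Metric.mem_nhds_iff.1 h
    exact ⟨a, ha, fun ξ hξ ↦ image_eq_zero_of_notMem_tsupport (hs (by simpa using hξ))⟩
  have hχ1 : ∀ ξ, |ξ| < a → P.χ ξ = 1 := by
    intro ξ hξ
    have h := P.sum_eq ξ
    have h0 : (fun q : ℕ ↦ P.φ ((2 : ℝ)⁻¹ ^ q * ξ)) = fun _ ↦ 0 := by
      ext q
      apply hφ
      rw [abs_mul, abs_of_nonneg (by positivity)]
      have : (2 : ℝ)⁻¹ ^ q ≤ 1 := pow_le_one₀ (by norm_num) (by norm_num)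
      nlinarith [abs_nonneg ξ]
    rw [h0] at h
    have := h.unique hasSum_zero
    linarith
  obtain ⟨b, hb, hχ⟩ : ∃ b > 0, ∀ ξ, P.χ ξ ≠ 0 → |ξ| ≤ b := by
    obtain ⟨b, hb⟩ := P.compact_χ.isCompact.isBounded.subset_closedBall (0 : ℝ)
    refine ⟨max b 1, by positivity, fun ξ hξ ↦ ?_⟩
    have := hb (subset_tsupport _ hξ)
    rw [mem_closedBall_zero_iff, Real.norm_eq_abs] at this
    exact this.trans (le_max_left _ _)
  obtain ⟨M, hM⟩ := pow_unbounded_of_one_lt (4 * b / (a / 4)) (one_lt_two (α := ℝ))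
  have hup : ∀ n ξ, P.lowR n ξ ≠ 0 → |ξ| ≤ b * 2 ^ n := by
    intro n ξ h
    cases n with
    | zero => simp [lowR] at h
    | succ n =>
      rw [lowR_succ_eq] at h
      have := hχ _ h
      rw [abs_mul, abs_of_nonneg (by positivity), inv_pow, inv_mul_le_iff₀ (by positivity)] at this
      rw [pow_succ]
      nlinarith [pow_pos (two_pos (α := ℝ)) n]
  -- Block k ≥ 1 is φ(2^{-(k-1)}·), so the index shift costs a factor 2 in each radius. The second
  -- factor 2 in a / 4 makes the inequality required by `hχ1` strict, and M + 3 restores the gap for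
  -- the new radii.
  refine ⟨a / 4, b * 2, M + 3, by positivity, by positivity, by omega, ?_, ?_, ?_, ?_, ?_⟩
  · rw [div_lt_iff₀ (by positivity)] at hM
    rw [pow_add]
    nlinarith
  · intro k ξ h
    have h1 : P.lowR (k + 1) ξ ≠ 0 := by
      rw [lowR_add_one]
      exact (add_pos_of_nonneg_of_pos (P.lowR_nonneg k ξ)
        ((P.symR_nonneg k ξ).lt_of_ne' h)).ne'
    have := hup _ _ h1
    rw [pow_succ] at this
    linarith
  · intro k ξ hk h
    cases k with
    | zero => exact absurd rfl hk
    | succ q =>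
      by_contra hlt
      push Not at hlt
      refine h (hφ _ ?_)
      rw [abs_mul, abs_of_nonneg (by positivity), inv_pow, inv_mul_lt_iff₀ (by positivity)]
      rw [pow_succ] at hlt
      nlinarith [pow_pos (two_pos (α := ℝ)) q]
  · intro n ξ hn h
    cases n with
    | zero => exact absurd rfl hn
    | succ n =>
      rw [lowR_succ_eq]
      refine hχ1 _ ?_
      rw [abs_mul, abs_of_nonneg (by positivity), inv_pow, inv_mul_lt_iff₀ (by positivity)]
      rw [pow_succ] at h
      nlinarith [pow_pos (two_pos (α := ℝ)) n]
  · intro n ξ h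
    have := hup n ξ h
    nlinarith [pow_pos (two_pos (α := ℝ)) n]

variable {P}

theorem jap_le_of_abs_le {b ξ : ℝ} {n : ℕ} (h : |ξ| ≤ b * 2 ^ n) : jap ξ ≤ (1 + b ^ 2) * 4 ^ n := by
  have h1 : ξ ^ 2 ≤ (b * 2 ^ n) ^ 2 := by
    rw [← sq_abs]
    exact pow_le_pow_left₀ (abs_nonneg ξ) h 2
  have h2 : (1 : ℝ) ≤ 4 ^ n := one_le_pow₀ (by norm_num)
  have h3 : (b * 2 ^ n) ^ 2 = b ^ 2 * 4 ^ n := by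
    rw [mul_pow, ← pow_mul, mul_comm n 2, pow_mul]
    norm_num
  unfold jap
  nlinarith

theorem le_jap_of_le_abs {a ξ : ℝ} (ha : 0 < a) {n : ℕ} (h : a * 2 ^ n ≤ |ξ|) :
    (4 : ℝ) ^ n ≤ (1 + (a ^ 2)⁻¹) * jap ξ := by
  have h1 : (a * 2 ^ n) ^ 2 ≤ ξ ^ 2 := by
    rw [← sq_abs ξ]
    exact pow_le_pow_left₀ (by positivity) h 2
  have h3 : (a * 2 ^ n) ^ 2 = a ^ 2 * 4 ^ n := by
    rw [mul_pow, ← pow_mul, mul_comm n 2, pow_mul]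
    norm_num
  have h4 : (4 : ℝ) ^ n ≤ (a ^ 2)⁻¹ * ξ ^ 2 := by
    rw [le_inv_mul_iff₀ (by positivity)]
    linarith
  have h5 : 0 < (a ^ 2)⁻¹ := by positivity
  unfold jap
  nlinarith [sq_nonneg ξ]

/-- The constant that compares `1 + ξ²` with powers of `4` on the supports of the symbols. -/
theorem Scales.exists_const {a b : ℝ} {M : ℕ} (h : P.Scales a b M) : ∃ C : ℝ, 1 ≤ C ∧
    (∀ k ξ, P.symR k ξ ≠ 0 → jap ξ ≤ C * 4 ^ k ∧ 4 ^ k ≤ C * jap ξ) ∧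
    (∀ n ξ, P.lowR n ξ ≠ 0 → jap ξ ≤ C * 4 ^ n) ∧
    (∀ n ξ, P.lowR n ξ ≠ 1 → 4 ^ n ≤ C * jap ξ) := by
  have ha := h.pos_a
  refine ⟨(1 + b ^ 2) + (1 + (a ^ 2)⁻¹), ?_, ?_, ?_, ?_⟩
  · have : 0 < (a ^ 2)⁻¹ := by positivity
    nlinarith [sq_nonneg b]
  · intro k ξ hk
    have h0 : 0 < (a ^ 2)⁻¹ := by positivity
    refine ⟨(jap_le_of_abs_le (h.symR_upper k ξ hk)).trans ?_, ?_⟩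
    · exact mul_le_mul_of_nonneg_right (by linarith) (by positivity)
    · rcases eq_or_ne k 0 with rfl | hk0
      · have := one_le_jap ξ
        rw [pow_zero]
        nlinarith [sq_nonneg b]
      · refine (le_jap_of_le_abs ha (h.symR_lower k ξ hk0 hk)).trans ?_
        exact mul_le_mul_of_nonneg_right (by nlinarith [sq_nonneg b]) (jap_pos ξ).le
  · intro n ξ hn
    have h0 : 0 < (a ^ 2)⁻¹ := by positivity
    refine (jap_le_of_abs_le (h.lowR_upper n ξ hn)).trans ?_
    exact mul_le_mul_of_nonneg_right (by linarith) (by positivity)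
  · intro n ξ hn
    have h0 : 0 < (a ^ 2)⁻¹ := by positivity
    rcases eq_or_ne n 0 with rfl | hn0
    · have := one_le_jap ξ
      rw [pow_zero]
      nlinarith [sq_nonneg b]
    · have h1 : a * 2 ^ n ≤ |ξ| := by
        by_contra hlt
        exact hn (h.lowR_eq_one n ξ hn0 (not_le.1 hlt).le)
      refine (le_jap_of_le_abs ha h1).trans ?_
      exact mul_le_mul_of_nonneg_right (by nlinarith [sq_nonneg b]) (jap_pos ξ).le

end DyadicPartition

end ProductLaws

end

noncomputable section

namespace ProductLaws

/-! ### Plancherel's theorem for integrable functions -/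

theorem ae_eq_of_integral_schwartz_eq {p : ℝ≥0∞} [hp : Fact (1 ≤ p)] {F : ℝ → ℂ}
    (hF : Continuous F) (f : Lp ℂ p (volume : Measure ℝ))
    (h : ∀ φ : 𝓢(ℝ, ℂ), ∫ x, F x * φ x = ∫ x, f x * φ x) : F =ᵐ[volume] f := by
  refine ae_eq_of_integral_contDiff_smul_eq hF.locallyIntegrable
    ((Lp.memLp f).locallyIntegrable hp.out) fun g hg hgc ↦ ?_
  have hg₁ : HasCompactSupport (Complex.ofRealCLM ∘ g) := hgc.comp_left rfl
  have hg₂ : ContDiff ℝ (⊤ : ℕ∞) (Complex.ofRealCLM ∘ g) := by fun_prop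
  have := h (hg₁.toSchwartzMap hg₂)
  simpa [mul_comm] using this

theorem toTemperedDistribution_fourierInv_apply {W : ℝ → ℂ} (hW : MemLp W 2) (φ : 𝓢(ℝ, ℂ)) :
    ((𝓕⁻ (hW.toLp W) : Lp ℂ 2 (volume : Measure ℝ)) : 𝓢'(ℝ, ℂ)) φ = ∫ ξ, W ξ * 𝓕⁻ φ ξ := by
  rw [← Lp.fourierInv_toTemperedDistribution_eq, TemperedDistribution.fourierInv_apply,
    Lp.toTemperedDistribution_apply]
  apply integral_congr_ae
  filter_upwards [hW.coeFn_toLp] with ξ hξ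
  rw [hξ, smul_eq_mul, mul_comm, SchwartzMap.fourierInv_coe]

theorem fourierInv_ae_eq {W : ℝ → ℂ} (hW : MemLp W 2) (hW1 : Integrable W) :
    𝓕⁻ W =ᵐ[volume] (𝓕⁻ (hW.toLp W) : Lp ℂ 2 (volume : Measure ℝ)) := by
  refine ae_eq_of_integral_schwartz_eq (continuous_fourierInv hW1) _ fun φ ↦ ?_
  have h := toTemperedDistribution_fourierInv_apply hW φ
  rw [Lp.toTemperedDistribution_apply] at h
  rw [← integral_fourierInv_mul_comm hW1 φ.integrable]
  simp only [smul_eq_mul] at h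
  simp only [mul_comm _ (φ _)]
  rw [h, SchwartzMap.fourierInv_coe]

theorem n2_fourierInv_le {W : ℝ → ℂ} (hW1 : Integrable W) :
    n2 volume (fun x ↦ ‖𝓕⁻ W x‖ₑ) ≤ n2 volume (fun ξ ↦ ‖W ξ‖ₑ) := by
  by_cases hW : eLpNorm W 2 volume < ∞
  · have hW2 : MemLp W 2 := ⟨hW1.aestronglyMeasurable, hW⟩
    rw [n2_eq_eLpNorm, n2_eq_eLpNorm, eLpNorm_congr_ae (fourierInv_ae_eq hW2 hW1), ← Lp.enorm_def,
      ← enorm_fourier_eq, FourierTransform.fourier_fourierInv_eq, Lp.enorm_def,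
      eLpNorm_congr_ae hW2.coeFn_toLp]
  · rw [n2_eq_eLpNorm (F := W), not_lt_top_iff.1 hW]
    exact le_top

theorem n2_schwartz_fourier (φ : 𝓢(ℝ, ℂ)) :
    n2 volume (fun x ↦ ‖𝓕 φ x‖ₑ) = n2 volume (fun ξ ↦ ‖φ ξ‖ₑ) := by
  rw [n2_eq_eLpNorm, n2_eq_eLpNorm, ← eLpNorm_congr_ae (φ.coeFn_toLp 2 volume),
    ← eLpNorm_congr_ae ((𝓕 φ).coeFn_toLp 2 volume), ← Lp.enorm_def, ← Lp.enorm_def,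
    ← SchwartzMap.toLp_fourier_eq, enorm_fourier_eq]

/-! ### The trilinear form on blocks -/

/-- The trilinear form `∫ F G ψ`. -/
def form (F G : ℝ → ℂ) (ψ : 𝓢(ℝ, ℂ)) : ℂ := ∫ x, F x * G x * ψ x

theorem form_comm (F G : ℝ → ℂ) (ψ : 𝓢(ℝ, ℂ)) : form F G ψ = form G F ψ := by
  simp only [form, mul_comm (F _)]

theorem integrable_form {F G : ℝ → ℂ} (hF : F.HasTemperateGrowth) (hG : G.HasTemperateGrowth)
    (ψ : 𝓢(ℝ, ℂ)) : Integrable (fun x ↦ F x * G x * ψ x) := by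
  have := (SchwartzMap.smulLeftCLM ℂ (F * G) ψ).integrable (μ := volume)
  refine this.congr (Filter.Eventually.of_forall fun x ↦ ?_)
  rw [SchwartzMap.smulLeftCLM_apply_apply (hF.mul hG)]
  rfl

theorem form_sum_left {ι : Type*} (s : Finset ι) {F : ι → ℝ → ℂ} {G : ℝ → ℂ}
    (hF : ∀ i, (F i).HasTemperateGrowth) (hG : G.HasTemperateGrowth) (ψ : 𝓢(ℝ, ℂ)) :
    form (fun x ↦ ∑ i ∈ s, F i x) G ψ = ∑ i ∈ s, form (F i) G ψ := by
  simp only [form, Finset.sum_mul]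
  exact integral_finsetSum _ fun i _ ↦ integrable_form (hF i) hG ψ

namespace Regular

variable (P : DyadicPartition) {u v : 𝓢'(ℝ, ℂ)}

theorem growth_blockFun (hu : Regular u) (k : ℕ) : (P.blockFun k u).HasTemperateGrowth :=
  hu.growth _

theorem growth_lowFun (hu : Regular u) (n : ℕ) : (P.lowFun n u).HasTemperateGrowth := by
  have : P.lowFun n u = genFun (𝓕 (P.lowS n)) u := funext (P.lowFun_eq_genFun n u)
  rw [this]
  exact hu.growth _

theorem block_apply (hu : Regular u) (k : ℕ) (ψ : 𝓢(ℝ, ℂ)) :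
    P.block k u ψ = ∫ x, P.blockFun k u x * ψ x := by
  rw [DyadicPartition.block, fourierMultiplierCLM_apply_apply]
  exact hu.rep (P.symbolS k) ψ

theorem smulLeft_block_apply (hv : Regular v) {F : ℝ → ℂ} (hF : F.HasTemperateGrowth) (k : ℕ)
    (ψ : 𝓢(ℝ, ℂ)) : smulLeftCLM ℂ F (P.block k v) ψ = form F (P.blockFun k v) ψ := by
  rw [smulLeftCLM_apply_apply, hv.block_apply P, form]
  congr 1
  ext x
  rw [SchwartzMap.smulLeftCLM_apply_apply hF, smul_eq_mul]
  ring

theorem form_lowFun (hu : Regular u) (n : ℕ) {G : ℝ → ℂ} (hG : G.HasTemperateGrowth)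
    (ψ : 𝓢(ℝ, ℂ)) :
    form (P.lowFun n u) G ψ = ∑ j ∈ Finset.range n, form (P.blockFun j u) G ψ :=
  form_sum_left _ (fun j ↦ hu.growth_blockFun P j) hG ψ

end Regular

/-! ### Existence of the product -/

/-- The topology on 𝓢' is that of pointwise convergence on test functions. -/
theorem hasSum_temperedDistribution_iff {ι : Type*} {T : ι → 𝓢'(ℝ, ℂ)} {t : 𝓢'(ℝ, ℂ)} :
    HasSum T t ↔ ∀ ψ, HasSum (fun i ↦ T i ψ) (t ψ) := by
  simp only [HasSum, SummationFilter.unconditional_filter]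
  rw [PointwiseConvergenceCLM.tendsto_iff_forall_tendsto]
  refine forall_congr' fun ψ ↦ ?_
  congr! 2 with s
  simp

theorem enorm_tsum_le {ι : Type*} {f : ι → ℂ} {t : ℂ} (h : HasSum f t) : ‖t‖ₑ ≤ ∑' i, ‖f i‖ₑ := by
  by_cases hs : ∑' i, ‖f i‖ₑ = ∞
  · rw [hs]; exact le_top
  · rw [← h.tsum_eq]
    exact enorm_tsum_le_tsum_enorm

/-- Absolute summability against each ψ defines a linear functional. Its continuity is not
automatic; it comes from the Sobolev bound by duality. -/
theorem exists_hasSum_of_bound {ι : Type*} (T : ι → 𝓢'(ℝ, ℂ)) {K : 𝓢(ℝ, ℂ) → ℝ≥0∞} {m : ℝ}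
    {C : ℝ≥0} (hK : ∀ ψ, K ψ ≤ C * wN m (fun ξ ↦ ‖𝓕⁻ ψ ξ‖ₑ)) (h : ∀ ψ, ∑' i, ‖T i ψ‖ₑ ≤ K ψ) :
    ∃ t, HasSum T t ∧ ∀ ψ, ‖t ψ‖ₑ ≤ K ψ := by
  have hs : ∀ ψ, Summable (fun i ↦ T i ψ) := by
    intro ψ
    refine Summable.of_enorm ?_
    exact ((h ψ).trans (hK ψ)).trans_lt
      (ENNReal.mul_lt_top ENNReal.coe_lt_top (wN_schwartz_lt_top m (𝓕⁻ ψ))) |>.ne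
  let L : 𝓢(ℝ, ℂ) →ₗ[ℂ] ℂ :=
    { toFun := fun ψ ↦ ∑' i, T i ψ
      map_add' := fun a b ↦ by
        simp only [map_add]
        exact (hs a).tsum_add (hs b)
      map_smul' := fun c a ↦ by
        simp only [map_smul, smul_eq_mul, RingHom.id_apply]
        exact tsum_mul_left }
  have hL : ∀ ψ, ‖L ψ‖ₑ ≤ K ψ := fun ψ ↦ (enorm_tsum_le (hs ψ).hasSum).trans (h ψ)
  obtain ⟨t, ht, -, -⟩ := exists_sobolev_of_bound (s := -m) L C fun ψ ↦ by
    rw [neg_neg]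
    exact (hL ψ).trans (hK ψ)
  refine ⟨t, hasSum_temperedDistribution_iff.2 fun ψ ↦ ?_, fun ψ ↦ by rw [ht]; exact hL ψ⟩
  rw [ht]
  exact (hs ψ).hasSum

/-- The distribution `w` is the sum of the three series of Bony's decomposition with respect to the
partition `P`. -/
def IsProductAt (P : DyadicPartition) (u v w : 𝓢'(ℝ, ℂ)) : Prop :=
  ∃ t₁ t₂ r : 𝓢'(ℝ, ℂ),
    IsParaproduct P u v t₁ ∧ IsParaproduct P v u t₂ ∧ IsRemainder P u v r ∧ w = t₁ + t₂ + r

/-- The part of the double series of blocks near the diagonal. -/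
def nearSum (P : DyadicPartition) (M : ℕ) (u v : 𝓢'(ℝ, ℂ)) (ψ : 𝓢(ℝ, ℂ)) : ℝ≥0∞ :=
  ∑' k, ∑' j, if j ≤ k + M ∧ k ≤ j + M then ‖form (P.blockFun j u) (P.blockFun k v) ψ‖ₑ else 0

/-- The series of a paraproduct with a gap of `M` between the frequencies. -/
def farSum (P : DyadicPartition) (M : ℕ) (u v : 𝓢'(ℝ, ℂ)) (ψ : 𝓢(ℝ, ℂ)) : ℝ≥0∞ :=
  ∑' k, ‖form (P.lowFun (k - M) u) (P.blockFun k v) ψ‖ₑ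

variable {P : DyadicPartition} {u v : 𝓢'(ℝ, ℂ)} {M : ℕ}

theorem nearSum_comm : nearSum P M u v = nearSum P M v u := by
  ext ψ
  rw [nearSum, nearSum, ENNReal.tsum_comm]
  congr! 5 with j k
  · exact and_comm
  · rw [form_comm]

/-- Bony's paraproduct keeps a gap of one block only, too small for the supports of a general
partition. The additional blocks k - M ≤ j < k - 1 lie near the diagonal and are charged to
`nearSum`. -/
theorem tsum_paraproduct_le (hu : Regular u) (hv : Regular v) (hM : 1 ≤ M) (ψ : 𝓢(ℝ, ℂ)) :
    ∑' k, ‖smulLeftCLM ℂ (P.lowFun (k - 1) u) (P.block k v) ψ‖ₑ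
      ≤ farSum P M u v ψ + nearSum P M u v ψ := by
  rw [farSum, nearSum, ← ENNReal.tsum_add]
  refine ENNReal.tsum_le_tsum fun k ↦ ?_
  rw [hv.smulLeft_block_apply P (hu.growth_lowFun P _), hu.form_lowFun P _ (hv.growth_blockFun P k),
    hu.form_lowFun P _ (hv.growth_blockFun P k),
    ← Finset.sum_range_add_sum_Ico _ (show k - M ≤ k - 1 by omega)]
  refine (enorm_add_le _ _).trans (add_le_add le_rfl ?_)
  refine (enorm_sum_le _ _).trans ?_
  refine le_trans (Finset.sum_le_sum fun j hj ↦ ?_) (ENNReal.sum_le_tsum (Finset.Ico (k - M) (k - 1)))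
  rw [Finset.mem_Ico] at hj
  rw [if_pos (by omega)]

theorem tsum_remainder_le (hu : Regular u) (hv : Regular v) (hM : 1 ≤ M) (ψ : 𝓢(ℝ, ℂ)) :
    ∑' i : {i : ℕ × ℕ // i.1 ≤ i.2 + 1 ∧ i.2 ≤ i.1 + 1},
      ‖smulLeftCLM ℂ (P.blockFun i.1.1 u) (P.block i.1.2 v) ψ‖ₑ ≤ nearSum P M u v ψ := by
  have h : ∀ i : ℕ × ℕ, smulLeftCLM ℂ (P.blockFun i.1 u) (P.block i.2 v) ψ
      = form (P.blockFun i.1 u) (P.blockFun i.2 v) ψ := fun i ↦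
    hv.smulLeft_block_apply P (hu.growth_blockFun P _) _ _
  simp only [h]
  refine (tsum_subtype {i : ℕ × ℕ | i.1 ≤ i.2 + 1 ∧ i.2 ≤ i.1 + 1}
    (fun i ↦ ‖form (P.blockFun i.1 u) (P.blockFun i.2 v) ψ‖ₑ)).trans_le ?_
  rw [ENNReal.tsum_prod', ENNReal.tsum_comm, nearSum]
  refine ENNReal.tsum_le_tsum fun k ↦ ENNReal.tsum_le_tsum fun j ↦ ?_
  rw [Set.indicator_apply]
  split_ifs with h1 h2
  · exact le_rfl
  · simp only [Set.mem_ofPred_eq] at h1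
    omega
  · exact bot_le
  · exact le_rfl

/-- Bony's decomposition converges if the far and near parts are absolutely summable. -/
theorem exists_isProductAt (hu : Regular u) (hv : Regular v) (hM : 1 ≤ M) {m : ℝ} {C : ℝ≥0}
    (h : ∀ ψ, farSum P M u v ψ + farSum P M v u ψ + 3 * nearSum P M u v ψ
      ≤ C * wN m (fun ξ ↦ ‖𝓕⁻ ψ ξ‖ₑ)) :
    ∃ w, IsProductAt P u v w := by
  obtain ⟨t₁, h₁, -⟩ := exists_hasSum_of_bound
    (fun k : ℕ ↦ smulLeftCLM ℂ (P.lowFun (k - 1) u) (P.block k v)) (m := m) (C := C)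
    (fun ψ ↦ le_trans (by
      rw [add_assoc]
      refine add_le_add le_rfl (le_trans ?_ le_add_self)
      exact le_mul_of_one_le_left' (by norm_num)) (h ψ)) (tsum_paraproduct_le hu hv hM)
  obtain ⟨t₂, h₂, -⟩ := exists_hasSum_of_bound
    (fun k : ℕ ↦ smulLeftCLM ℂ (P.lowFun (k - 1) v) (P.block k u)) (m := m) (C := C)
    (fun ψ ↦ le_trans (by
      rw [nearSum_comm]
      refine add_le_add le_add_self ?_
      exact le_mul_of_one_le_left' (by norm_num)) (h ψ)) (tsum_paraproduct_le hv hu hM)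
  obtain ⟨r, h₃, -⟩ := exists_hasSum_of_bound
    (fun i : {i : ℕ × ℕ // i.1 ≤ i.2 + 1 ∧ i.2 ≤ i.1 + 1} ↦
      smulLeftCLM ℂ (P.blockFun i.1.1 u) (P.block i.1.2 v)) (m := m) (C := C)
    (fun ψ ↦ le_trans (by
      refine le_trans ?_ le_add_self
      exact le_mul_of_one_le_left' (by norm_num)) (h ψ)) (tsum_remainder_le hu hv hM)
  exact ⟨_, t₁, t₂, r, h₁, h₂, h₃, rfl⟩

/-- Each of the three series contributes one copy of `nearSum`, and each paraproduct its far part.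
-/
theorem IsProductAt.enorm_apply_le {w : 𝓢'(ℝ, ℂ)} (h : IsProductAt P u v w) (hu : Regular u)
    (hv : Regular v) (hM : 1 ≤ M) (ψ : 𝓢(ℝ, ℂ)) :
    ‖w ψ‖ₑ ≤ farSum P M u v ψ + farSum P M v u ψ + 3 * nearSum P M u v ψ := by
  obtain ⟨t₁, t₂, r, h₁, h₂, h₃, rfl⟩ := h
  have e₁ := (enorm_tsum_le (hasSum_temperedDistribution_iff.1 h₁ ψ)).trans
    (tsum_paraproduct_le hu hv hM ψ)
  have e₂ := (enorm_tsum_le (hasSum_temperedDistribution_iff.1 h₂ ψ)).trans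
    (tsum_paraproduct_le hv hu hM ψ)
  have e₃ := (enorm_tsum_le (hasSum_temperedDistribution_iff.1 h₃ ψ)).trans
    (tsum_remainder_le hu hv hM ψ)
  rw [nearSum_comm] at e₂
  calc ‖(t₁ + t₂ + r) ψ‖ₑ = ‖t₁ ψ + t₂ ψ + r ψ‖ₑ := rfl
    _ ≤ ‖t₁ ψ‖ₑ + ‖t₂ ψ‖ₑ + ‖r ψ‖ₑ := (enorm_add_le _ _).trans (by gcongr; exact enorm_add_le _ _)
    _ ≤ _ := add_le_add (add_le_add e₁ e₂) e₃
    _ = _ := by ring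

end ProductLaws

end

noncomputable section

namespace ProductLaws

/-! ### The product as a limit -/

/-- The regions j + 1 < k, k + 1 < j and |j - k| ≤ 1 partition the square of indices. -/
theorem sum_range_sum_range_bony (a : ℕ → ℕ → ℂ) (n : ℕ) :
    ∑ k ∈ Finset.range n, ∑ j ∈ Finset.range (k - 1), a j k
      + ∑ k ∈ Finset.range n, ∑ j ∈ Finset.range (k - 1), a k j
      + ∑ j ∈ Finset.range n, ∑ k ∈ Finset.range n, (if j ≤ k + 1 ∧ k ≤ j + 1 then a j k else 0)
      = ∑ j ∈ Finset.range n, ∑ k ∈ Finset.range n, a j k := by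
  have h : ∀ b : ℕ → ℕ → ℂ, ∑ k ∈ Finset.range n, ∑ j ∈ Finset.range (k - 1), b j k
      = ∑ k ∈ Finset.range n, ∑ j ∈ Finset.range n, (if j + 1 < k then b j k else 0) := by
    intro b
    refine Finset.sum_congr rfl fun k hk ↦ ?_
    rw [← Finset.sum_filter]
    congr 1
    ext j
    simp only [Finset.mem_range, Finset.mem_filter] at hk ⊢
    omega
  rw [h a, h fun j k ↦ a k j, Finset.sum_comm, ← Finset.sum_add_distrib, ← Finset.sum_add_distrib]
  refine Finset.sum_congr rfl fun j _ ↦ ?_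
  rw [← Finset.sum_add_distrib, ← Finset.sum_add_distrib]
  refine Finset.sum_congr rfl fun k _ ↦ ?_
  split_ifs <;> first | omega | simp

theorem tendsto_range_product :
    Filter.Tendsto (fun n ↦ Finset.range n ×ˢ Finset.range n) Filter.atTop Filter.atTop := by
  refine Filter.tendsto_atTop_finset_of_monotone (fun m n h ↦ ?_) fun x ↦ ⟨max x.1 x.2 + 1, ?_⟩
  · exact Finset.product_subset_product (Finset.range_mono h) (Finset.range_mono h)
  · simp only [Finset.mem_product, Finset.mem_range]
    omega

variable {P : DyadicPartition} {u v w : 𝓢'(ℝ, ℂ)}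

/-- Summed over squares of indices, Bony's decomposition is the product S_n u S_n v. This formula is
what allows the product to be compared across partitions and identified with the pointwise product.
-/
theorem IsProductAt.tendsto (h : IsProductAt P u v w) (hu : Regular u) (hv : Regular v)
    (ψ : 𝓢(ℝ, ℂ)) :
    Filter.Tendsto (fun n ↦ form (P.lowFun n u) (P.lowFun n v) ψ) Filter.atTop (nhds (w ψ)) := by
  obtain ⟨t₁, t₂, r, h₁, h₂, h₃, rfl⟩ := h
  set a : ℕ → ℕ → ℂ := fun j k ↦ form (P.blockFun j u) (P.blockFun k v) ψ
  have e₁ := (hasSum_temperedDistribution_iff.1 h₁ ψ).tendsto_sum_nat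
  have e₂ := (hasSum_temperedDistribution_iff.1 h₂ ψ).tendsto_sum_nat
  have h₃' : HasSum (Set.indicator {i : ℕ × ℕ | i.1 ≤ i.2 + 1 ∧ i.2 ≤ i.1 + 1}
      fun i ↦ a i.1 i.2) (r ψ) := by
    rw [← hasSum_subtype_iff_indicator]
    have h := hasSum_temperedDistribution_iff.1 h₃ ψ
    simp only [hv.smulLeft_block_apply P (hu.growth_blockFun P _)] at h
    exact h
  -- The remainder is an unordered sum over pairs, so it may be evaluated along the exhausting
  -- squares.
  have e₃ := Filter.Tendsto.comp h₃' (by simpa using tendsto_range_product)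
  refine ((e₁.add e₂).add e₃).congr fun n ↦ ?_
  rw [hu.form_lowFun P _ (hv.growth_lowFun P _)]
  have h4 : ∀ j, form (P.blockFun j u) (P.lowFun n v) ψ = ∑ k ∈ Finset.range n, a j k := by
    intro j
    rw [form_comm, hv.form_lowFun P _ (hu.growth_blockFun P _)]
    exact Finset.sum_congr rfl fun k _ ↦ form_comm _ _ _
  simp only [h4]
  rw [← sum_range_sum_range_bony a n, Function.comp_apply, Finset.sum_product]
  refine congrArg₂ _ (congrArg₂ _ ?_ ?_) ?_
  · refine Finset.sum_congr rfl fun k _ ↦ ?_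
    rw [hv.smulLeft_block_apply P (hu.growth_lowFun P _),
      hu.form_lowFun P _ (hv.growth_blockFun P k)]
  · refine Finset.sum_congr rfl fun k _ ↦ ?_
    rw [hu.smulLeft_block_apply P (hv.growth_lowFun P _),
      hv.form_lowFun P _ (hu.growth_blockFun P k)]
    exact Finset.sum_congr rfl fun j _ ↦ form_comm _ _ _
  · refine Finset.sum_congr rfl fun j _ ↦ Finset.sum_congr rfl fun k _ ↦ ?_
    simp only [Set.indicator_apply, Set.mem_ofPred_eq]

theorem IsProductAt.unique {w' : 𝓢'(ℝ, ℂ)} (h : IsProductAt P u v w) (h' : IsProductAt P u v w') :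
    w = w' := by
  obtain ⟨t₁, t₂, r, h₁, h₂, h₃, rfl⟩ := h
  obtain ⟨t₁', t₂', r', h₁', h₂', h₃', rfl⟩ := h'
  have e {ι : Type} {T : ι → 𝓢'(ℝ, ℂ)} {t t' : 𝓢'(ℝ, ℂ)} (h : HasSum T t) (h' : HasSum T t') :
      t = t' := by
    ext ψ
    exact (hasSum_temperedDistribution_iff.1 h ψ).unique (hasSum_temperedDistribution_iff.1 h' ψ)
  rw [e h₁ h₁', e h₂ h₂', e h₃ h₃']

/-! ### Bilinearity and symmetry of the product at a fixed partition -/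

theorem lowFun_add_right (n : ℕ) (u v : 𝓢'(ℝ, ℂ)) :
    P.lowFun n (u + v) = P.lowFun n u + P.lowFun n v := by
  ext x
  simp only [P.lowFun_eq_genFun, Pi.add_apply, genFun_add_right]

theorem blockFun_add_right (n : ℕ) (u v : 𝓢'(ℝ, ℂ)) :
    P.blockFun n (u + v) = P.blockFun n u + P.blockFun n v := rfl

theorem lowFun_smul_right (n : ℕ) (c : ℂ) (u : 𝓢'(ℝ, ℂ)) :
    P.lowFun n (c • u) = c • P.lowFun n u := by
  ext x
  simp only [P.lowFun_eq_genFun, Pi.smul_apply, genFun_smul_right, smul_eq_mul]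

theorem blockFun_smul_right (n : ℕ) (c : ℂ) (u : 𝓢'(ℝ, ℂ)) :
    P.blockFun n (c • u) = c • P.blockFun n u := rfl

theorem HasSum.add_temperedDistribution {ι : Type*} {S T : ι → 𝓢'(ℝ, ℂ)} {s t : 𝓢'(ℝ, ℂ)}
    (hs : HasSum S s) (ht : HasSum T t) : HasSum (fun i ↦ S i + T i) (s + t) :=
  hasSum_temperedDistribution_iff.2 fun ψ ↦
    (hasSum_temperedDistribution_iff.1 hs ψ).add (hasSum_temperedDistribution_iff.1 ht ψ)

theorem HasSum.smul_temperedDistribution {ι : Type*} {S : ι → 𝓢'(ℝ, ℂ)} {s : 𝓢'(ℝ, ℂ)}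
    (hs : HasSum S s) (c : ℂ) : HasSum (fun i ↦ c • S i) (c • s) :=
  hasSum_temperedDistribution_iff.2 fun ψ ↦ (hasSum_temperedDistribution_iff.1 hs ψ).mul_left c

theorem IsProductAt.add_left {u' w' : 𝓢'(ℝ, ℂ)} (hu : Regular u) (hu' : Regular u')
    (h : IsProductAt P u v w) (h' : IsProductAt P u' v w') : IsProductAt P (u + u') v (w + w') := by
  obtain ⟨t₁, t₂, r, h₁, h₂, h₃, rfl⟩ := h
  obtain ⟨t₁', t₂', r', h₁', h₂', h₃', rfl⟩ := h'
  refine ⟨t₁ + t₁', t₂ + t₂', r + r', ?_, ?_, ?_, by abel⟩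
  · rw [IsParaproduct]
    convert HasSum.add_temperedDistribution h₁ h₁' using 2 with k
    rw [lowFun_add_right, smulLeftCLM_add (hu.growth_lowFun P _) (hu'.growth_lowFun P _)]
    rfl
  · rw [IsParaproduct]
    convert HasSum.add_temperedDistribution h₂ h₂' using 2 with k
    rw [map_add, map_add]
  · rw [IsRemainder]
    convert HasSum.add_temperedDistribution h₃ h₃' using 2 with k
    rw [blockFun_add_right, smulLeftCLM_add (hu.growth_blockFun P _) (hu'.growth_blockFun P _)]
    rfl

theorem IsProductAt.smul_left (hu : Regular u) (c : ℂ) (h : IsProductAt P u v w) :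
    IsProductAt P (c • u) v (c • w) := by
  obtain ⟨t₁, t₂, r, h₁, h₂, h₃, rfl⟩ := h
  refine ⟨c • t₁, c • t₂, c • r, ?_, ?_, ?_, by simp only [smul_add]⟩
  · rw [IsParaproduct]
    convert HasSum.smul_temperedDistribution h₁ c using 2 with k
    rw [lowFun_smul_right, smulLeftCLM_smul (hu.growth_lowFun P _)]
    rfl
  · rw [IsParaproduct]
    convert HasSum.smul_temperedDistribution h₂ c using 2 with k
    rw [map_smul, map_smul]
  · rw [IsRemainder]
    convert HasSum.smul_temperedDistribution h₃ c using 2 with k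
    rw [blockFun_smul_right, smulLeftCLM_smul (hu.growth_blockFun P _)]
    rfl

/-- For regular distributions the blocks are functions, so products of blocks commute and the two
paraproducts exchange roles. This transfers linearity from the left factor to the right one. -/
theorem IsProductAt.symm (hu : Regular u) (hv : Regular v) (h : IsProductAt P u v w) :
    IsProductAt P v u w := by
  obtain ⟨t₁, t₂, r, h₁, h₂, h₃, rfl⟩ := h
  refine ⟨t₂, t₁, r, h₂, h₁, ?_, by abel⟩
  let e : {i : ℕ × ℕ // i.1 ≤ i.2 + 1 ∧ i.2 ≤ i.1 + 1} ≃
      {i : ℕ × ℕ // i.1 ≤ i.2 + 1 ∧ i.2 ≤ i.1 + 1} :=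
    (Equiv.prodComm ℕ ℕ).subtypeEquiv fun i ↦ and_comm
  rw [IsRemainder, ← e.hasSum_iff]
  refine hasSum_temperedDistribution_iff.2 fun ψ ↦ ?_
  have h := hasSum_temperedDistribution_iff.1 h₃ ψ
  simp only [hv.smulLeft_block_apply P (hu.growth_blockFun P _)] at h
  have h' : (fun i : {i : ℕ × ℕ // i.1 ≤ i.2 + 1 ∧ i.2 ≤ i.1 + 1} ↦
      smulLeftCLM ℂ (P.blockFun i.1.2 v) (P.block i.1.1 u) ψ) =
      fun i ↦ form (P.blockFun i.1.1 u) (P.blockFun i.1.2 v) ψ := by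
    funext i
    rw [hu.smulLeft_block_apply P (hv.growth_blockFun P _), form_comm]
  rw [← h'] at h
  exact h

theorem IsProductAt.add_right {v' w' : 𝓢'(ℝ, ℂ)} (hu : Regular u) (hv : Regular v)
    (hv' : Regular v') (h : IsProductAt P u v w) (h' : IsProductAt P u v' w') :
    IsProductAt P u (v + v') (w + w') :=
  ((h.symm hu hv).add_left hv hv' (h'.symm hu hv')).symm (hv.add hv') hu

theorem Regular.smul (hu : Regular u) (c : ℂ) : Regular (c • u) where
  growth κ := (Function.HasTemperateGrowth.const c).mul (hu.growth κ)
  rep θ φ := by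
    rw [show (c • u) (𝓕 (SchwartzMap.smulLeftCLM ℂ θ (𝓕⁻ φ))) =
      c * u (𝓕 (SchwartzMap.smulLeftCLM ℂ θ (𝓕⁻ φ))) from rfl, hu.rep, ← integral_const_mul]
    simp [genFun_smul_right, mul_assoc]

theorem IsProductAt.smul_right (hu : Regular u) (hv : Regular v) (c : ℂ)
    (h : IsProductAt P u v w) : IsProductAt P u (c • v) (c • w) :=
  ((h.symm hu hv).smul_left hv c).symm (hv.smul c) hu

/-- The product laws follow from the existence of the products with bounds. -/
theorem productContinuous_of_forall_exists (P : DyadicPartition)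
    {X Y Z : Submodule ℂ 𝓢'(ℝ, ℂ)} {NX NY NZ : 𝓢'(ℝ, ℂ) → ℝ≥0∞}
    (hX : ∀ u ∈ X, Regular u) (hY : ∀ v ∈ Y, Regular v) (C : ℝ≥0)
    (h : ∀ u ∈ X, ∀ v ∈ Y, ∃ w ∈ Z, (∀ P, IsProductAt P u v w) ∧ AgreesWithPointwise u v w ∧
      NZ w ≤ C * NX u * NY v) : ProductContinuous X NX Y NY Z NZ := by
  -- Chosen products are automatically bilinear: sums and multiples of products are products, and a
  -- product at the single partition `P` is unique.
  choose! B hBZ hB hA hN using h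
  let B' : X →ₗ[ℂ] Y →ₗ[ℂ] Z := LinearMap.mk₂ ℂ (fun u v ↦ ⟨B u v, hBZ u u.2 v v.2⟩)
    (fun u u' v ↦ Subtype.ext <| (hB _ (u + u').2 v v.2 P).unique
      ((hB u u.2 v v.2 P).add_left (hX u u.2) (hX u' u'.2) (hB u' u'.2 v v.2 P)))
    (fun c u v ↦ Subtype.ext <| (hB _ (c • u).2 v v.2 P).unique
      ((hB u u.2 v v.2 P).smul_left (hX u u.2) c))
    (fun u v v' ↦ Subtype.ext <| (hB u u.2 _ (v + v').2 P).unique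
      ((hB u u.2 v v.2 P).add_right (hX u u.2) (hY v v.2) (hY v' v'.2) (hB u u.2 v' v'.2 P)))
    (fun c u v ↦ Subtype.ext <| (hB u u.2 _ (c • v).2 P).unique
      ((hB u u.2 v v.2 P).smul_right (hX u u.2) (hY v v.2) c))
  exact ⟨B', fun u v ↦ hB u u.2 v v.2, fun u v ↦ hA u u.2 v v.2, C, fun u v ↦ hN u u.2 v v.2⟩

end ProductLaws

end

noncomputable section

namespace ProductLaws

/-! ### Trilinear integrals on the frequency side -/

theorem n2_congr_of_sq {α β : Type*} [MeasurableSpace α] [MeasurableSpace β] {μ : Measure α}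
    {ν : Measure β} {f : α → ℝ≥0∞} {g : β → ℝ≥0∞}
    (h : ∫⁻ x, f x ^ 2 ∂μ = ∫⁻ x, g x ^ 2 ∂ν) : n2 μ f = n2 ν g := by
  rw [← n2_sq, ← n2_sq] at h
  exact (ENNReal.pow_right_strictMono two_ne_zero).injective h

theorem n2_comp_measurePreserving {α β : Type*} [MeasurableSpace α] [MeasurableSpace β]
    {μ : Measure α} {ν : Measure β} {T : α → β} (hT : MeasurePreserving T μ ν) {g : β → ℝ≥0∞}
    (hg : Measurable g) : n2 μ (fun x ↦ g (T x)) = n2 ν g :=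
  n2_congr_of_sq (hT.lintegral_comp (hg.pow_const 2))

theorem n2_prod_mul {f g : ℝ → ℝ≥0∞} (hf : Measurable f) (hg : Measurable g) :
    n2 volume (fun p : ℝ × ℝ ↦ f p.1 * g p.2) = n2 volume f * n2 volume g := by
  refine (ENNReal.pow_right_strictMono two_ne_zero).injective ?_
  simp only [mul_pow, n2_sq]
  rw [Measure.volume_eq_prod]
  exact lintegral_prod_mul (hf.pow_const 2).aemeasurable (hg.pow_const 2).aemeasurable

theorem n2_prod_kernel_le {h : ℝ → ℝ≥0∞} (hh : Measurable h) {k : ℝ → ℝ → ℝ≥0∞}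
    (hk : Measurable (Function.uncurry k)) {C : ℝ≥0∞} (hC : ∀ y, ∫⁻ x, k x y ^ 2 ≤ C ^ 2) :
    n2 volume (fun p : ℝ × ℝ ↦ h p.2 * k p.1 p.2) ≤ C * n2 volume h := by
  refine n2_le_of_sq_le ?_
  have hm : Measurable fun p : ℝ × ℝ ↦ (h p.2 * k p.1 p.2) ^ 2 :=
    ((hh.comp measurable_snd).mul hk).pow_const 2
  rw [Measure.volume_eq_prod, lintegral_prod_symm' _ hm, mul_pow, n2_sq,
    ← lintegral_const_mul _ (hh.pow_const 2)]
  refine lintegral_mono fun y ↦ ?_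
  simp only [mul_pow]
  have hy : Measurable fun x ↦ k x y := hk.comp measurable_prodMk_right
  rw [lintegral_const_mul _ (hy.pow_const 2), mul_comm (C ^ 2)]
  gcongr
  exact hC y

theorem measurePreserving_fst_add :
    MeasurePreserving (fun p : ℝ × ℝ ↦ (p.1, p.1 + p.2)) volume volume :=
  measurePreserving_prod_add volume volume

theorem measurePreserving_add_snd :
    MeasurePreserving (fun p : ℝ × ℝ ↦ (p.1 + p.2, p.2)) volume volume :=
  measurePreserving_add_prod volume volume

theorem measurePreserving_snd_fst :
    MeasurePreserving (fun p : ℝ × ℝ ↦ (p.2, p.1)) volume volume :=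
  Measure.measurePreserving_swap (μ := (volume : Measure ℝ)) (ν := (volume : Measure ℝ))

section Kernel

variable {f g h : ℝ → ℝ≥0∞} (hf : Measurable f) (hg : Measurable g) (hh : Measurable h)
  {k : ℝ → ℝ → ℝ≥0∞} (hk : Measurable (Function.uncurry k)) {C : ℝ≥0∞}
  (hC : ∀ y, ∫⁻ x, k x y ^ 2 ≤ C ^ 2)

include hf hg hh hk hC

/-- Cauchy–Schwarz in both frequencies pairs f ⊗ g with h times the kernel. The shear (ξ, η) ↦ (ξ,
ξ+η) preserves measure, and integrating first in the variable x of the kernel uses its uniform L²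
bound. The two companions permute the roles of the three frequencies. -/
theorem lintegral_kernel_fst_le :
    ∫⁻ p : ℝ × ℝ, f p.1 * g p.2 * h (p.1 + p.2) * k p.1 (p.1 + p.2)
      ≤ C * (n2 volume f * n2 volume g * n2 volume h) := by
  have hm : Measurable fun p : ℝ × ℝ ↦ h p.2 * k p.1 p.2 := (hh.comp measurable_snd).mul hk
  calc ∫⁻ p : ℝ × ℝ, f p.1 * g p.2 * h (p.1 + p.2) * k p.1 (p.1 + p.2)
      = ∫⁻ p : ℝ × ℝ, (f p.1 * g p.2) * (h (p.1 + p.2) * k p.1 (p.1 + p.2)) := by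
        simp only [mul_assoc]
    _ ≤ n2 volume (fun p : ℝ × ℝ ↦ f p.1 * g p.2)
        * n2 volume (fun p : ℝ × ℝ ↦ h (p.1 + p.2) * k p.1 (p.1 + p.2)) :=
        lintegral_mul_le_n2 (by fun_prop) (hm.comp measurePreserving_fst_add.measurable).aemeasurable
    _ ≤ (n2 volume f * n2 volume g) * (C * n2 volume h) := by
        rw [n2_prod_mul hf hg, n2_comp_measurePreserving measurePreserving_fst_add hm]
        gcongr
        exact n2_prod_kernel_le hh hk hC
    _ = _ := by ring

theorem lintegral_kernel_snd_le :
    ∫⁻ p : ℝ × ℝ, f p.1 * g p.2 * h (p.1 + p.2) * k p.2 (p.1 + p.2)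
      ≤ C * (n2 volume f * n2 volume g * n2 volume h) := by
  have hm : Measurable fun p : ℝ × ℝ ↦ f p.1 * g p.2 * h (p.1 + p.2) * k p.2 (p.1 + p.2) := by
    have := hk.comp (f := fun p : ℝ × ℝ ↦ (p.2, p.1 + p.2)) (by fun_prop)
    have h1 : Measurable fun p : ℝ × ℝ ↦ k p.2 (p.1 + p.2) := this
    fun_prop
  rw [← measurePreserving_snd_fst.lintegral_comp hm]
  refine le_trans (le_of_eq ?_) ((lintegral_kernel_fst_le hg hf hh hk hC).trans (le_of_eq ?_))
  · refine lintegral_congr fun p ↦ ?_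
    simp only [add_comm p.2 p.1]
    ring
  · ring

theorem lintegral_kernel_add_le :
    ∫⁻ p : ℝ × ℝ, f p.1 * g p.2 * h (p.1 + p.2) * k (p.1 + p.2) p.2
      ≤ C * (n2 volume f * n2 volume g * n2 volume h) := by
  have hm : Measurable fun p : ℝ × ℝ ↦ g p.2 * k p.1 p.2 := (hg.comp measurable_snd).mul hk
  have hm' : Measurable fun p : ℝ × ℝ ↦ f p.1 * h p.2 := by fun_prop
  calc ∫⁻ p : ℝ × ℝ, f p.1 * g p.2 * h (p.1 + p.2) * k (p.1 + p.2) p.2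
      = ∫⁻ p : ℝ × ℝ, (f p.1 * h (p.1 + p.2)) * (g p.2 * k (p.1 + p.2) p.2) :=
        lintegral_congr fun p ↦ by ring
    _ ≤ n2 volume (fun p : ℝ × ℝ ↦ f p.1 * h (p.1 + p.2))
        * n2 volume (fun p : ℝ × ℝ ↦ g p.2 * k (p.1 + p.2) p.2) :=
        lintegral_mul_le_n2 (by fun_prop) (hm.comp measurePreserving_add_snd.measurable).aemeasurable
    _ ≤ (n2 volume f * n2 volume h) * (C * n2 volume g) := by
        rw [← n2_prod_mul hf hh, n2_comp_measurePreserving measurePreserving_add_snd hm,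
          n2_comp_measurePreserving measurePreserving_fst_add hm']
        gcongr
        exact n2_prod_kernel_le hg hk hC
    _ = _ := by ring

end Kernel

/-! ### Integrals of powers of the weight -/

theorem lintegral_jw_lt_top {p : ℝ} (hp : p < -(1 / 2)) : ∫⁻ ξ, jw p ξ < ∞ := by
  have h := (integrable_rpow_neg_one_add_norm_sq (E := ℝ) (μ := volume) (r := -2 * p)
    (by simp; linarith)).lintegral_lt_top
  refine lt_of_le_of_lt (le_of_eq ?_) h
  refine lintegral_congr fun ξ ↦ ?_
  rw [jw, jap, Real.norm_eq_abs, sq_abs]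
  congr 2
  ring

theorem rpow_mono_exponent_of_comparable {x y c : ℝ} (hx : 0 < x) (hy : 0 < y) (hc : 1 ≤ c)
    (h₁ : x ≤ c * y) (h₂ : y ≤ c * x) (r : ℝ) : x ^ r ≤ c ^ |r| * y ^ r := by
  have hc0 : 0 < c := by linarith
  rcases le_total 0 r with hr | hr
  · rw [abs_of_nonneg hr, ← Real.mul_rpow hc0.le hy.le]
    exact Real.rpow_le_rpow hx.le h₁ hr
  · rw [abs_of_nonpos hr, Real.rpow_neg hc0.le, ← Real.inv_rpow hc0.le,
      ← Real.mul_rpow (inv_nonneg.2 hc0.le) hy.le]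
    refine Real.rpow_le_rpow_of_nonpos (by positivity) ?_ hr
    rw [inv_mul_le_iff₀ hc0]
    exact h₂

theorem jw_le_of_comparable {c ξ η : ℝ} (hc : 1 ≤ c) (h₁ : jap ξ ≤ c * jap η)
    (h₂ : jap η ≤ c * jap ξ) (r : ℝ) : jw r ξ ≤ ENNReal.ofReal (c ^ |r|) * jw r η := by
  rw [jw, jw, ← ENNReal.ofReal_mul (by positivity)]
  exact ENNReal.ofReal_le_ofReal
    (rpow_mono_exponent_of_comparable (jap_pos ξ) (jap_pos η) hc h₁ h₂ r)

theorem jw_le_of_nonneg {ξ η : ℝ} {c : ℝ} (hc : 0 ≤ c) (h : jap ξ ≤ c * jap η) {r : ℝ}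
    (hr : 0 ≤ r) : jw r ξ ≤ ENNReal.ofReal (c ^ r) * jw r η := by
  rw [jw, jw, ← ENNReal.ofReal_mul (by positivity), ← Real.mul_rpow hc (jap_pos η).le]
  exact ENNReal.ofReal_le_ofReal (Real.rpow_le_rpow (jap_pos ξ).le h hr)

theorem lintegral_Ioo_rpow {q : ℝ} (hq : -1 < q) {r : ℝ} (hr : 0 ≤ r) :
    ∫⁻ x in Set.Ioc 0 r, ENNReal.ofReal (x ^ q) = ENNReal.ofReal (r ^ (q + 1) / (q + 1)) := by
  have h := integral_rpow (a := 0) (b := r) (Or.inl hq)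
  rw [Real.zero_rpow (by linarith), sub_zero, intervalIntegral.integral_of_le hr] at h
  rw [← h, ofReal_integral_eq_lintegral_ofReal]
  · exact (intervalIntegrable_iff_integrableOn_Ioc_of_le hr).1
      (intervalIntegral.intervalIntegrable_rpow' hq)
  · refine (ae_restrict_iff' measurableSet_Ioc).2 (Filter.Eventually.of_forall fun x hx ↦ ?_)
    exact Real.rpow_nonneg hx.1.le q

/-- The weight is integrated over a ball. -/
theorem exists_lintegral_jw_ball_le {p : ℝ} (hp : p < 1 / 2) :
    ∃ C : ℝ≥0, ∀ y, ∫⁻ x in {x | jap x ≤ jap y}, jw (-p) x ≤ C * jw (1 / 2 - p) y := by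
  have hball : ∀ y, {x | jap x ≤ jap y} ⊆ Set.Icc (-|y|) |y| := by
    intro y x hx
    have : x ^ 2 ≤ y ^ 2 := by simpa [jap] using hx
    exact Set.mem_Icc.2 (abs_le.1 (sq_le_sq.1 this))
  have habs : ∀ y : ℝ, |y| ≤ jap y ^ (1 / 2 : ℝ) := by
    intro y
    rw [← Real.sqrt_eq_rpow]
    refine Real.le_sqrt_of_sq_le ?_
    rw [sq_abs, jap]; linarith
  -- For p ≤ 0 the weight is largest at the boundary of the ball, and the length 2|y| supplies the
  -- extra power 1/2 of 1 + y².
  rcases le_total p 0 with h0 | h0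
  · refine ⟨2, fun y ↦ ?_⟩
    calc ∫⁻ x in {x | jap x ≤ jap y}, jw (-p) x
        ≤ ∫⁻ x in {x | jap x ≤ jap y}, jw (-p) y := by
          refine setLIntegral_mono measurable_const fun x hx ↦ ?_
          exact ENNReal.ofReal_le_ofReal (Real.rpow_le_rpow (jap_pos x).le hx (by linarith))
      _ = jw (-p) y * volume {x | jap x ≤ jap y} := by simp
      _ ≤ jw (-p) y * (2 * jw (1 / 2) y) := by
          gcongr
          refine (measure_mono (hball y)).trans ?_
          rw [Real.volume_Icc, jw, ← ENNReal.ofReal_ofNat, ← ENNReal.ofReal_mul (by norm_num)]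
          refine ENNReal.ofReal_le_ofReal ?_
          have := habs y
          linarith
      _ = ((2 : ℝ≥0) : ℝ≥0∞) * jw (1 / 2 - p) y := by
          rw [show 1 / 2 - p = -p + 1 / 2 by ring, jw_add]
          push_cast
          ring
  -- For p ≥ 0 the weight is dominated by |x|^{-2p}, integrable at 0 because p < 1/2; its integral
  -- over |x| ≤ |y| gives this constant.
  · refine ⟨(2 * (1 / (1 - 2 * p))).toNNReal, fun y ↦ ?_⟩
    have hq : 0 < 1 - 2 * p := by linarith
    have hle : ∀ x : ℝ, x ≠ 0 → jw (-p) x ≤ ENNReal.ofReal (|x| ^ (-2 * p)) := by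
      intro x hx
      refine ENNReal.ofReal_le_ofReal ?_
      rw [show -2 * p = 2 * (-p) by ring, Real.rpow_mul (abs_nonneg x), Real.rpow_two, sq_abs]
      exact Real.rpow_le_rpow_of_nonpos (by positivity) (by rw [jap]; linarith) (by linarith)
    have hpos : ∫⁻ x in Set.Ioc 0 |y|, jw (-p) x
        ≤ ENNReal.ofReal (|y| ^ (1 - 2 * p) / (1 - 2 * p)) := by
      rw [show 1 - 2 * p = -2 * p + 1 by ring,
        ← lintegral_Ioo_rpow (by linarith : -1 < -2 * p) (abs_nonneg y)]
      refine setLIntegral_mono (by fun_prop) fun x hx ↦ ?_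
      have := hle x hx.1.ne'
      rwa [abs_of_pos hx.1] at this
    have hneg : ∫⁻ x in Set.Ico (-|y|) 0, jw (-p) x = ∫⁻ x in Set.Ioc 0 |y|, jw (-p) x := by
      rw [← (Measure.measurePreserving_neg (volume : Measure ℝ)).setLIntegral_comp_preimage
        measurableSet_Ico (measurable_jw (-p))]
      simp [jw_even]
    calc ∫⁻ x in {x | jap x ≤ jap y}, jw (-p) x
        ≤ ∫⁻ x in Set.Ico (-|y|) 0 ∪ {0} ∪ Set.Ioc 0 |y|, jw (-p) x := by
          refine lintegral_mono_set fun x hx ↦ ?_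
          have := hball y hx
          rcases lt_trichotomy x 0 with h | h | h
          · exact Or.inl (Or.inl ⟨this.1, h⟩)
          · exact Or.inl (Or.inr h)
          · exact Or.inr ⟨h, this.2⟩
      _ ≤ (∫⁻ x in Set.Ico (-|y|) 0, jw (-p) x) + (∫⁻ x in {0}, jw (-p) x)
          + ∫⁻ x in Set.Ioc 0 |y|, jw (-p) x :=
          (lintegral_union_le _ _ _).trans (by gcongr; exact lintegral_union_le _ _ _)
      _ = 2 * ∫⁻ x in Set.Ioc 0 |y|, jw (-p) x := by rw [hneg]; simp [two_mul]
      _ ≤ 2 * ENNReal.ofReal (|y| ^ (1 - 2 * p) / (1 - 2 * p)) := by gcongr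
      _ ≤ ENNReal.ofReal (2 * (1 / (1 - 2 * p))) * jw (1 / 2 - p) y := by
          rw [jw, ← ENNReal.ofReal_mul (by positivity), ← ENNReal.ofReal_ofNat,
            ← ENNReal.ofReal_mul (by norm_num)]
          refine ENNReal.ofReal_le_ofReal ?_
          have h1 : |y| ^ (1 - 2 * p) ≤ jap y ^ (1 / 2 - p) := by
            rw [show 1 / 2 - p = (1 / 2) * (1 - 2 * p) by ring, Real.rpow_mul (jap_pos y).le]
            exact Real.rpow_le_rpow (abs_nonneg y) (habs y) hq.le
          calc 2 * (|y| ^ (1 - 2 * p) / (1 - 2 * p))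
              = 2 * (1 / (1 - 2 * p)) * |y| ^ (1 - 2 * p) := by ring
            _ ≤ _ := by gcongr

/-- The kernel `⟨x⟩^{-p} ⟨y⟩^{p - 1/2}`, restricted to `|x| ≤ |y|`. -/
def lowKernel (p x y : ℝ) : ℝ≥0∞ :=
  if jap x ≤ jap y then jw (-(p / 2)) x * jw (-((1 / 2 - p) / 2)) y else 0

theorem measurable_lowKernel (p : ℝ) : Measurable (Function.uncurry (lowKernel p)) := by
  unfold Function.uncurry lowKernel
  refine Measurable.ite ?_ ?_ measurable_const
  · exact measurableSet_le (continuous_jap.measurable.comp measurable_fst)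
      (continuous_jap.measurable.comp measurable_snd)
  · exact ((measurable_jw _).comp measurable_fst).mul ((measurable_jw _).comp measurable_snd)

theorem exists_lowKernel_sq_le {p : ℝ} (hp : p < 1 / 2) :
    ∃ C : ℝ≥0, ∀ y, ∫⁻ x, lowKernel p x y ^ 2 ≤ (C : ℝ≥0∞) ^ 2 := by
  obtain ⟨C, hC⟩ := exists_lintegral_jw_ball_le hp
  refine ⟨C + 1, fun y ↦ ?_⟩
  have hs : MeasurableSet {x | jap x ≤ jap y} :=
    measurableSet_le continuous_jap.measurable measurable_const
  have h : ∀ x, lowKernel p x y ^ 2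
      = {x | jap x ≤ jap y}.indicator (fun x ↦ jw (-(1 / 2 - p)) y * jw (-p) x) x := by
    intro x
    simp only [lowKernel, Set.indicator_apply, Set.mem_ofPred_eq]
    split_ifs
    · rw [mul_pow, jw_sq, jw_sq, mul_comm]
      congr 2 <;> ring
    · simp
  simp only [h]
  rw [lintegral_indicator hs, lintegral_const_mul _ (measurable_jw _)]
  calc jw (-(1 / 2 - p)) y * ∫⁻ x in {x | jap x ≤ jap y}, jw (-p) x
      ≤ jw (-(1 / 2 - p)) y * (C * jw (1 / 2 - p) y) := by gcongr; exact hC y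
    _ = C * (jw (-(1 / 2 - p)) y * jw (1 / 2 - p) y) := by ring
    _ = C := by rw [jw_neg_mul, mul_one]
    _ ≤ ((C + 1 : ℝ≥0) : ℝ≥0∞) ^ 2 := by
      have : C ≤ (C + 1) ^ 2 := by nlinarith [C.2, sq_nonneg C]
      exact_mod_cast this

/-! ### Comparison of the weights at three frequencies ξ, η, ξ+η -/

theorem jap_add_le (ξ η : ℝ) : jap (ξ + η) ≤ 4 * max (jap ξ) (jap η) := by
  have h1 := le_max_left (jap ξ) (jap η)
  have h2 := le_max_right (jap ξ) (jap η)
  have : jap (ξ + η) ≤ 2 * jap ξ + 2 * jap η := by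
    simp only [jap]; nlinarith [sq_nonneg (ξ - η)]
  linarith

theorem jap_sub_le (ξ η : ℝ) : jap (ξ - η) ≤ 4 * max (jap ξ) (jap η) := by
  rw [sub_eq_add_neg, ← jap_neg η]; exact jap_add_le _ _

/-- Of three frequencies `ξ + η = ζ` the larger two are comparable. -/
theorem exists_jw_mul_le_lowKernel {s s' t : ℝ} (h : s + s' + t = 1 / 2) :
    ∃ C : ℝ≥0, ∀ ξ η, jw (-(s / 2)) ξ * jw (-(s' / 2)) η * jw (-(t / 2)) (ξ + η)
      ≤ C * (lowKernel s ξ (ξ + η) + lowKernel s' η (ξ + η) + lowKernel t (ξ + η) η) := by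
  set C₁ := ENNReal.ofReal (4 ^ |-(s' / 2)|)
  set C₂ := ENNReal.ofReal (4 ^ |-(s / 2)|)
  refine ⟨(4 ^ |-(s' / 2)| : ℝ).toNNReal + (4 ^ |-(s / 2)| : ℝ).toNNReal, fun ξ η ↦ ?_⟩
  change _ ≤ (C₁ + C₂ : ℝ≥0∞) * _
  have e1 := jap_add_le ξ η
  have e2 : jap ξ ≤ 4 * max (jap (ξ + η)) (jap η) := by simpa using jap_sub_le (ξ + η) η
  have e3 : jap η ≤ 4 * max (jap (ξ + η)) (jap ξ) := by simpa using jap_sub_le (ξ + η) ξ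
  have p1 := jap_pos ξ
  have p2 := jap_pos η
  have p3 := jap_pos (ξ + η)
  -- Split according to the smallest frequency. It keeps its own factor; the other two weights are
  -- moved to a single frequency, where the relation between s, s' and t makes the exponents those
  -- of `lowKernel`.
  by_cases c1 : jap ξ ≤ jap η ∧ jap ξ ≤ jap (ξ + η)
  · rw [max_eq_right c1.1] at e1
    rw [max_eq_left c1.2] at e3
    calc _ ≤ jw (-(s / 2)) ξ * (C₁ * jw (-(s' / 2)) (ξ + η)) * jw (-(t / 2)) (ξ + η) := by
          gcongr
          exact jw_le_of_comparable (by norm_num) e3 e1 _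
      _ = C₁ * lowKernel s ξ (ξ + η) := by
          rw [lowKernel, if_pos c1.2, show -((1 / 2 - s) / 2) = -(s' / 2) + -(t / 2) by linarith,
            jw_add]
          ring
      _ ≤ _ := by gcongr <;> simp [add_assoc]
  by_cases c2 : jap η ≤ jap ξ ∧ jap η ≤ jap (ξ + η)
  · rw [max_eq_left c2.1] at e1
    rw [max_eq_left c2.2] at e2
    calc _ ≤ (C₂ * jw (-(s / 2)) (ξ + η)) * jw (-(s' / 2)) η * jw (-(t / 2)) (ξ + η) := by
          gcongr
          exact jw_le_of_comparable (by norm_num) e2 e1 _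
      _ = C₂ * lowKernel s' η (ξ + η) := by
          rw [lowKernel, if_pos c2.2, show -((1 / 2 - s') / 2) = -(s / 2) + -(t / 2) by linarith,
            jw_add]
          ring
      _ ≤ _ := by
          gcongr
          exacts [le_add_self, le_add_self.trans le_self_add]
  · have c3 : jap (ξ + η) ≤ jap ξ ∧ jap (ξ + η) ≤ jap η := by
      constructor <;> by_contra hh <;> push Not at hh c1 c2
      · rcases le_total (jap ξ) (jap η) with h' | h'
        · linarith [c1 h']
        · linarith [c2 h']
      · rcases le_total (jap ξ) (jap η) with h' | h'
        · linarith [c1 h']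
        · linarith [c2 h']
    rw [max_eq_right c3.2] at e2
    rw [max_eq_right c3.1] at e3
    calc _ ≤ (C₂ * jw (-(s / 2)) η) * jw (-(s' / 2)) η * jw (-(t / 2)) (ξ + η) := by
          gcongr
          exact jw_le_of_comparable (by norm_num) e2 e3 _
      _ = C₂ * lowKernel t (ξ + η) η := by
          rw [lowKernel, if_pos c3.2, show -((1 / 2 - t) / 2) = -(s / 2) + -(s' / 2) by linarith,
            jw_add]
          ring
      _ ≤ _ := by gcongr <;> simp

end ProductLaws

end

noncomputable section

namespace ProductLaws

/-! ### The double series of blocks on the frequency side -/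

/-- The double series of blocks, restricted to the pairs of indices in `S`. -/
def dblSum (P : DyadicPartition) (S : ℕ → ℕ → Prop) [∀ j k, Decidable (S j k)]
    (u v : 𝓢'(ℝ, ℂ)) (ψ : 𝓢(ℝ, ℂ)) : ℝ≥0∞ :=
  ∑' k, ∑' j, if S j k then ‖form (P.blockFun j u) (P.blockFun k v) ψ‖ₑ else 0

section dblSum

variable {P : DyadicPartition} {S : ℕ → ℕ → Prop} [∀ j k, Decidable (S j k)] {u v : 𝓢'(ℝ, ℂ)}
  {M : ℕ}

theorem farSum_le_dblSum (hu : Regular u) (hv : Regular v) (hS : ∀ j k, j ≤ k → S j k)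
    (ψ : 𝓢(ℝ, ℂ)) : farSum P M u v ψ ≤ dblSum P S u v ψ := by
  refine ENNReal.tsum_le_tsum fun k ↦ ?_
  rw [hu.form_lowFun P _ (hv.growth_blockFun P k)]
  refine (enorm_sum_le _ _).trans ?_
  refine le_trans (Finset.sum_le_sum fun j hj ↦ ?_) (ENNReal.sum_le_tsum (Finset.range (k - M)))
  rw [Finset.mem_range] at hj
  rw [if_pos (hS j k (by omega))]

theorem nearSum_le_dblSum (hS : ∀ j k, j ≤ k + M → S j k) (ψ : 𝓢(ℝ, ℂ)) :
    nearSum P M u v ψ ≤ dblSum P S u v ψ := by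
  refine ENNReal.tsum_le_tsum fun k ↦ ENNReal.tsum_le_tsum fun j ↦ ?_
  split_ifs with h1 h2
  · exact le_rfl
  · exact absurd (hS j k h1.1) h2
  · exact bot_le
  · exact le_rfl

theorem dblSum_comm (ψ : 𝓢(ℝ, ℂ)) :
    dblSum P (fun _ _ ↦ True) u v ψ = dblSum P (fun _ _ ↦ True) v u ψ := by
  rw [dblSum, dblSum, ENNReal.tsum_comm]
  simp only [form_comm]

theorem bony_le_dblSum (hu : Regular u) (hv : Regular v) (ψ : 𝓢(ℝ, ℂ)) :
    farSum P M u v ψ + farSum P M v u ψ + 3 * nearSum P M u v ψ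
      ≤ 5 * dblSum P (fun _ _ ↦ True) u v ψ := by
  have h1 := farSum_le_dblSum (P := P) (M := M) (S := fun _ _ ↦ True) hu hv (by simp) ψ
  have h2 := farSum_le_dblSum (P := P) (M := M) (S := fun _ _ ↦ True) hv hu (by simp) ψ
  have h3 := nearSum_le_dblSum (P := P) (M := M) (S := fun _ _ ↦ True) (u := u) (v := v)
    (by simp) ψ
  rw [← dblSum_comm] at h2
  calc _ ≤ dblSum P (fun _ _ ↦ True) u v ψ + dblSum P (fun _ _ ↦ True) u v ψ
        + 3 * dblSum P (fun _ _ ↦ True) u v ψ := by gcongr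
    _ = _ := by ring

end dblSum

theorem measurable_schwartz (φ : 𝓢(ℝ, ℂ)) : Measurable fun ξ ↦ φ ξ := φ.continuous.measurable

theorem integrable_prod_mul_schwartz {W₁ W₂ : ℝ → ℂ} (h₁ : Integrable W₁) (h₂ : Integrable W₂)
    (Ψ : 𝓢(ℝ, ℂ)) : Integrable (fun p : ℝ × ℝ ↦ W₁ p.1 * W₂ p.2 * Ψ (p.1 + p.2)) := by
  refine (h₁.mul_prod h₂).mul_bdd (c := SchwartzMap.seminorm ℂ 0 0 Ψ) ?_ ?_
  · exact (Ψ.continuous.comp (continuous_fst.add continuous_snd)).aestronglyMeasurable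
  · exact Filter.Eventually.of_forall fun p ↦ SchwartzMap.norm_le_seminorm ℂ Ψ _

/-! ### Block sums of distributions whose Fourier transforms are functions -/

section FourierRep

variable {u v : 𝓢'(ℝ, ℂ)} {U V : ℝ → ℂ}

theorem FourierRep.form_genFun (hU : FourierRep u U) (hV : FourierRep v V) (θ θ' ψ : 𝓢(ℝ, ℂ)) :
    form (genFun (𝓕 θ) u) (genFun (𝓕 θ') v) ψ
      = ∫ p : ℝ × ℝ, U p.1 * θ p.1 * (V p.2 * θ' p.2) * 𝓕⁻ ψ (p.1 + p.2) := by
  have h := integrable_prod_mul_schwartz (hU.integrable θ) (hV.integrable θ') (𝓕⁻ ψ)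
  rw [Measure.volume_eq_prod] at h ⊢
  rw [integral_prod _ h, ← integral_fourierInv_mul_mul (hU.integrable θ) (hV.integrable θ') ψ, form]
  simp only [hU.genFun_eq, hV.genFun_eq, FourierTransform.fourierInv_fourier_eq]

theorem FourierRep.enorm_form_blockFun_le (P : DyadicPartition) (hU : FourierRep u U)
    (hV : FourierRep v V) (j k : ℕ) (ψ : 𝓢(ℝ, ℂ)) :
    ‖form (P.blockFun j u) (P.blockFun k v) ψ‖ₑ
      ≤ ∫⁻ p : ℝ × ℝ, ‖U p.1‖ₑ * ‖V p.2‖ₑ * ‖𝓕⁻ ψ (p.1 + p.2)‖ₑ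
        * ENNReal.ofReal (P.symR j p.1 * P.symR k p.2) := by
  have h : ∀ j (u : 𝓢'(ℝ, ℂ)), P.blockFun j u = genFun (𝓕 (P.symbolS j)) u := fun j u ↦ by
    ext x; exact P.blockFun_eq_genFun j u x
  rw [h, h, hU.form_genFun hV]
  refine (enorm_integral_le_lintegral_enorm _).trans (le_of_eq ?_)
  refine lintegral_congr fun p ↦ ?_
  have e : ∀ j ξ, ‖P.symbolS j ξ‖ₑ = ENNReal.ofReal (P.symR j ξ) := fun j ξ ↦ by
    rw [P.symbolS_apply, ← ofReal_norm, Complex.norm_real, Real.norm_eq_abs,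
      abs_of_nonneg (P.symR_nonneg j ξ)]
  rw [enorm_mul, enorm_mul, enorm_mul, enorm_mul, e, e, ENNReal.ofReal_mul (P.symR_nonneg _ _)]
  ring

/-- The symbols are nonnegative and sum to one in each variable. Summing the absolute values over
all pairs of blocks therefore costs nothing beyond the single integral over the region their
supports reach. -/
theorem FourierRep.dblSum_le (P : DyadicPartition) {S : ℕ → ℕ → Prop} [∀ j k, Decidable (S j k)]
    (hU : FourierRep u U) (hV : FourierRep v V) {R : Set (ℝ × ℝ)}
    (hR : ∀ j k ξ η, S j k → P.symR j ξ ≠ 0 → P.symR k η ≠ 0 → (ξ, η) ∈ R) (ψ : 𝓢(ℝ, ℂ)) :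
    dblSum P S u v ψ ≤ ∫⁻ p in R, ‖U p.1‖ₑ * ‖V p.2‖ₑ * ‖𝓕⁻ ψ (p.1 + p.2)‖ₑ := by
  set F : ℝ × ℝ → ℝ≥0∞ := fun p ↦ ‖U p.1‖ₑ * ‖V p.2‖ₑ * ‖𝓕⁻ ψ (p.1 + p.2)‖ₑ with hF
  have hUm := hU.measurable
  have hVm := hV.measurable
  have hFm : Measurable F := by
    have := (measurable_schwartz (𝓕⁻ ψ)).comp (measurable_fst.add measurable_snd :
      Measurable fun p : ℝ × ℝ ↦ p.1 + p.2)
    exact ((hUm.comp measurable_fst).enorm.mul (hVm.comp measurable_snd).enorm).mul this.enorm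
  have hm : ∀ j k, Measurable fun p : ℝ × ℝ ↦ ENNReal.ofReal (P.symR j p.1 * P.symR k p.2) :=
    fun j k ↦ (((P.continuous_symR j).measurable.comp measurable_fst).mul
      ((P.continuous_symR k).measurable.comp measurable_snd)).ennreal_ofReal
  have hm' : ∀ j k, Measurable fun p : ℝ × ℝ ↦
      if S j k then F p * ENNReal.ofReal (P.symR j p.1 * P.symR k p.2) else 0 := fun j k ↦ by
    split_ifs
    · exact hFm.mul (hm j k)
    · exact measurable_const
  have hsum : ∀ ξ, ∑' k, ENNReal.ofReal (P.symR k ξ) = 1 := fun ξ ↦ by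
    rw [← ENNReal.ofReal_tsum_of_nonneg (fun k ↦ P.symR_nonneg k ξ) (P.hasSum_symR ξ).summable,
      (P.hasSum_symR ξ).tsum_eq, ENNReal.ofReal_one]
  calc dblSum P S u v ψ
      ≤ ∑' k, ∑' j, ∫⁻ p : ℝ × ℝ,
          if S j k then F p * ENNReal.ofReal (P.symR j p.1 * P.symR k p.2) else 0 := by
        refine ENNReal.tsum_le_tsum fun k ↦ ENNReal.tsum_le_tsum fun j ↦ ?_
        split_ifs
        · exact hU.enorm_form_blockFun_le P hV j k ψ
        · exact bot_le
    _ = ∫⁻ p : ℝ × ℝ, ∑' k, ∑' j,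
          if S j k then F p * ENNReal.ofReal (P.symR j p.1 * P.symR k p.2) else 0 := by
        rw [lintegral_tsum fun k ↦ (Measurable.tsum fun j ↦ hm' j k).aemeasurable]
        congr 1
        ext k
        rw [lintegral_tsum fun j ↦ (hm' j k).aemeasurable]
    _ ≤ ∫⁻ p : ℝ × ℝ, R.indicator F p := by
        refine lintegral_mono fun p ↦ ?_
        by_cases hp : p ∈ R
        · rw [Set.indicator_of_mem hp]
          calc ∑' k, ∑' j, (if S j k then F p * ENNReal.ofReal (P.symR j p.1 * P.symR k p.2) else 0)
              ≤ ∑' k, ∑' j, F p * (ENNReal.ofReal (P.symR j p.1) * ENNReal.ofReal (P.symR k p.2)) := by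
                refine ENNReal.tsum_le_tsum fun k ↦ ENNReal.tsum_le_tsum fun j ↦ ?_
                rw [ENNReal.ofReal_mul (P.symR_nonneg _ _)]
                split_ifs
                · exact le_rfl
                · exact bot_le
            _ = F p := by
                simp only [ENNReal.tsum_mul_left, ENNReal.tsum_mul_right, hsum, one_mul, mul_one]
        · rw [Set.indicator_of_notMem hp]
          refine le_of_eq ?_
          simp only [ENNReal.tsum_eq_zero]
          intro k j
          split_ifs with h
          · by_cases h1 : P.symR j p.1 = 0
            · simp [h1]
            · by_cases h2 : P.symR k p.2 = 0
              · simp [h2]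
              · exact absurd (hR j k p.1 p.2 h h1 h2) hp
          · rfl
    _ ≤ _ := lintegral_indicator_le _ _

/-- Dominated convergence: the low frequency symbols lie between 0 and 1 and tend to 1. The limit
does not involve the partition. -/
theorem FourierRep.tendsto_form_lowFun (P : DyadicPartition) (hU : FourierRep u U)
    (hV : FourierRep v V) (ψ : 𝓢(ℝ, ℂ))
    (h : ∫⁻ p : ℝ × ℝ, ‖U p.1‖ₑ * ‖V p.2‖ₑ * ‖𝓕⁻ ψ (p.1 + p.2)‖ₑ < ∞) :
    Filter.Tendsto (fun n ↦ form (P.lowFun n u) (P.lowFun n v) ψ) Filter.atTop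
      (nhds (∫ p : ℝ × ℝ, U p.1 * V p.2 * 𝓕⁻ ψ (p.1 + p.2))) := by
  have hl : ∀ n (u : 𝓢'(ℝ, ℂ)), P.lowFun n u = genFun (𝓕 (P.lowS n)) u := fun j u ↦ by
    ext x; exact P.lowFun_eq_genFun j u x
  simp only [hl, hU.form_genFun hV, P.lowS_apply]
  have hUm := hU.measurable
  have hVm := hV.measurable
  have hψ := (measurable_schwartz (𝓕⁻ ψ)).comp (measurable_fst.add measurable_snd :
      Measurable fun p : ℝ × ℝ ↦ p.1 + p.2)
  have hFm : Measurable fun p : ℝ × ℝ ↦ U p.1 * V p.2 * 𝓕⁻ ψ (p.1 + p.2) :=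
    ((hUm.comp measurable_fst).mul (hVm.comp measurable_snd)).mul hψ
  have hl (n : ℕ) (ξ : ℝ) : ‖(P.lowR n ξ : ℂ)‖ ≤ 1 := by
    rw [Complex.norm_real, Real.norm_eq_abs, abs_of_nonneg (P.lowR_nonneg n ξ)]
    exact P.lowR_le_one n ξ
  refine tendsto_integral_of_dominated_convergence
    (fun p ↦ ‖U p.1 * V p.2 * 𝓕⁻ ψ (p.1 + p.2)‖) (fun n ↦ ?_) ⟨hFm.norm.aestronglyMeasurable, ?_⟩
    (fun n ↦ Filter.Eventually.of_forall fun p ↦ ?_)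
    (Filter.Eventually.of_forall fun p ↦ ?_)
  · have h1 : Measurable fun p : ℝ × ℝ ↦ (P.lowR n p.1 : ℂ) :=
      (Complex.continuous_ofReal.comp (P.continuous_lowR n)).measurable.comp measurable_fst
    have h2 : Measurable fun p : ℝ × ℝ ↦ (P.lowR n p.2 : ℂ) :=
      (Complex.continuous_ofReal.comp (P.continuous_lowR n)).measurable.comp measurable_snd
    exact ((((hUm.comp measurable_fst).mul h1).mul
      ((hVm.comp measurable_snd).mul h2)).mul hψ).aestronglyMeasurable
  · rw [hasFiniteIntegral_def]
    simpa only [enorm_norm, enorm_mul] using h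
  · rw [show U p.1 * (P.lowR n p.1 : ℂ) * (V p.2 * (P.lowR n p.2 : ℂ)) * 𝓕⁻ ψ (p.1 + p.2)
      = (P.lowR n p.1 : ℂ) * (P.lowR n p.2 : ℂ) * (U p.1 * V p.2 * 𝓕⁻ ψ (p.1 + p.2)) by ring,
      norm_mul]
    refine mul_le_of_le_one_left (norm_nonneg _) ?_
    rw [norm_mul]
    exact mul_le_one₀ (hl n _) (norm_nonneg _) (hl n _)
  · have e (ξ : ℝ) : Filter.Tendsto (fun n ↦ (P.lowR n ξ : ℂ)) Filter.atTop (nhds 1) := by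
      have := (Complex.continuous_ofReal.tendsto _).comp (P.tendsto_lowR ξ)
      simpa [Function.comp_def] using this
    have := ((((e p.1).const_mul (U p.1)).mul ((e p.2).const_mul (V p.2))).mul_const
      (𝓕⁻ ψ (p.1 + p.2)))
    simpa using this

/-- The product exists if the convolution of the Fourier transforms converges absolutely. -/
theorem FourierRep.exists_isProductAt (hU : FourierRep u U) (hV : FourierRep v V) {m : ℝ}
    {C : ℝ≥0} (h : ∀ ψ : 𝓢(ℝ, ℂ), ∫⁻ p : ℝ × ℝ, ‖U p.1‖ₑ * ‖V p.2‖ₑ * ‖𝓕⁻ ψ (p.1 + p.2)‖ₑ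
      ≤ C * wN m (fun ξ ↦ ‖𝓕⁻ ψ ξ‖ₑ)) (P₀ : DyadicPartition) :
    ∃ w, (∀ P, IsProductAt P u v w) ∧ ∀ ψ, ‖w ψ‖ₑ ≤ C * wN m (fun ξ ↦ ‖𝓕⁻ ψ ξ‖ₑ) := by
  have hu := hU.regular
  have hv := hV.regular
  have hfin : ∀ ψ : 𝓢(ℝ, ℂ),
      ∫⁻ p : ℝ × ℝ, ‖U p.1‖ₑ * ‖V p.2‖ₑ * ‖𝓕⁻ ψ (p.1 + p.2)‖ₑ < ∞ := fun ψ ↦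
    (h ψ).trans_lt (ENNReal.mul_lt_top ENNReal.coe_lt_top (wN_schwartz_lt_top m (𝓕⁻ ψ)))
  have hex : ∀ P, ∃ w, IsProductAt P u v w := fun P ↦ by
    refine ProductLaws.exists_isProductAt hu hv (M := 1) le_rfl (m := m) (C := 5 * C) fun ψ ↦ ?_
    refine (bony_le_dblSum hu hv ψ).trans ?_
    rw [ENNReal.coe_mul, mul_assoc]
    refine mul_le_mul' (by norm_num) (le_trans ?_ (h ψ))
    simpa using hU.dblSum_le P hV (S := fun _ _ ↦ True) (R := Set.univ) (by simp) ψ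
  choose w hw using hex
  have hlim : ∀ P ψ, w P ψ = ∫ p : ℝ × ℝ, U p.1 * V p.2 * 𝓕⁻ ψ (p.1 + p.2) := fun P ψ ↦
    tendsto_nhds_unique ((hw P).tendsto hu hv ψ) (hU.tendsto_form_lowFun P hV ψ (hfin ψ))
  refine ⟨w P₀, fun P ↦ ?_, fun ψ ↦ ?_⟩
  · have : w P₀ = w P := by ext ψ; rw [hlim, hlim]
    rw [this]
    exact hw P
  · rw [hlim]
    refine (enorm_integral_le_lintegral_enorm _).trans ?_
    simpa only [enorm_mul] using h ψ

end FourierRep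

theorem sobolevNorm_le_of_bound {s : ℝ} {w : 𝓢'(ℝ, ℂ)} {C : ℝ≥0∞} (hC : C ≠ ∞)
    (h : ∀ ψ, ‖w ψ‖ₑ ≤ C * wN (-s) (fun ξ ↦ ‖𝓕⁻ ψ ξ‖ₑ)) :
    w ∈ SobolevSpace s ∧ sobolevNorm s w ≤ C := by
  lift C to ℝ≥0 using hC
  obtain ⟨w', hw', h1, h2⟩ := exists_sobolev_of_bound (s := s)
    (w : 𝓢(ℝ, ℂ) →L[ℂ] ℂ).toLinearMap C h
  have : w' = w := by ext ψ; exact hw' ψ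
  rw [← this]
  exact ⟨h1, h2⟩

end ProductLaws

end

noncomputable section

namespace ProductLaws

/-! ### The partial sums of the blocks converge -/

namespace DyadicPartition

variable (P : DyadicPartition)

/-- The functions are dilates of 1 - χ by factors 2^{-n} ≤ 1, and each derivative only gains such a
factor. -/
theorem exists_norm_iteratedFDeriv_one_sub_lowS_le (i : ℕ) :
    ∃ B, 0 ≤ B ∧ ∀ n x, ‖iteratedFDeriv ℝ i (fun x ↦ 1 - P.lowS (n + 1) x) x‖ ≤ B := by
  set ρ : ℝ → ℂ := fun x ↦ 1 - P.symbolS 0 x with hρ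
  have hsm : ContDiff ℝ i (P.symbolS 0) := (P.symbolS 0).smooth i
  have hρs : ContDiff ℝ i ρ := contDiff_const.sub hsm
  refine ⟨1 + SchwartzMap.seminorm ℝ 0 i (P.symbolS 0), by positivity, fun n x ↦ ?_⟩
  have h1 : (fun x ↦ 1 - P.lowS (n + 1) x) = fun x ↦ ρ (((2 : ℝ)⁻¹ ^ n) • x) := by
    ext x
    simp only [hρ, P.lowS_apply, P.symbolS_apply, P.lowR_succ_eq, smul_eq_mul]
    rfl
  have h2 : ∀ y, ‖iteratedFDeriv ℝ i ρ y‖ ≤ 1 + SchwartzMap.seminorm ℝ 0 i (P.symbolS 0) := by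
    intro y
    have : ρ = (fun _ ↦ (1 : ℂ)) - (P.symbolS 0 : ℝ → ℂ) := rfl
    rw [this, iteratedFDeriv_sub_apply contDiff_const.contDiffAt hsm.contDiffAt]
    refine (norm_sub_le _ _).trans (add_le_add ?_ ?_)
    · cases i with
      | zero => simp
      | succ i => rw [iteratedFDeriv_const_of_ne (by simp)]; simp
    · exact SchwartzMap.norm_iteratedFDeriv_le_seminorm ℝ (P.symbolS 0) i y
  rw [h1, iteratedFDeriv_comp_const_smul _ hρs]
  refine le_trans ?_ (h2 (((2 : ℝ)⁻¹ ^ n) • x))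
  rw [norm_smul, norm_pow, norm_pow]
  refine mul_le_of_le_one_left (norm_nonneg _) (pow_le_one₀ (by positivity) (pow_le_one₀ ?_ ?_))
  · positivity
  · norm_num

/-- The factor 1 - S_{n+1} vanishes on a ball of radius about 2^n. Outside it one more power of |x|
in the seminorm is exchanged for 2^{-n}. -/
theorem exists_seminorm_sub_lowS_le (k l : ℕ) (ψ : 𝓢(ℝ, ℂ)) :
    ∃ D, ∀ n, SchwartzMap.seminorm ℝ k l
      (ψ - SchwartzMap.smulLeftCLM ℂ (P.lowS (n + 1)) ψ) ≤ D * (2 : ℝ)⁻¹ ^ n := by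
  obtain ⟨a, b, M, h⟩ := P.exists_scales
  choose B hB0 hB using P.exists_norm_iteratedFDeriv_one_sub_lowS_le
  set D : ℝ := ∑ i ∈ Finset.range (l + 1),
    (l.choose i : ℝ) * B i * SchwartzMap.seminorm ℝ (k + 1) (l - i) ψ with hD
  have hD0 : 0 ≤ D := Finset.sum_nonneg fun i _ ↦
    mul_nonneg (mul_nonneg (by positivity) (hB0 i)) (apply_nonneg _ _)
  have ha := h.pos_a
  refine ⟨a⁻¹ * D, fun n ↦ SchwartzMap.seminorm_le_bound ℝ k l _ (by positivity) fun x ↦ ?_⟩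
  have hfun : ((ψ - SchwartzMap.smulLeftCLM ℂ (P.lowS (n + 1)) ψ : 𝓢(ℝ, ℂ)) : ℝ → ℂ)
      = fun x ↦ (1 - P.lowS (n + 1) x) * ψ x := by
    ext x
    rw [sub_apply, SchwartzMap.smulLeftCLM_apply_apply (P.lowS (n + 1)).hasTemperateGrowth,
      smul_eq_mul]
    ring
  have hx0 := norm_nonneg x
  rw [hfun]
  rcases lt_or_ge |x| (a * 2 ^ (n + 1)) with hx | hx
  · have : (fun x ↦ (1 - P.lowS (n + 1) x) * ψ x) =ᶠ[nhds x] fun _ ↦ 0 := by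
      filter_upwards [(isOpen_lt continuous_abs continuous_const).mem_nhds hx] with y hy
      rw [P.lowS_apply, h.lowR_eq_one _ _ (Nat.succ_ne_zero n) (le_of_lt hy)]
      simp
    rw [(Filter.EventuallyEq.iteratedFDeriv ℝ this l).eq_of_nhds]
    rw [iteratedFDeriv_fun_zero]
    simp only [Pi.zero_apply, norm_zero, mul_zero]
    positivity
  · have hxk : ‖x‖ ^ k ≤ ‖x‖ ^ (k + 1) * (a⁻¹ * (2 : ℝ)⁻¹ ^ n) := by
      rw [pow_succ, mul_assoc]
      refine le_mul_of_one_le_right (by positivity) ?_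
      rw [Real.norm_eq_abs, inv_pow, ← mul_inv, ← div_eq_mul_inv, one_le_div (by positivity)]
      refine le_trans ?_ hx
      gcongr
      · norm_num
      · omega
    have hsm : ContDiff ℝ l fun x ↦ 1 - P.lowS (n + 1) x :=
      contDiff_const.sub ((P.lowS (n + 1)).smooth l)
    calc ‖x‖ ^ k * ‖iteratedFDeriv ℝ l (fun x ↦ (1 - P.lowS (n + 1) x) * ψ x) x‖
        ≤ (‖x‖ ^ (k + 1) * (a⁻¹ * (2 : ℝ)⁻¹ ^ n)) * ∑ i ∈ Finset.range (l + 1),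
          (l.choose i : ℝ) * ‖iteratedFDeriv ℝ i (fun x ↦ 1 - P.lowS (n + 1) x) x‖
            * ‖iteratedFDeriv ℝ (l - i) ψ x‖ := by
          gcongr
          exact norm_iteratedFDeriv_mul_le hsm (ψ.smooth l) x le_rfl
      _ = (a⁻¹ * (2 : ℝ)⁻¹ ^ n) * ∑ i ∈ Finset.range (l + 1),
          (l.choose i : ℝ) * ‖iteratedFDeriv ℝ i (fun x ↦ 1 - P.lowS (n + 1) x) x‖
            * (‖x‖ ^ (k + 1) * ‖iteratedFDeriv ℝ (l - i) ψ x‖) := by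
          rw [mul_comm (‖x‖ ^ (k + 1)), mul_assoc, Finset.mul_sum]
          congr 1
          exact Finset.sum_congr rfl fun i _ ↦ by ring
      _ ≤ (a⁻¹ * (2 : ℝ)⁻¹ ^ n) * D := by
          refine mul_le_mul_of_nonneg_left (Finset.sum_le_sum fun i _ ↦ ?_) (by positivity)
          refine mul_le_mul (mul_le_mul_of_nonneg_left (hB i n x) (by positivity))
            (SchwartzMap.le_seminorm ℝ (k + 1) (l - i) ψ x) (by positivity)
            (mul_nonneg (by positivity) (hB0 i))
      _ = _ := by ring

theorem tendsto_smulLeft_lowS (ψ : 𝓢(ℝ, ℂ)) :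
    Filter.Tendsto (fun n ↦ SchwartzMap.smulLeftCLM ℂ (P.lowS n) ψ) Filter.atTop (nhds ψ) := by
  rw [← Filter.tendsto_add_atTop_iff_nat 1, (schwartz_withSeminorms ℝ ℝ ℂ).tendsto_nhds]
  rintro ⟨k, l⟩ ε hε
  obtain ⟨D, hD⟩ := P.exists_seminorm_sub_lowS_le k l ψ
  have h0 : Filter.Tendsto (fun n : ℕ ↦ D * (2 : ℝ)⁻¹ ^ n) Filter.atTop (nhds 0) := by
    simpa using (tendsto_pow_atTop_nhds_zero_of_lt_one (by norm_num : (0 : ℝ) ≤ 2⁻¹)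
      (by norm_num)).const_mul D
  filter_upwards [h0.eventually_lt_const hε] with n hn
  rw [← map_neg_eq_map, neg_sub]
  exact (hD n).trans_lt hn

theorem tendsto_sum_block (u : 𝓢'(ℝ, ℂ)) (φ : 𝓢(ℝ, ℂ)) :
    Filter.Tendsto (fun n ↦ ∑ j ∈ Finset.range n, P.block j u φ) Filter.atTop (nhds (u φ)) := by
  have h2 : Filter.Tendsto (fun n ↦ 𝓕 (SchwartzMap.smulLeftCLM ℂ (P.lowS n) (𝓕⁻ φ))) Filter.atTop
      (nhds (𝓕 (𝓕⁻ φ))) :=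
    ((fourierCLM ℂ 𝓢(ℝ, ℂ)).continuous.tendsto _).comp (P.tendsto_smulLeft_lowS (𝓕⁻ φ))
  rw [FourierTransform.fourier_fourierInv_eq] at h2
  have h1 : Filter.Tendsto (fun n ↦ u (𝓕 (SchwartzMap.smulLeftCLM ℂ (P.lowS n) (𝓕⁻ φ))))
      Filter.atTop (nhds (u φ)) :=
    ((ContinuousLinearMap.continuous u).tendsto _).comp h2
  refine h1.congr fun n ↦ ?_
  have : SchwartzMap.smulLeftCLM ℂ (P.lowS n) (𝓕⁻ φ)
      = ∑ j ∈ Finset.range n, SchwartzMap.smulLeftCLM ℂ (P.symbol j) (𝓕⁻ φ) := by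
    ext x
    rw [SchwartzMap.smulLeftCLM_apply_apply (P.lowS n).hasTemperateGrowth, sum_apply,
      lowS, sum_apply, Finset.sum_smul]
    refine Finset.sum_congr rfl fun j _ ↦ ?_
    exact (SchwartzMap.smulLeftCLM_apply_apply (P.symbolS j).hasTemperateGrowth (𝓕⁻ φ) x).symm
  rw [this, ← fourierCLM_apply (R := ℂ), map_sum, map_sum]
  refine Finset.sum_congr rfl fun j _ ↦ ?_
  rw [DyadicPartition.block, fourierMultiplierCLM_apply_apply]
  rfl

end DyadicPartition

end ProductLaws

end

noncomputable section

namespace ProductLaws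

/-! ### Agreement with the pointwise product -/

theorem sobolevNorm_zero (u : 𝓢'(ℝ, ℂ)) : sobolevNorm 0 u = normLp 2 u := by
  rw [sobolevNorm, besselPotential_zero]
  rfl

theorem exists_fourierRep_L2 (f : Lp ℂ 2 (volume : Measure ℝ)) :
    ∃ (U : ℝ → ℂ) (hU : MemLp U 2 volume), FourierRep (f : 𝓢'(ℝ, ℂ)) U ∧ f = 𝓕⁻ (hU.toLp U) := by
  have hf : sobolevNorm 0 (f : 𝓢'(ℝ, ℂ)) = ‖f‖ₑ := by rw [sobolevNorm_zero, normLp_coe]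
  obtain ⟨U, hU, hn⟩ := exists_fourierRep (s := 0) (u := (f : 𝓢'(ℝ, ℂ)))
    (mem_sobolevSpace_iff.2 (by rw [hf]; exact enorm_lt_top))
  rw [wN_zero_eq, hf, n2_eq_eLpNorm] at hn
  have hU2 : MemLp U 2 volume := ⟨hU.measurable.aestronglyMeasurable, by rw [hn]; exact enorm_lt_top⟩
  refine ⟨U, hU2, hU, ?_⟩
  have hinj := LinearMap.ker_eq_bot.mp
    (Lp.ker_toTemperedDistributionCLM_eq_bot (F := ℂ) (μ := (volume : Measure ℝ)) (p := 2))
  refine hinj ?_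
  ext φ
  change (f : 𝓢'(ℝ, ℂ)) φ = ((𝓕⁻ (hU2.toLp U) : Lp ℂ 2 (volume : Measure ℝ)) : 𝓢'(ℝ, ℂ)) φ
  rw [toTemperedDistribution_fourierInv_apply, hU.rep]

theorem regular_L2 (f : Lp ℂ 2 (volume : Measure ℝ)) : Regular (f : 𝓢'(ℝ, ℂ)) := by
  obtain ⟨U, -, hU, -⟩ := exists_fourierRep_L2 f
  exact hU.regular

theorem lowFun_eq_fourierInv (P : DyadicPartition) {u : 𝓢'(ℝ, ℂ)} {U : ℝ → ℂ}
    (hU : FourierRep u U) (n : ℕ) : P.lowFun n u = 𝓕⁻ (fun ξ ↦ U ξ * P.lowS n ξ) := by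
  ext x
  rw [P.lowFun_eq_genFun, hU.genFun_eq, FourierTransform.fourierInv_fourier_eq]

/-- By Plancherel the error is the L² norm of U times a multiplier that is bounded and tends to zero
pointwise. -/
theorem tendsto_n2_lowFun_sub (P : DyadicPartition) (f : Lp ℂ 2 (volume : Measure ℝ)) :
    Filter.Tendsto (fun n ↦ n2 volume (fun x ↦ ‖P.lowFun n (f : 𝓢'(ℝ, ℂ)) x - f x‖ₑ))
      Filter.atTop (nhds 0) := by
  obtain ⟨U, hU2, hU, hfU⟩ := exists_fourierRep_L2 f
  have hle (n : ℕ) (ξ : ℝ) : ‖P.lowS n ξ‖ ≤ 1 := by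
    rw [P.lowS_apply, Complex.norm_real, Real.norm_eq_abs, abs_of_nonneg (P.lowR_nonneg n ξ)]
    exact P.lowR_le_one n ξ
  have hUn (n : ℕ) : MemLp (fun ξ ↦ U ξ * P.lowS n ξ) 2 volume := by
    refine hU2.mono (hU.measurable.mul (measurable_schwartz _)).aestronglyMeasurable
      (Filter.Eventually.of_forall fun ξ ↦ ?_)
    rw [norm_mul]
    exact mul_le_of_le_one_right (norm_nonneg _) (hle n ξ)
  have key (n : ℕ) : n2 volume (fun x ↦ ‖P.lowFun n (f : 𝓢'(ℝ, ℂ)) x - f x‖ₑ) ^ 2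
      = ∫⁻ ξ, ‖U ξ * P.lowS n ξ - U ξ‖ₑ ^ 2 := by
    rw [← n2_sq]
    congr 1
    rw [n2_eq_eLpNorm (F := fun ξ ↦ U ξ * P.lowS n ξ - U ξ),
      n2_eq_eLpNorm (F := fun x ↦ P.lowFun n (f : 𝓢'(ℝ, ℂ)) x - f x),
      lowFun_eq_fourierInv P hU]
    have h1 := fourierInv_ae_eq (hUn n) (hU.integrable _)
    calc eLpNorm (fun x ↦ 𝓕⁻ (fun ξ ↦ U ξ * P.lowS n ξ) x - f x) 2 volume
        = eLpNorm ((𝓕⁻ ((hUn n).toLp _) - 𝓕⁻ (hU2.toLp U) : Lp ℂ 2 (volume : Measure ℝ)) : ℝ → ℂ)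
          2 volume := by
          refine eLpNorm_congr_ae ?_
          filter_upwards [h1, Lp.coeFn_sub (𝓕⁻ ((hUn n).toLp _)) (𝓕⁻ (hU2.toLp U))] with x hx hx'
          rw [hx', Pi.sub_apply, hx, ← hfU]
      _ = ‖(hUn n).toLp _ - hU2.toLp U‖ₑ := by
          rw [← Lp.enorm_def, ← enorm_fourier_eq, sub_eq_add_neg,
            FourierTransform.fourier_add, FourierTransform.fourier_neg,
            FourierTransform.fourier_fourierInv_eq, FourierTransform.fourier_fourierInv_eq,
            ← sub_eq_add_neg]
      _ = _ := by
          rw [← MemLp.toLp_sub, Lp.enorm_toLp]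
          rfl
  have hU2' : ∫⁻ ξ, ‖U ξ‖ₑ ^ 2 < ∞ := by
    rw [← n2_sq, n2_eq_eLpNorm]
    exact ENNReal.pow_lt_top hU2.2
  have hlim : Filter.Tendsto (fun n ↦ ∫⁻ ξ, ‖U ξ * P.lowS n ξ - U ξ‖ₑ ^ 2) Filter.atTop
      (nhds (∫⁻ _ : ℝ, 0)) := by
    refine tendsto_lintegral_of_dominated_convergence (fun ξ ↦ 4 * ‖U ξ‖ₑ ^ 2) (fun n ↦ ?_)
      (fun n ↦ Filter.Eventually.of_forall fun ξ ↦ ?_) ?_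
      (Filter.Eventually.of_forall fun ξ ↦ ?_)
    · exact ((hU.measurable.mul (measurable_schwartz _)).sub hU.measurable).enorm.pow_const 2
    · have : ‖U ξ * P.lowS n ξ - U ξ‖ₑ ≤ 2 * ‖U ξ‖ₑ := by
        refine (enorm_sub_le).trans ?_
        rw [enorm_mul, two_mul]
        gcongr
        refine mul_le_of_le_one_right' ?_
        rw [← ofReal_norm]
        exact ENNReal.ofReal_le_one.2 (hle n ξ)
      calc ‖U ξ * P.lowS n ξ - U ξ‖ₑ ^ 2 ≤ (2 * ‖U ξ‖ₑ) ^ 2 := by gcongr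
        _ = 4 * ‖U ξ‖ₑ ^ 2 := by rw [mul_pow]; norm_num
    · rw [lintegral_const_mul' _ _ (by norm_num)]
      exact (ENNReal.mul_lt_top (by norm_num) hU2').ne
    · have h1 : Filter.Tendsto (fun n ↦ P.lowS n ξ) Filter.atTop (nhds 1) := by
        simp only [P.lowS_apply]
        simpa [Function.comp_def] using (Complex.continuous_ofReal.tendsto _).comp (P.tendsto_lowR ξ)
      have h2 := ((h1.const_mul (U ξ)).sub_const (U ξ)).enorm
      rw [mul_one, sub_self, enorm_zero] at h2
      have h3 := ((ENNReal.continuous_pow 2).tendsto 0).comp h2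
      simpa [Function.comp_def] using h3
  rw [lintegral_zero] at hlim
  have h3 := (ENNReal.continuous_rpow_const (y := 1 / 2)).tendsto 0 |>.comp hlim
  rw [ENNReal.zero_rpow_of_pos (by norm_num)] at h3
  refine h3.congr fun n ↦ ?_
  rw [Function.comp_apply, ← key, ← ENNReal.rpow_natCast, ← ENNReal.rpow_mul]
  norm_num

/-- The low frequency parts of a bounded function converge weakly. -/
theorem tendsto_integral_mul_lowFun (P : DyadicPartition) (g : Lp ℂ ∞ (volume : Measure ℝ))
    {h : ℝ → ℂ} (hh : Integrable h) :
    Filter.Tendsto (fun n ↦ ∫ x, h x * P.lowFun n (g : 𝓢'(ℝ, ℂ)) x) Filter.atTop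
      (nhds (∫ x, h x * g x)) := by
  have hg := regular_Linfty g
  have hS : ∀ φ : 𝓢(ℝ, ℂ), Filter.Tendsto (fun n ↦ ∫ x, φ x * P.lowFun n (g : 𝓢'(ℝ, ℂ)) x)
      Filter.atTop (nhds (∫ x, φ x * g x)) := by
    intro φ
    have h1 := P.tendsto_sum_block (g : 𝓢'(ℝ, ℂ)) φ
    rw [Lp.toTemperedDistribution_apply] at h1
    simp only [smul_eq_mul] at h1
    refine h1.congr fun n ↦ ?_
    simp only [hg.block_apply P, DyadicPartition.lowFun, Finset.mul_sum]
    rw [integral_finsetSum]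
    · simp only [mul_comm]
    · intro j _
      have := integrable_form (hg.growth_blockFun P j) (Function.HasTemperateGrowth.const (1 : ℂ)) φ
      simpa [mul_comm] using this
  -- `K` bounds S_n g - g uniformly, so the convergence already known for Schwartz functions extends
  -- to L¹ by density.
  set K : ℝ := (P.lowConst.toReal + 1) * ‖g‖ with hK
  have hK0 : 0 ≤ K := by positivity
  have hb (n : ℕ) : ∀ᵐ x, ‖P.lowFun n (g : 𝓢'(ℝ, ℂ)) x - g x‖ ≤ K := by
    filter_upwards [ae_norm_le_Linfty g] with x hx
    refine (norm_sub_le _ _).trans ?_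
    have := ENNReal.toReal_mono (ENNReal.mul_ne_top P.lowConst_lt_top.ne enorm_ne_top)
      (P.enorm_lowFun_le n g x)
    rw [ENNReal.toReal_mul, toReal_enorm, toReal_enorm] at this
    rw [hK]
    linarith
  have hlm (n : ℕ) : AEStronglyMeasurable (P.lowFun n (g : 𝓢'(ℝ, ℂ))) :=
    (hg.growth_lowFun P n).1.continuous.aestronglyMeasurable
  have hi (n : ℕ) {h : ℝ → ℂ} (hh : Integrable h) :
      Integrable (fun x ↦ h x * (P.lowFun n (g : 𝓢'(ℝ, ℂ)) x - g x)) :=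
    hh.mul_bdd ((hlm n).sub (Lp.aestronglyMeasurable g)) (hb n)
  have hig {h : ℝ → ℂ} (hh : Integrable h) : Integrable (fun x ↦ h x * g x) :=
    hh.mul_bdd (Lp.aestronglyMeasurable g) (ae_norm_le_Linfty g)
  have hsub (n : ℕ) {h : ℝ → ℂ} (hh : Integrable h) :
      (∫ x, h x * P.lowFun n (g : 𝓢'(ℝ, ℂ)) x) - ∫ x, h x * g x
        = ∫ x, h x * (P.lowFun n (g : 𝓢'(ℝ, ℂ)) x - g x) := by
    rw [sub_eq_iff_eq_add, ← integral_add (hi n hh) (hig hh)]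
    congr 1; ext x; ring
  rw [Metric.tendsto_atTop]
  intro ε hε
  obtain ⟨φ, hφ⟩ := (SchwartzMap.denseRange_toLpCLM (F := ℂ) (E := ℝ) (p := 1) (μ := volume)
    (by norm_num)).exists_dist_lt (hh.toL1 h) (show 0 < ε / (2 * (K + 1)) by positivity)
  have hφ1 : ∫ x, ‖h x - φ x‖ < ε / (2 * (K + 1)) := by
    rw [dist_eq_norm, L1.norm_eq_integral_norm] at hφ
    refine lt_of_le_of_lt (le_of_eq (integral_congr_ae ?_)) hφ
    filter_upwards [hh.coeFn_toL1, φ.coeFn_toLp 1 volume,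
      Lp.coeFn_sub (hh.toL1 h) (SchwartzMap.toLpCLM ℝ ℂ 1 volume φ)] with x h1 h2 h3
    rw [h3, Pi.sub_apply, h1]
    change _ = ‖h x - (φ.toLp 1 volume) x‖
    rw [h2]
  obtain ⟨N, hN⟩ := Metric.tendsto_atTop.1 (hS φ) (ε / 2) (by positivity)
  refine ⟨N, fun n hn ↦ ?_⟩
  have h1 := hN n hn
  rw [dist_eq_norm, hsub n φ.integrable] at h1
  rw [dist_eq_norm, hsub n hh]
  have h2 : ∫ x, h x * (P.lowFun n (g : 𝓢'(ℝ, ℂ)) x - g x)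
      = (∫ x, (h x - φ x) * (P.lowFun n (g : 𝓢'(ℝ, ℂ)) x - g x))
        + ∫ x, φ x * (P.lowFun n (g : 𝓢'(ℝ, ℂ)) x - g x) := by
    have := hi n (h := fun x ↦ h x - φ x) (hh.sub φ.integrable)
    rw [← integral_add this (hi n φ.integrable)]
    congr 1; ext x; ring
  have h3 : ‖∫ x, (h x - φ x) * (P.lowFun n (g : 𝓢'(ℝ, ℂ)) x - g x)‖
      ≤ K * ∫ x, ‖h x - φ x‖ := by
    rw [← integral_const_mul]
    refine norm_integral_le_of_norm_le ((hh.sub φ.integrable).norm.const_mul K) ?_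
    filter_upwards [hb n] with x hx
    rw [norm_mul, mul_comm]
    gcongr
  calc _ ≤ K * (∫ x, ‖h x - φ x‖) + ‖∫ x, φ x * (P.lowFun n (g : 𝓢'(ℝ, ℂ)) x - g x)‖ := by
        rw [h2]
        exact (norm_add_le _ _).trans (by gcongr)
    _ < K * (ε / (2 * (K + 1))) + ε / 2 :=
        add_lt_add_of_le_of_lt (mul_le_mul_of_nonneg_left hφ1.le hK0) h1
    _ ≤ (K + 1) * (ε / (2 * (K + 1))) + ε / 2 := by gcongr; linarith
    _ = ε := by field_simp; ring

/-- The product is the pointwise product of an `L²` function with an `L²` or an `L^∞` function. -/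
theorem IsProductAt.agreesWithPointwise {P : DyadicPartition} {u v w : 𝓢'(ℝ, ℂ)}
    (h : IsProductAt P u v w) : AgreesWithPointwise u v w := by
  rintro f rfl
  have hf := regular_L2 f
  have hfm := Lp.aestronglyMeasurable f
  have hnf : n2 volume (fun x ↦ ‖f x‖ₑ) ≠ ∞ := by
    rw [n2_eq_eLpNorm]; exact (Lp.memLp f).2.ne
  have h1 := tendsto_n2_lowFun_sub P f
  set A : ℕ → ℝ → ℂ := fun n ↦ P.lowFun n (f : 𝓢'(ℝ, ℂ)) with hA
  have hAm (n : ℕ) : AEStronglyMeasurable (A n) :=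
    (hf.growth_lowFun P n).1.continuous.aestronglyMeasurable
  refine ⟨?_, ?_⟩
  · rintro g rfl ψ
    have hg := regular_L2 g
    have hgm := Lp.aestronglyMeasurable g
    have hng : n2 volume (fun x ↦ ‖g x‖ₑ) ≠ ∞ := by
      rw [n2_eq_eLpNorm]; exact (Lp.memLp g).2.ne
    have h2 := tendsto_n2_lowFun_sub P g
    set B : ℕ → ℝ → ℂ := fun n ↦ P.lowFun n (g : 𝓢'(ℝ, ℂ)) with hB
    have hBm (n : ℕ) : AEStronglyMeasurable (B n) :=
      (hg.growth_lowFun P n).1.continuous.aestronglyMeasurable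
    refine tendsto_nhds_unique (h.tendsto hf hg ψ) ?_
    refine tendsto_integral_of_L1 (fun x ↦ ψ x * (f x * g x))
      (ψ.continuous.aestronglyMeasurable.mul (hfm.mul hgm))
      (Filter.Eventually.of_forall fun n ↦ integrable_form (hf.growth_lowFun P n)
        (hg.growth_lowFun P n) ψ) ?_
    set c : ℝ≥0∞ := ENNReal.ofReal (SchwartzMap.seminorm ℂ 0 0 ψ) with hc
    have hψ (x : ℝ) : ‖ψ x‖ₑ ≤ c := by
      rw [← ofReal_norm]
      exact ENNReal.ofReal_le_ofReal (SchwartzMap.norm_le_seminorm ℂ ψ x)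
    have hle (n : ℕ) : ∫⁻ x, ‖A n x * B n x * ψ x - ψ x * (f x * g x)‖ₑ
        ≤ c * (n2 volume (fun x ↦ ‖A n x - f x‖ₑ) * n2 volume (fun x ↦ ‖B n x - g x‖ₑ)
          + n2 volume (fun x ↦ ‖A n x - f x‖ₑ) * n2 volume (fun x ↦ ‖g x‖ₑ)
          + n2 volume (fun x ↦ ‖f x‖ₑ) * n2 volume (fun x ↦ ‖B n x - g x‖ₑ)) := by
      have m1 : AEMeasurable (fun x ↦ ‖A n x - f x‖ₑ) := ((hAm n).sub hfm).enorm
      have m2 : AEMeasurable (fun x ↦ ‖B n x - g x‖ₑ) := ((hBm n).sub hgm).enorm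
      have m3 : AEMeasurable (fun x ↦ ‖f x‖ₑ * ‖B n x - g x‖ₑ) := hfm.enorm.mul m2
      have m4 : AEMeasurable (fun x ↦ ‖A n x - f x‖ₑ * ‖g x‖ₑ) := m1.mul hgm.enorm
      calc _ ≤ ∫⁻ x, c * (‖A n x - f x‖ₑ * ‖B n x - g x‖ₑ + ‖A n x - f x‖ₑ * ‖g x‖ₑ
            + ‖f x‖ₑ * ‖B n x - g x‖ₑ) := by
            refine lintegral_mono fun x ↦ ?_
            -- AB - fg is written in terms of the errors A - f and B - g, each of which tends to
            -- zero in L².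
            have : A n x * B n x * ψ x - ψ x * (f x * g x) = ψ x * ((A n x - f x) * (B n x - g x)
              + (A n x - f x) * g x + f x * (B n x - g x)) := by ring
            rw [this, enorm_mul]
            gcongr
            · exact hψ x
            · refine (enorm_add_le _ _).trans ?_
              rw [enorm_mul]
              gcongr
              refine (enorm_add_le _ _).trans ?_
              rw [enorm_mul, enorm_mul]
        _ = c * ((∫⁻ x, ‖A n x - f x‖ₑ * ‖B n x - g x‖ₑ) + (∫⁻ x, ‖A n x - f x‖ₑ * ‖g x‖ₑ)
            + ∫⁻ x, ‖f x‖ₑ * ‖B n x - g x‖ₑ) := by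
            rw [lintegral_const_mul' _ _ ENNReal.ofReal_ne_top,
              lintegral_add_right' _ m3, lintegral_add_right' _ m4]
        _ ≤ _ := by
            gcongr
            · exact lintegral_mul_le_n2 m1 m2
            · exact lintegral_mul_le_n2 m1 hgm.enorm
            · exact lintegral_mul_le_n2 hfm.enorm m2
    refine tendsto_of_tendsto_of_tendsto_of_le_of_le tendsto_const_nhds ?_ (fun _ ↦ bot_le) hle
    have t1 := ENNReal.Tendsto.mul h1 (Or.inr ENNReal.zero_ne_top) h2 (Or.inr ENNReal.zero_ne_top)
    have t2 := ENNReal.Tendsto.mul_const h1 (b := n2 volume (fun x ↦ ‖g x‖ₑ)) (Or.inr hng)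
    have t3 := ENNReal.Tendsto.const_mul h2 (a := n2 volume (fun x ↦ ‖f x‖ₑ)) (Or.inr hnf)
    have := ENNReal.Tendsto.const_mul ((t1.add t2).add t3) (a := c) (Or.inr ENNReal.ofReal_ne_top)
    simpa using this
  · rintro g rfl ψ
    have hg := regular_Linfty g
    have hgm := Lp.aestronglyMeasurable g
    set B : ℕ → ℝ → ℂ := fun n ↦ P.lowFun n (g : 𝓢'(ℝ, ℂ)) with hB
    have hBm (n : ℕ) : AEStronglyMeasurable (B n) :=
      (hg.growth_lowFun P n).1.continuous.aestronglyMeasurable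
    have hfψ : Integrable (fun x ↦ f x * ψ x) := integrable_lp_mul_schwartz f ψ
    have hBle (n : ℕ) (x : ℝ) : ‖B n x‖ₑ ≤ P.lowConst * ‖g‖ₑ := P.enorm_lowFun_le n g x
    have hK : P.lowConst * ‖g‖ₑ ≠ ∞ := ENNReal.mul_ne_top P.lowConst_lt_top.ne enorm_ne_top
    have hi1 (n : ℕ) : Integrable (fun x ↦ A n x * B n x * ψ x) :=
      integrable_form (hf.growth_lowFun P n) (hg.growth_lowFun P n) ψ
    have hi2 (n : ℕ) : Integrable (fun x ↦ f x * ψ x * B n x) := by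
      refine hfψ.mul_bdd (c := (P.lowConst * ‖g‖ₑ).toReal) (hBm n)
        (Filter.Eventually.of_forall fun x ↦ ?_)
      rw [← toReal_enorm]
      exact ENNReal.toReal_mono hK (hBle n x)
    -- For bounded g there is only weak convergence of S_n g. The strong L² convergence of S_n f
    -- first replaces S_n f by f; the weak limit is then taken against the fixed integrable function
    -- fψ.
    have hdiff : Filter.Tendsto (fun n ↦ ∫ x, (A n x * B n x * ψ x - f x * ψ x * B n x))
        Filter.atTop (nhds (∫ _ : ℝ, (0 : ℂ))) := by
      refine tendsto_integral_of_L1 _ aestronglyMeasurable_const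
        (Filter.Eventually.of_forall fun n ↦ (hi1 n).sub (hi2 n)) ?_
      have hle (n : ℕ) : ∫⁻ x, ‖A n x * B n x * ψ x - f x * ψ x * B n x - 0‖ₑ
          ≤ P.lowConst * ‖g‖ₑ * (n2 volume (fun x ↦ ‖A n x - f x‖ₑ)
            * n2 volume (fun x ↦ ‖ψ x‖ₑ)) := by
        calc _ ≤ ∫⁻ x, P.lowConst * ‖g‖ₑ * (‖A n x - f x‖ₑ * ‖ψ x‖ₑ) := by
              refine lintegral_mono fun x ↦ ?_
              have : A n x * B n x * ψ x - f x * ψ x * B n x - 0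
                = B n x * ((A n x - f x) * ψ x) := by ring
              rw [this, enorm_mul, enorm_mul]
              gcongr
              exact hBle n x
          _ = P.lowConst * ‖g‖ₑ * ∫⁻ x, ‖A n x - f x‖ₑ * ‖ψ x‖ₑ := lintegral_const_mul' _ _ hK
          _ ≤ _ := by
              gcongr
              exact lintegral_mul_le_n2 ((hAm n).sub hfm).enorm
                ψ.continuous.aestronglyMeasurable.enorm
      refine tendsto_of_tendsto_of_tendsto_of_le_of_le tendsto_const_nhds ?_ (fun _ ↦ bot_le) hle
      have hψ : n2 volume (fun x ↦ ‖ψ x‖ₑ) ≠ ∞ := by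
        rw [← wN_zero_eq]; exact (wN_schwartz_lt_top 0 ψ).ne
      have := ENNReal.Tendsto.const_mul (ENNReal.Tendsto.mul_const h1 (Or.inr hψ))
        (a := P.lowConst * ‖g‖ₑ) (Or.inr hK)
      simpa using this
    have hmain := hdiff.add (tendsto_integral_mul_lowFun P g hfψ)
    refine tendsto_nhds_unique (h.tendsto hf hg ψ) ?_
    rw [integral_zero, zero_add] at hmain
    convert hmain using 2 with n
    · rw [integral_sub (hi1 n) (hi2 n), sub_add_cancel]
      rfl
    · congr 1; ext x; ring

end ProductLaws

end

noncomputable section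

namespace ProductLaws

/-! ### Products of Sobolev functions -/

theorem jw_mul_neg_mul (r ξ : ℝ) (a : ℝ≥0∞) : jw (-r) ξ * (jw r ξ * a) = a := by
  rw [← mul_assoc, jw_neg_mul, one_mul]

/-- The weights are absorbed into f, g and h. What remains is a product of negative powers,
dominated by kernels that depend on two of the three frequencies each and are uniformly square
integrable in one of them. -/
theorem lintegral_weight_le {s s' t : ℝ} {k₁ k₂ k₃ : ℝ → ℝ → ℝ≥0∞} {A C₁ C₂ C₃ : ℝ≥0}
    (m₁ : Measurable (Function.uncurry k₁)) (m₂ : Measurable (Function.uncurry k₂))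
    (m₃ : Measurable (Function.uncurry k₃))
    (h₁ : ∀ y, ∫⁻ x, k₁ x y ^ 2 ≤ (C₁ : ℝ≥0∞) ^ 2) (h₂ : ∀ y, ∫⁻ x, k₂ x y ^ 2 ≤ (C₂ : ℝ≥0∞) ^ 2)
    (h₃ : ∀ y, ∫⁻ x, k₃ x y ^ 2 ≤ (C₃ : ℝ≥0∞) ^ 2)
    (h : ∀ ξ η, jw (-(s / 2)) ξ * jw (-(s' / 2)) η * jw (-(t / 2)) (ξ + η)
      ≤ A * (k₁ ξ (ξ + η) + k₂ η (ξ + η) + k₃ (ξ + η) η)) :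
    ∃ C : ℝ≥0, ∀ f g h : ℝ → ℝ≥0∞, Measurable f → Measurable g → Measurable h →
      ∫⁻ p : ℝ × ℝ, f p.1 * g p.2 * h (p.1 + p.2) ≤ C * wN s f * wN s' g * wN t h := by
  refine ⟨A * (C₁ + C₂ + C₃), fun f g e hf hg he ↦ ?_⟩
  set F : ℝ → ℝ≥0∞ := fun ξ ↦ jw (s / 2) ξ * f ξ with hF
  set G : ℝ → ℝ≥0∞ := fun ξ ↦ jw (s' / 2) ξ * g ξ with hG
  set E : ℝ → ℝ≥0∞ := fun ξ ↦ jw (t / 2) ξ * e ξ with hE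
  have hFm : Measurable F := (measurable_jw _).mul hf
  have hGm : Measurable G := (measurable_jw _).mul hg
  have hEm : Measurable E := (measurable_jw _).mul he
  have n₁ : Measurable fun p : ℝ × ℝ ↦ k₁ p.1 (p.1 + p.2) :=
    m₁.comp (f := fun p : ℝ × ℝ ↦ (p.1, p.1 + p.2)) (by fun_prop)
  have n₂ : Measurable fun p : ℝ × ℝ ↦ k₂ p.2 (p.1 + p.2) :=
    m₂.comp (f := fun p : ℝ × ℝ ↦ (p.2, p.1 + p.2)) (by fun_prop)
  have n₃ : Measurable fun p : ℝ × ℝ ↦ k₃ (p.1 + p.2) p.2 :=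
    m₃.comp (f := fun p : ℝ × ℝ ↦ (p.1 + p.2, p.2)) (by fun_prop)
  have nT : Measurable fun p : ℝ × ℝ ↦ F p.1 * G p.2 * E (p.1 + p.2) := by fun_prop
  have q₂ : Measurable fun p : ℝ × ℝ ↦ F p.1 * G p.2 * E (p.1 + p.2) * k₂ p.2 (p.1 + p.2) :=
    nT.mul n₂
  have q₃ : Measurable fun p : ℝ × ℝ ↦ F p.1 * G p.2 * E (p.1 + p.2) * k₃ (p.1 + p.2) p.2 :=
    nT.mul n₃
  calc ∫⁻ p : ℝ × ℝ, f p.1 * g p.2 * e (p.1 + p.2)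
      ≤ ∫⁻ p : ℝ × ℝ, A * (F p.1 * G p.2 * E (p.1 + p.2) * k₁ p.1 (p.1 + p.2)
        + F p.1 * G p.2 * E (p.1 + p.2) * k₂ p.2 (p.1 + p.2)
        + F p.1 * G p.2 * E (p.1 + p.2) * k₃ (p.1 + p.2) p.2) := by
        refine lintegral_mono fun p ↦ ?_
        calc f p.1 * g p.2 * e (p.1 + p.2)
            = (jw (-(s / 2)) p.1 * F p.1) * (jw (-(s' / 2)) p.2 * G p.2)
              * (jw (-(t / 2)) (p.1 + p.2) * E (p.1 + p.2)) := by
              simp only [hF, hG, hE, jw_mul_neg_mul]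
          _ = F p.1 * G p.2 * E (p.1 + p.2)
              * (jw (-(s / 2)) p.1 * jw (-(s' / 2)) p.2 * jw (-(t / 2)) (p.1 + p.2)) := by ring
          _ ≤ F p.1 * G p.2 * E (p.1 + p.2)
              * (A * (k₁ p.1 (p.1 + p.2) + k₂ p.2 (p.1 + p.2) + k₃ (p.1 + p.2) p.2)) := by
              exact mul_le_mul_right (h p.1 p.2) _
          _ = _ := by ring
    _ = A * ((∫⁻ p : ℝ × ℝ, F p.1 * G p.2 * E (p.1 + p.2) * k₁ p.1 (p.1 + p.2))
        + (∫⁻ p : ℝ × ℝ, F p.1 * G p.2 * E (p.1 + p.2) * k₂ p.2 (p.1 + p.2))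
        + ∫⁻ p : ℝ × ℝ, F p.1 * G p.2 * E (p.1 + p.2) * k₃ (p.1 + p.2) p.2) := by
        rw [lintegral_const_mul' _ _ ENNReal.coe_ne_top, lintegral_add_right _ q₃,
          lintegral_add_right _ q₂]
    _ ≤ A * (C₁ * (n2 volume F * n2 volume G * n2 volume E)
        + C₂ * (n2 volume F * n2 volume G * n2 volume E)
        + C₃ * (n2 volume F * n2 volume G * n2 volume E)) := by
        gcongr
        · exact lintegral_kernel_fst_le hFm hGm hEm m₁ h₁
        · exact lintegral_kernel_snd_le hFm hGm hEm m₂ h₂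
        · exact lintegral_kernel_add_le hFm hGm hEm m₃ h₃
    _ = _ := by
        push_cast
        simp only [wN, hF, hG, hE]
        ring

/-- A product law for Sobolev spaces follows from a trilinear estimate. -/
theorem productContinuous_sobolev (P : DyadicPartition) {s s' σ : ℝ}
    (h : ∃ C : ℝ≥0, ∀ f g h : ℝ → ℝ≥0∞, Measurable f → Measurable g → Measurable h →
      ∫⁻ p : ℝ × ℝ, f p.1 * g p.2 * h (p.1 + p.2) ≤ C * wN s f * wN s' g * wN (-σ) h) :
    ProductContinuous (SobolevSpace s) (sobolevNorm s) (SobolevSpace s') (sobolevNorm s')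
      (SobolevSpace σ) (sobolevNorm σ) := by
  obtain ⟨C, hC⟩ := h
  refine productContinuous_of_forall_exists P (fun u hu ↦ ?_) (fun v hv ↦ ?_) C
    fun u hu v hv ↦ ?_
  · obtain ⟨U, hU, -⟩ := exists_fourierRep hu
    exact hU.regular
  · obtain ⟨V, hV, -⟩ := exists_fourierRep hv
    exact hV.regular
  · obtain ⟨U, hU, hUn⟩ := exists_fourierRep hu
    obtain ⟨V, hV, hVn⟩ := exists_fourierRep hv
    have hfin : C * sobolevNorm s u * sobolevNorm s' v ≠ ∞ :=
      ENNReal.mul_ne_top (ENNReal.mul_ne_top ENNReal.coe_ne_top (mem_sobolevSpace_iff.1 hu).ne)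
        (mem_sobolevSpace_iff.1 hv).ne
    obtain ⟨w, hw, hwb⟩ := hU.exists_isProductAt hV (m := -σ)
      (C := (C * sobolevNorm s u * sobolevNorm s' v).toNNReal) (fun ψ ↦ by
        rw [ENNReal.coe_toNNReal hfin, ← hUn, ← hVn]
        exact hC _ _ (fun ξ ↦ ‖𝓕⁻ ψ ξ‖ₑ) hU.measurable.enorm hV.measurable.enorm
          (measurable_schwartz _).enorm) P
    rw [ENNReal.coe_toNNReal hfin] at hwb
    obtain ⟨h1, h2⟩ := sobolevNorm_le_of_bound hfin hwb
    exact ⟨w, h1, hw, (hw P).agreesWithPointwise, h2⟩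

/-- By duality the third exponent is t = 1/2 - s - s'. The hypothesis s + s' > 0 is exactly t < 1/2,
so the conditions on the three exponents are symmetric. -/
theorem productContinuous_sobolev_subcritical (P : DyadicPartition) {s s' : ℝ} (hs : s < 1 / 2)
    (hs' : s' < 1 / 2) (h : 0 < s + s') :
    ProductContinuous (SobolevSpace s) (sobolevNorm s) (SobolevSpace s') (sobolevNorm s')
      (SobolevSpace (s + s' - 1 / 2)) (sobolevNorm (s + s' - 1 / 2)) := by
  obtain ⟨C₁, h₁⟩ := exists_lowKernel_sq_le hs
  obtain ⟨C₂, h₂⟩ := exists_lowKernel_sq_le hs'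
  obtain ⟨C₃, h₃⟩ := exists_lowKernel_sq_le (p := -(s + s' - 1 / 2)) (by linarith)
  obtain ⟨A, hA⟩ := exists_jw_mul_le_lowKernel (s := s) (s' := s') (t := -(s + s' - 1 / 2))
    (by ring)
  exact productContinuous_sobolev P (lintegral_weight_le (measurable_lowKernel _)
    (measurable_lowKernel _) (measurable_lowKernel _) h₁ h₂ h₃ hA)

theorem exists_jw_sq_le {p : ℝ} (hp : 1 / 2 < p) :
    ∃ C : ℝ≥0, ∀ _y : ℝ, ∫⁻ x, jw (-(p / 2)) x ^ 2 ≤ (C : ℝ≥0∞) ^ 2 := by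
  have h := lintegral_jw_lt_top (p := -p) (by linarith)
  refine ⟨(∫⁻ x, jw (-p) x).toNNReal + 1, fun _ ↦ ?_⟩
  have e : ∀ x, jw (-(p / 2)) x ^ 2 = jw (-p) x := fun x ↦ by rw [jw_sq]; congr 1; ring
  simp only [e]
  push_cast
  rw [ENNReal.coe_toNNReal h.ne]
  exact le_self_add.trans (le_self_pow₀ le_add_self two_ne_zero)

theorem measurable_jw_fst (p : ℝ) : Measurable (Function.uncurry fun x _y : ℝ ↦ jw p x) :=
  (measurable_jw p).comp measurable_fst

/-- The weight ⟨ξ+η⟩^s is at most a constant times ⟨ξ⟩^s or ⟨η⟩^s, whichever is larger. It cancels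
that factor and leaves ⟨x⟩^{-s}, square integrable because s > 1/2. -/
theorem productContinuous_sobolev_algebra (P : DyadicPartition) {s : ℝ} (hs : 1 / 2 < s) :
    ProductContinuous (SobolevSpace s) (sobolevNorm s) (SobolevSpace s) (sobolevNorm s)
      (SobolevSpace s) (sobolevNorm s) := by
  obtain ⟨C, hC⟩ := exists_jw_sq_le hs
  refine productContinuous_sobolev P (lintegral_weight_le (k₁ := fun x _ ↦ jw (-(s / 2)) x)
    (k₂ := fun x _ ↦ jw (-(s / 2)) x) (k₃ := fun _ _ ↦ 0) (A := ((4 : ℝ) ^ (s / 2)).toNNReal)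
    (C₃ := 0)
    (measurable_jw_fst _) (measurable_jw_fst _) measurable_const hC hC (by simp) fun ξ η ↦ ?_)
  set A : ℝ≥0∞ := ENNReal.ofReal ((4 : ℝ) ^ (s / 2)) with hA
  change _ ≤ A * _
  have e := jap_add_le ξ η
  rw [show -(-s / 2) = s / 2 by ring, add_zero]
  rcases le_total (jap ξ) (jap η) with h | h
  · rw [max_eq_right h] at e
    calc _ ≤ jw (-(s / 2)) ξ * jw (-(s / 2)) η * (A * jw (s / 2) η) := by
          gcongr
          exact jw_le_of_nonneg (by norm_num) e (by linarith)
      _ = A * jw (-(s / 2)) ξ * (jw (-(s / 2)) η * jw (s / 2) η) := by ring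
      _ = A * jw (-(s / 2)) ξ := by rw [jw_neg_mul, mul_one]
      _ ≤ _ := by gcongr; exact le_self_add
  · rw [max_eq_left h] at e
    calc _ ≤ jw (-(s / 2)) ξ * jw (-(s / 2)) η * (A * jw (s / 2) ξ) := by
          gcongr
          exact jw_le_of_nonneg (by norm_num) e (by linarith)
      _ = A * jw (-(s / 2)) η * (jw (-(s / 2)) ξ * jw (s / 2) ξ) := by ring
      _ = A * jw (-(s / 2)) η := by rw [jw_neg_mul, mul_one]
      _ ≤ _ := by gcongr; exact le_add_self

/-- The trilinear estimate for two `L²` functions. -/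
theorem exists_lintegral_L2_mul_L2_le :
    ∃ C : ℝ≥0, ∀ f g h : ℝ → ℝ≥0∞, Measurable f → Measurable g → Measurable h →
      ∫⁻ p : ℝ × ℝ, f p.1 * g p.2 * h (p.1 + p.2) ≤ C * wN 0 f * wN 0 g * wN 1 h := by
  -- Any exponent above 1/2 would do: the product is in L¹, which embeds in H^{-1}.
  obtain ⟨C, hC⟩ := exists_jw_sq_le (p := 1) (by norm_num)
  refine lintegral_weight_le (k₁ := fun _ _ ↦ 0) (k₂ := fun _ _ ↦ 0)
    (k₃ := fun x _ ↦ jw (-(1 / 2)) x) (A := 1) (C₁ := 0) (C₂ := 0)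
    measurable_const measurable_const (measurable_jw_fst _) (by simp) (by simp) hC fun ξ η ↦ ?_
  simp [jw_zero]

/-- The product of two `L²` functions exists. -/
theorem exists_isProductAt_L2 (P₀ : DyadicPartition) {u v : 𝓢'(ℝ, ℂ)} (hu : u ∈ SobolevSpace 0)
    (hv : v ∈ SobolevSpace 0) : ∃ w, ∀ P, IsProductAt P u v w := by
  obtain ⟨C, hC⟩ := exists_lintegral_L2_mul_L2_le
  obtain ⟨B, hB, -⟩ := productContinuous_sobolev (σ := -1) P₀ ⟨C, by simpa using hC⟩
  exact ⟨B ⟨u, hu⟩ ⟨v, hv⟩, hB ⟨u, hu⟩ ⟨v, hv⟩⟩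

end ProductLaws

end

noncomputable section

namespace ProductLaws

/-! ### Localization of the frequencies of a product with a bounded function -/

/-- Writing the regularization of g as an average of translated kernels and applying Fubini, one
gets for each y an ordinary trilinear form, whose first factor has Fourier transform θ times a
character. Frequency supports become visible although g has no Fourier transform as a function. -/
theorem form_genFun_Linfty (g : Lp ℂ ∞ (volume : Measure ℝ)) (θ : 𝓢(ℝ, ℂ)) {W : ℝ → ℂ}
    (hW : Integrable W) (ψ : 𝓢(ℝ, ℂ)) :
    form (genFun (𝓕 θ) (g : 𝓢'(ℝ, ℂ))) (𝓕⁻ W) ψ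
      = ∫ y, g y * ∫ ξ, ∫ η, W ξ * (ech (-(y * η)) * θ η) * 𝓕⁻ ψ (ξ + η) := by
  have hφ : Integrable (fun x ↦ 𝓕⁻ W x * ψ x) :=
    ψ.integrable.bdd_mul (c := ∫ ξ, ‖W ξ‖) (continuous_fourierInv hW).aestronglyMeasurable
      (Filter.Eventually.of_forall fun x ↦ norm_fourierInv_le W x)
  have hI := integrable_convolution_prod (Lp.aestronglyMeasurable g) (ae_norm_le_Linfty g)
    (𝓕 θ).integrable hφ
  have hθ : ∀ y, Integrable fun η ↦ ech (-(y * η)) * θ η := fun y ↦ by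
    have := integrable_ech_mul θ.integrable (-y)
    simpa only [neg_mul] using this
  have hin : ∀ y x, 𝓕 θ (y - x) = 𝓕⁻ (fun η ↦ ech (-(y * η)) * θ η) x := fun y x ↦ by
    rw [schwartz_fourier_apply, fourierInv_apply]
    congr 1
    ext η
    rw [← mul_assoc, ← ech_add]
    congr 2
    ring
  calc form (genFun (𝓕 θ) (g : 𝓢'(ℝ, ℂ))) (𝓕⁻ W) ψ
      = ∫ x, ∫ y, g y * (𝓕 θ (y - x) * (𝓕⁻ W x * ψ x)) := by
        rw [form]
        congr 1
        ext x
        rw [genFun_Linfty, mul_assoc, ← integral_mul_const]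
        congr 1
        ext y
        ring
    _ = ∫ y, ∫ x, g y * (𝓕 θ (y - x) * (𝓕⁻ W x * ψ x)) := (integral_integral_swap hI).symm
    _ = _ := by
        congr 1
        ext y
        rw [integral_const_mul, ← integral_fourierInv_mul_mul hW (hθ y)]
        congr 2
        ext x
        rw [hin]
        ring

/-- Only the values of 𝓕⁻ψ on supp W + supp θ enter, so ψ may be filtered by any multiplier equal to
1 there. -/
theorem form_localize (g : Lp ℂ ∞ (volume : Measure ℝ)) (θ Q : 𝓢(ℝ, ℂ)) {W : ℝ → ℂ}
    (hW : Integrable W) (hQ : ∀ ξ η, W ξ ≠ 0 → θ η ≠ 0 → Q (ξ + η) = 1) (ψ : 𝓢(ℝ, ℂ)) :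
    form (genFun (𝓕 θ) (g : 𝓢'(ℝ, ℂ))) (𝓕⁻ W) ψ
      = form (genFun (𝓕 θ) (g : 𝓢'(ℝ, ℂ))) (𝓕⁻ W) (𝓕 (SchwartzMap.smulLeftCLM ℂ Q (𝓕⁻ ψ))) := by
  rw [form_genFun_Linfty g θ hW, form_genFun_Linfty g θ hW]
  congr! 6 with y ξ
  ext η
  rw [FourierTransform.fourierInv_fourier_eq, SchwartzMap.smulLeftCLM_apply_apply Q.hasTemperateGrowth]
  by_cases h1 : W ξ = 0
  · simp [h1]
  · by_cases h2 : θ η = 0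
    · simp [h2]
    · rw [hQ ξ η h1 h2, one_smul]

theorem enorm_form_localize_le (g : Lp ℂ ∞ (volume : Measure ℝ)) (θ Q : 𝓢(ℝ, ℂ)) {W : ℝ → ℂ}
    (hW : Integrable W) (hQ : ∀ ξ η, W ξ ≠ 0 → θ η ≠ 0 → Q (ξ + η) = 1) {B : ℝ≥0∞}
    (hB : ∀ x, ‖genFun (𝓕 θ) (g : 𝓢'(ℝ, ℂ)) x‖ₑ ≤ B) (ψ : 𝓢(ℝ, ℂ)) :
    ‖form (genFun (𝓕 θ) (g : 𝓢'(ℝ, ℂ))) (𝓕⁻ W) ψ‖ₑ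
      ≤ B * (n2 volume (fun ξ ↦ ‖W ξ‖ₑ) * n2 volume (fun ξ ↦ ‖Q ξ‖ₑ * ‖𝓕⁻ ψ ξ‖ₑ)) := by
  rw [form_localize g θ Q hW hQ, form]
  set ψ' := 𝓕 (SchwartzMap.smulLeftCLM ℂ Q (𝓕⁻ ψ)) with hψ'
  have hn : n2 volume (fun x ↦ ‖ψ' x‖ₑ) = n2 volume (fun ξ ↦ ‖Q ξ‖ₑ * ‖𝓕⁻ ψ ξ‖ₑ) := by
    rw [hψ', n2_schwartz_fourier]
    congr 1
    ext ξ
    rw [SchwartzMap.smulLeftCLM_apply_apply Q.hasTemperateGrowth, smul_eq_mul, enorm_mul]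
  have hm1 : Measurable fun x ↦ ‖𝓕⁻ W x‖ₑ := (continuous_fourierInv hW).measurable.enorm
  have hm2 : Measurable fun x ↦ ‖ψ' x‖ₑ := (measurable_schwartz ψ').enorm
  calc _ ≤ ∫⁻ x, ‖genFun (𝓕 θ) (g : 𝓢'(ℝ, ℂ)) x * 𝓕⁻ W x * ψ' x‖ₑ :=
        enorm_integral_le_lintegral_enorm _
    _ ≤ ∫⁻ x, B * (‖𝓕⁻ W x‖ₑ * ‖ψ' x‖ₑ) := by
        refine lintegral_mono fun x ↦ ?_
        rw [enorm_mul, enorm_mul, mul_assoc]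
        gcongr
        exact hB x
    _ = B * ∫⁻ x, ‖𝓕⁻ W x‖ₑ * ‖ψ' x‖ₑ := lintegral_const_mul _ (hm1.mul hm2)
    _ ≤ B * (n2 volume (fun x ↦ ‖𝓕⁻ W x‖ₑ) * n2 volume (fun x ↦ ‖ψ' x‖ₑ)) := by
        gcongr
        exact lintegral_mul_le_n2 hm1.aemeasurable hm2.aemeasurable
    _ ≤ _ := by
        rw [hn]
        gcongr
        exact n2_fourierInv_le hW

theorem blockFun_eq_fourierInv (P : DyadicPartition) {u : 𝓢'(ℝ, ℂ)} {U : ℝ → ℂ}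
    (hU : FourierRep u U) (k : ℕ) : P.blockFun k u = 𝓕⁻ (fun ξ ↦ U ξ * P.symbolS k ξ) := by
  ext x
  rw [P.blockFun_eq_genFun, hU.genFun_eq, FourierTransform.fourierInv_fourier_eq]

namespace DyadicPartition

variable {P : DyadicPartition}

theorem enorm_lowS (n : ℕ) (ξ : ℝ) : ‖P.lowS n ξ‖ₑ = ENNReal.ofReal (P.lowR n ξ) := by
  rw [P.lowS_apply, ← ofReal_norm, Complex.norm_real, Real.norm_eq_abs,
    abs_of_nonneg (P.lowR_nonneg n ξ)]

theorem enorm_symbolS (k : ℕ) (ξ : ℝ) : ‖P.symbolS k ξ‖ₑ = ENNReal.ofReal (P.symR k ξ) := by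
  rw [P.symbolS_apply, ← ofReal_norm, Complex.norm_real, Real.norm_eq_abs,
    abs_of_nonneg (P.symR_nonneg k ξ)]

theorem Scales.two_mul_b_le {a b : ℝ} {M : ℕ} (h : P.Scales a b M) (k : ℕ) :
    b * 2 ^ (k + M) + b * 2 ^ (k + M) ≤ a * 2 ^ (k + 2 * M) := by
  have h1 := h.gap
  have h2 : (0 : ℝ) < 2 ^ (k + M) := by positivity
  have h3 : (2 : ℝ) ^ (k + 2 * M) = 2 ^ (k + M) * 2 ^ M := by rw [← pow_add]; congr 1; ring
  rw [h3]
  have h4 : 0 < b := h.pos_b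
  nlinarith

/-- A product of two functions with frequencies in balls has its frequencies in a ball. -/
theorem Scales.enorm_form_ball_le {a b : ℝ} {M : ℕ} (h : P.Scales a b M)
    (g : Lp ℂ ∞ (volume : Measure ℝ)) {W : ℝ → ℂ} (hW : Integrable W) {j k : ℕ}
    (hWs : ∀ ξ, W ξ ≠ 0 → |ξ| ≤ b * 2 ^ (k + M)) (hj : j ≤ k + M) {B : ℝ≥0∞}
    (hB : ∀ x, ‖P.blockFun j (g : 𝓢'(ℝ, ℂ)) x‖ₑ ≤ B) (ψ : 𝓢(ℝ, ℂ)) :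
    ‖form (P.blockFun j (g : 𝓢'(ℝ, ℂ))) (𝓕⁻ W) ψ‖ₑ
      ≤ B * (n2 volume (fun ξ ↦ ‖W ξ‖ₑ)
        * n2 volume (fun ξ ↦ ENNReal.ofReal (P.lowR (k + 2 * M) ξ) * ‖𝓕⁻ ψ ξ‖ₑ)) := by
  have e : P.blockFun j (g : 𝓢'(ℝ, ℂ)) = genFun (𝓕 (P.symbolS j)) (g : 𝓢'(ℝ, ℂ)) :=
    funext (P.blockFun_eq_genFun j _)
  rw [e] at hB ⊢
  simp only [← enorm_lowS]
  refine enorm_form_localize_le g _ _ hW (fun ξ η h1 h2 ↦ ?_) hB ψ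
  rw [P.symbolS_apply, Complex.ofReal_ne_zero] at h2
  rw [P.lowS_apply, h.lowR_eq_one, Complex.ofReal_one]
  · have := h.two_le; omega
  · refine (abs_add_le ξ η).trans (le_trans (add_le_add (hWs ξ h1) ?_) (h.two_mul_b_le k))
    refine (h.symR_upper j η h2).trans ?_
    have := h.pos_b
    gcongr
    norm_num

/-- A product of a function with frequencies in a small ball and a function with frequencies in an
annulus has its frequencies in an annulus. -/
theorem Scales.enorm_form_annulus_le {a b : ℝ} {M : ℕ} (h : P.Scales a b M)
    (g : Lp ℂ ∞ (volume : Measure ℝ)) {u : 𝓢'(ℝ, ℂ)} {U : ℝ → ℂ} (hU : FourierRep u U) (k : ℕ)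
    (ψ : 𝓢(ℝ, ℂ)) :
    ‖form (P.lowFun (k - M) (g : 𝓢'(ℝ, ℂ))) (P.blockFun k u) ψ‖ₑ
      ≤ P.lowConst * ‖g‖ₑ * (n2 volume (fun ξ ↦ ENNReal.ofReal (P.symR k ξ) * ‖U ξ‖ₑ)
        * n2 volume (fun ξ ↦ ENNReal.ofReal (P.lowR (k + M) ξ - P.lowR (k - M) ξ) * ‖𝓕⁻ ψ ξ‖ₑ)) := by
  have e : P.lowFun (k - M) (g : 𝓢'(ℝ, ℂ)) = genFun (𝓕 (P.lowS (k - M))) (g : 𝓢'(ℝ, ℂ)) :=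
    funext (P.lowFun_eq_genFun _ _)
  have hB := P.enorm_lowFun_le (k - M) g
  have h0 := h.two_le
  have hQ : ∀ ξ η, U ξ * P.symbolS k ξ ≠ 0 → P.lowS (k - M) η ≠ 0 →
      (P.lowS (k + M) - P.lowS (k - M)) (ξ + η) = 1 := by
    intro ξ η h1 h2
    replace h1 := right_ne_zero_of_mul h1
    rw [P.symbolS_apply, Complex.ofReal_ne_zero] at h1
    rw [P.lowS_apply, Complex.ofReal_ne_zero] at h2
    -- For k ≤ M the truncated difference is 0 and the low frequency sum is empty.
    have hk : M < k := by
      by_contra hk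
      rw [show k - M = 0 by omega, P.lowR_zero] at h2
      exact h2 rfl
    have e1 := h.symR_upper k ξ h1
    have e2 := h.symR_lower k ξ (by omega) h1
    have e3 := h.lowR_upper _ η h2
    -- Since |η| ≤ a2^k/4 and |ξ| ≥ a2^k, the sum has size at least 3a2^k/4, beyond the support of
    -- the symbol of index k - M.
    have e4 : b * 2 ^ (k - M) ≤ a * 2 ^ k / 4 := by
      have : (2 : ℝ) ^ k = 2 ^ M * 2 ^ (k - M) := by rw [← pow_add]; congr 1; omega
      rw [this]
      have := h.gap
      have h5 : (0 : ℝ) < 2 ^ (k - M) := by positivity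
      nlinarith
    have ha : 0 < a * 2 ^ k := mul_pos h.pos_a (by positivity)
    have e5 : b * 2 ^ k ≤ a * 2 ^ (k + M) / 4 := by
      rw [pow_add]
      have := h.gap
      have h5 : (0 : ℝ) < 2 ^ k := by positivity
      nlinarith
    have e6 : a * 2 ^ k ≤ a * 2 ^ (k + M) :=
      mul_le_mul_of_nonneg_left (pow_le_pow_right₀ (by norm_num) (by omega)) h.pos_a.le
    rw [sub_apply, P.lowS_apply, P.lowS_apply, h.lowR_eq_one (k + M) _ (by omega)]
    · have : P.lowR (k - M) (ξ + η) = 0 := by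
        by_contra hne
        have e7 := h.lowR_upper _ _ hne
        have e8 : |ξ| ≤ |ξ + η| + |η| := by simpa using abs_sub (ξ + η) η
        linarith
      rw [this]
      simp
    · have := abs_add_le ξ η
      linarith
  have key := enorm_form_localize_le g (P.lowS (k - M)) (P.lowS (k + M) - P.lowS (k - M))
    (hU.integrable (P.symbolS k)) hQ (by rw [← e]; exact hB) ψ
  rw [← e, ← blockFun_eq_fourierInv P hU] at key
  refine key.trans (le_of_eq ?_)
  congr 3
  · ext ξ
    rw [enorm_mul, enorm_symbolS, mul_comm]
  · ext ξ
    rw [sub_apply, P.lowS_apply, P.lowS_apply, ← Complex.ofReal_sub, ← ofReal_norm,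
      Complex.norm_real, Real.norm_eq_abs,
      abs_of_nonneg (sub_nonneg.2 (P.lowR_mono (by omega) ξ))]

end DyadicPartition

end ProductLaws

end

noncomputable section

namespace ProductLaws

/-! ### Dyadic sums -/

/-- The dyadic weight `4^{k r}`. -/
def dy (r : ℝ) (k : ℕ) : ℝ≥0∞ := ENNReal.ofReal (((4 : ℝ) ^ k) ^ r)

theorem dy_add (r t : ℝ) (k : ℕ) : dy (r + t) k = dy r k * dy t k := by
  rw [dy, dy, dy, ← ENNReal.ofReal_mul (by positivity), Real.rpow_add (by positivity)]

theorem dy_neg_mul (r : ℝ) (k : ℕ) : dy (-r) k * dy r k = 1 := by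
  rw [← dy_add, neg_add_cancel, dy, Real.rpow_zero, ENNReal.ofReal_one]

theorem dy_sq (r : ℝ) (k : ℕ) : dy r k ^ 2 = dy (2 * r) k := by
  rw [sq, ← dy_add, two_mul]

theorem dy_ne_top (r : ℝ) (k : ℕ) : dy r k ≠ ∞ := ENNReal.ofReal_ne_top

theorem dy_idx_add (r : ℝ) (i k : ℕ) : dy r (i + k) = dy r k * dy r 1 ^ i := by
  rw [dy, dy, dy, ← ENNReal.ofReal_pow (by positivity), ← ENNReal.ofReal_mul (by positivity),
    ← Real.rpow_natCast (_ ^ r), ← Real.rpow_mul (by positivity), mul_comm r,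
    Real.rpow_mul (by positivity), Real.rpow_natCast, ← Real.mul_rpow (by positivity) (by positivity),
    pow_one, ← pow_add, add_comm i]

theorem dy_le_jw {C ξ : ℝ} {k : ℕ} (hC : 1 ≤ C) (h₁ : jap ξ ≤ C * 4 ^ k) (h₂ : 4 ^ k ≤ C * jap ξ)
    (r : ℝ) : dy r k ≤ ENNReal.ofReal (C ^ |r|) * jw r ξ := by
  rw [jw, dy, ← ENNReal.ofReal_mul (by positivity)]
  exact ENNReal.ofReal_le_ofReal
    (rpow_mono_exponent_of_comparable (by positivity) (jap_pos ξ) hC h₂ h₁ r)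

theorem tsum_dy_lt_top {r : ℝ} (hr : 0 < r) : ∑' k, dy (-r) k < ∞ := by
  have h : ∀ k, dy (-r) k = dy (-r) 1 ^ k := fun k ↦ by
    have := dy_idx_add (-r) k 0
    rw [add_zero] at this
    rw [this]
    simp [dy]
  rw [tsum_congr h, ENNReal.tsum_geometric, ENNReal.inv_lt_top, tsub_pos_iff_lt, dy, ENNReal.ofReal_lt_one, pow_one]
  exact Real.rpow_lt_one_of_one_lt_of_neg (by norm_num) (by linarith)

/-- A geometric sum over the dyadic scales above a frequency. -/
theorem exists_tsum_dy_le {s C : ℝ} (hs : 0 < s) (hC : 0 < C) :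
    ∃ D : ℝ≥0, ∀ ξ, ∑' k, (if jap ξ ≤ C * 4 ^ k then dy (-s) k else 0) ≤ D * jw (-s) ξ := by
  have hS := tsum_dy_lt_top hs
  refine ⟨(ENNReal.ofReal (C ^ s) * ∑' k, dy (-s) k).toNNReal, fun ξ ↦ ?_⟩
  rw [ENNReal.coe_toNNReal (ENNReal.mul_ne_top ENNReal.ofReal_ne_top hS.ne)]
  have hex : ∃ k, jap ξ ≤ C * 4 ^ k := by
    obtain ⟨k, hk⟩ := pow_unbounded_of_one_lt (jap ξ / C) (by norm_num : (1 : ℝ) < 4)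
    exact ⟨k, by rw [div_lt_iff₀ hC] at hk; linarith⟩
  classical
  -- The condition holds exactly from `k₀` on, so the sum is a geometric tail comparable with its
  -- first term.
  set k₀ := Nat.find hex with hk₀
  have h0 : dy (-s) k₀ ≤ ENNReal.ofReal (C ^ s) * jw (-s) ξ := by
    rw [dy, jw, ← ENNReal.ofReal_mul (by positivity)]
    refine ENNReal.ofReal_le_ofReal ?_
    have h1 : C⁻¹ * jap ξ ≤ 4 ^ k₀ := by
      rw [inv_mul_le_iff₀ hC]
      exact Nat.find_spec hex
    have := jap_pos ξ
    calc ((4 : ℝ) ^ k₀) ^ (-s) ≤ (C⁻¹ * jap ξ) ^ (-s) :=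
          Real.rpow_le_rpow_of_nonpos (by positivity) h1 (by linarith)
      _ = _ := by
          rw [Real.mul_rpow (by positivity) this.le, Real.inv_rpow hC.le, Real.rpow_neg hC.le, inv_inv]
  rw [← ENNReal.summable.sum_add_tsum_nat_add' (k := k₀), Finset.sum_eq_zero, zero_add]
  · calc ∑' i, (if jap ξ ≤ C * 4 ^ (i + k₀) then dy (-s) (i + k₀) else 0)
        ≤ ∑' i, dy (-s) k₀ * dy (-s) i := by
          refine ENNReal.tsum_le_tsum fun i ↦ ?_
          split_ifs
          · rw [dy_idx_add, show dy (-s) i = dy (-s) 0 * dy (-s) 1 ^ i by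
              rw [← dy_idx_add, add_zero]]
            simp [dy]
          · exact bot_le
      _ = dy (-s) k₀ * ∑' i, dy (-s) i := ENNReal.tsum_mul_left
      _ ≤ (ENNReal.ofReal (C ^ s) * jw (-s) ξ) * ∑' i, dy (-s) i := by gcongr
      _ = _ := by ring
  · intro i hi
    rw [if_neg (Nat.find_min hex (Finset.mem_range.1 hi))]

/-- Almost orthogonality: after exchanging sum and integral, only the pointwise sum of the squared
multipliers matters. -/
theorem tsum_n2_sq_le {s : ℝ} {A : ℕ → ℝ → ℝ≥0∞} {C : ℝ≥0∞} (hA : ∀ k, Measurable (A k))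
    (h : ∀ ξ, ∑' k, dy s k * A k ξ ^ 2 ≤ C ^ 2 * jw s ξ) {f : ℝ → ℝ≥0∞} (hf : Measurable f) :
    (∑' k, (dy (s / 2) k * n2 volume (fun ξ ↦ A k ξ * f ξ)) ^ 2) ^ (1 / 2 : ℝ) ≤ C * wN s f := by
  have key : ∑' k, (dy (s / 2) k * n2 volume (fun ξ ↦ A k ξ * f ξ)) ^ 2 ≤ (C * wN s f) ^ 2 := by
    calc ∑' k, (dy (s / 2) k * n2 volume (fun ξ ↦ A k ξ * f ξ)) ^ 2
        = ∑' k, ∫⁻ ξ, dy s k * A k ξ ^ 2 * f ξ ^ 2 := by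
          congr 1
          ext k
          rw [mul_pow, dy_sq, n2_sq, ← lintegral_const_mul' _ _ (dy_ne_top _ _),
            show 2 * (s / 2) = s by ring]
          simp only [mul_pow, mul_assoc]
      _ = ∫⁻ ξ, ∑' k, dy s k * A k ξ ^ 2 * f ξ ^ 2 :=
          (lintegral_tsum fun k ↦ ((((hA k).pow_const 2).const_mul _).mul
            (hf.pow_const 2)).aemeasurable).symm
      _ ≤ ∫⁻ ξ, C ^ 2 * (jw s ξ * f ξ ^ 2) := by
          refine lintegral_mono fun ξ ↦ ?_
          rw [ENNReal.tsum_mul_right, ← mul_assoc]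
          gcongr
          exact h ξ
      _ = (C * wN s f) ^ 2 := by
          have hm : Measurable fun ξ ↦ jw s ξ * f ξ ^ 2 := (measurable_jw s).mul (hf.pow_const 2)
          rw [lintegral_const_mul _ hm, mul_pow, wN_sq]
  calc _ ≤ ((C * wN s f) ^ 2) ^ (1 / 2 : ℝ) := by gcongr
    _ = C * wN s f := by rw [← ENNReal.rpow_natCast, ← ENNReal.rpow_mul]; norm_num

/-- Cauchy–Schwarz in k after inserting the reciprocal weights 2^{ks} and 2^{-ks}. -/
theorem tsum_n2_mul_n2_le {s : ℝ} {A B : ℕ → ℝ → ℝ≥0∞} {C D : ℝ≥0∞} (hA : ∀ k, Measurable (A k))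
    (hB : ∀ k, Measurable (B k)) (h₁ : ∀ ξ, ∑' k, dy s k * A k ξ ^ 2 ≤ C ^ 2 * jw s ξ)
    (h₂ : ∀ ξ, ∑' k, dy (-s) k * B k ξ ^ 2 ≤ D ^ 2 * jw (-s) ξ) {f h : ℝ → ℝ≥0∞}
    (hf : Measurable f) (hh : Measurable h) :
    ∑' k, n2 volume (fun ξ ↦ A k ξ * f ξ) * n2 volume (fun ξ ↦ B k ξ * h ξ)
      ≤ C * D * (wN s f * wN (-s) h) := by
  calc ∑' k, n2 volume (fun ξ ↦ A k ξ * f ξ) * n2 volume (fun ξ ↦ B k ξ * h ξ)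
      = ∑' k, (dy (s / 2) k * n2 volume (fun ξ ↦ A k ξ * f ξ))
        * (dy (-s / 2) k * n2 volume (fun ξ ↦ B k ξ * h ξ)) := by
        congr 1
        ext k
        have := dy_neg_mul (s / 2) k
        calc _ = (dy (-(s / 2)) k * dy (s / 2) k) * (n2 volume (fun ξ ↦ A k ξ * f ξ)
              * n2 volume (fun ξ ↦ B k ξ * h ξ)) := by rw [this, one_mul]
          _ = _ := by rw [neg_div]; ring
    _ ≤ _ := tsum_mul_le_sqrt
    _ ≤ (C * wN s f) * (D * wN (-s) h) :=
        mul_le_mul' (tsum_n2_sq_le hA h₁ hf) (tsum_n2_sq_le hB h₂ hh)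
    _ = _ := by ring

theorem tsum_ite_near_le (k M : ℕ) (c : ℝ≥0∞) :
    ∑' j, (if j ≤ k + M ∧ k ≤ j + M then c else 0) ≤ ((2 * M + 1 : ℕ) : ℝ≥0∞) * c := by
  have h : ∀ j ∉ Finset.Icc (k - M) (k + M), (if j ≤ k + M ∧ k ≤ j + M then c else 0) = 0 := by
    intro j hj
    rw [Finset.mem_Icc] at hj
    rw [if_neg (by omega)]
  rw [tsum_eq_sum h]
  calc ∑ j ∈ Finset.Icc (k - M) (k + M), (if j ≤ k + M ∧ k ≤ j + M then c else 0)
      ≤ ∑ _j ∈ Finset.Icc (k - M) (k + M), c := by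
        refine Finset.sum_le_sum fun j _ ↦ ?_
        split_ifs
        · exact le_rfl
        · exact bot_le
    _ = (((k + M + 1 - (k - M) : ℕ)) : ℝ≥0∞) * c := by simp
    _ ≤ _ := by gcongr; omega

namespace DyadicPartition

variable {P : DyadicPartition}

theorem tsum_ofReal_symR (ξ : ℝ) : ∑' k, ENNReal.ofReal (P.symR k ξ) = 1 := by
  rw [← ENNReal.ofReal_tsum_of_nonneg (fun k ↦ P.symR_nonneg k ξ) (P.hasSum_symR ξ).summable,
    (P.hasSum_symR ξ).tsum_eq, ENNReal.ofReal_one]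

theorem measurable_ofReal_symR (k : ℕ) : Measurable fun ξ ↦ ENNReal.ofReal (P.symR k ξ) :=
  (P.continuous_symR k).measurable.ennreal_ofReal

theorem measurable_ofReal_lowR (k : ℕ) : Measurable fun ξ ↦ ENNReal.ofReal (P.lowR k ξ) :=
  (P.continuous_lowR k).measurable.ennreal_ofReal

theorem sq_le_of_le_one {x : ℝ≥0∞} (h : x ≤ 1) : x ^ 2 ≤ x := by
  rw [sq]; exact mul_le_of_le_one_left' h

namespace Scales

variable {a b : ℝ} {M : ℕ} (h : P.Scales a b M)

include h

/-- On the support of block k the numbers 4^k and 1 + ξ² are comparable, so the weight leaves the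
sum, and symbols in [0,1] dominate their squares and sum to one. Both signs of s are allowed. -/
theorem exists_tsum_dy_symR_le (s : ℝ) : ∃ C : ℝ≥0, ∀ ξ,
    ∑' k, dy s k * ENNReal.ofReal (P.symR k ξ) ^ 2 ≤ (C : ℝ≥0∞) ^ 2 * jw s ξ := by
  obtain ⟨C, hC, h1, -, -⟩ := h.exists_const
  refine ⟨(C ^ |s|).toNNReal, fun ξ ↦ ?_⟩
  have hC1 : (1 : ℝ≥0∞) ≤ ((C ^ |s|).toNNReal : ℝ≥0∞) :=
    ENNReal.one_le_ofReal.2 (Real.one_le_rpow hC (abs_nonneg s))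
  calc ∑' k, dy s k * ENNReal.ofReal (P.symR k ξ) ^ 2
      ≤ ∑' k, ((C ^ |s|).toNNReal * jw s ξ) * ENNReal.ofReal (P.symR k ξ) := by
        refine ENNReal.tsum_le_tsum fun k ↦ ?_
        by_cases hk : P.symR k ξ = 0
        · simp [hk]
        · gcongr
          · exact dy_le_jw hC (h1 k ξ hk).1 (h1 k ξ hk).2 s
          · exact sq_le_of_le_one (ENNReal.ofReal_le_one.2 (P.symR_le_one k ξ))
    _ = (C ^ |s|).toNNReal * jw s ξ := by rw [ENNReal.tsum_mul_left, tsum_ofReal_symR, mul_one]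
    _ ≤ _ := by gcongr; exact le_self_pow₀ hC1 two_ne_zero

/-- The enlarged annulus symbol is a sum of blocks with indices from k - M to k + M. Comparability
with 4^k persists with an additional factor 4^M, and each block is counted at most 2M + 1 times. -/
theorem exists_tsum_dy_annulus_le (s : ℝ) : ∃ C : ℝ≥0, ∀ ξ,
    ∑' k, dy s k * ENNReal.ofReal (P.lowR (k + M) ξ - P.lowR (k - M) ξ) ^ 2
      ≤ (C : ℝ≥0∞) ^ 2 * jw s ξ := by
  obtain ⟨C, hC, -, h2, h3⟩ := h.exists_const
  set C' : ℝ := C * 4 ^ M with hC'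
  have h4M : (1 : ℝ) ≤ 4 ^ M := one_le_pow₀ (by norm_num)
  have hC'1 : 1 ≤ C' := by nlinarith
  refine ⟨((2 * M + 1 : ℕ) : ℝ≥0) * (C' ^ |s|).toNNReal, fun ξ ↦ ?_⟩
  have hC1 : (1 : ℝ≥0∞) ≤ ((C' ^ |s|).toNNReal : ℝ≥0∞) :=
    ENNReal.one_le_ofReal.2 (Real.one_le_rpow hC'1 (abs_nonneg s))
  have hq : ∀ k, ENNReal.ofReal (P.lowR (k + M) ξ - P.lowR (k - M) ξ)
      ≤ ∑' j, if j ≤ k + M ∧ k ≤ j + M then ENNReal.ofReal (P.symR j ξ) else 0 := by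
    intro k
    have : P.lowR (k + M) ξ - P.lowR (k - M) ξ = ∑ j ∈ Finset.Ico (k - M) (k + M), P.symR j ξ := by
      rw [Finset.sum_Ico_eq_sub _ (by omega)]
      rfl
    rw [this, ENNReal.ofReal_sum_of_nonneg fun j _ ↦ P.symR_nonneg j ξ]
    refine le_trans (Finset.sum_le_sum fun j hj ↦ ?_) (ENNReal.sum_le_tsum _)
    rw [Finset.mem_Ico] at hj
    rw [if_pos (by omega)]
  calc ∑' k, dy s k * ENNReal.ofReal (P.lowR (k + M) ξ - P.lowR (k - M) ξ) ^ 2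
      ≤ ∑' k, ((C' ^ |s|).toNNReal * jw s ξ)
        * ∑' j, if j ≤ k + M ∧ k ≤ j + M then ENNReal.ofReal (P.symR j ξ) else 0 := by
        refine ENNReal.tsum_le_tsum fun k ↦ ?_
        by_cases hk : P.lowR (k + M) ξ - P.lowR (k - M) ξ = 0
        · simp [hk]
        have hk1 : P.lowR (k + M) ξ ≠ 0 := fun h0 ↦ hk (by
          have := P.lowR_nonneg (k - M) ξ
          have := P.lowR_mono (show k - M ≤ k + M by omega) ξ
          linarith)
        have hk2 : P.lowR (k - M) ξ ≠ 1 := fun h0 ↦ hk (by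
          have := P.lowR_le_one (k + M) ξ
          have := P.lowR_mono (show k - M ≤ k + M by omega) ξ
          linarith)
        have e1 := h2 _ _ hk1
        have e2 := h3 _ _ hk2
        gcongr
        · refine dy_le_jw hC'1 ?_ ?_ s
          · rw [pow_add] at e1
            calc jap ξ ≤ _ := e1
              _ = _ := by rw [hC']; ring
          · calc (4 : ℝ) ^ k ≤ 4 ^ M * 4 ^ (k - M) := by
                  rw [← pow_add]
                  exact pow_le_pow_right₀ (by norm_num) (by omega)
              _ ≤ 4 ^ M * (C * jap ξ) := by gcongr
              _ = _ := by rw [hC']; ring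
        · refine (sq_le_of_le_one (ENNReal.ofReal_le_one.2 ?_)).trans (hq k)
          have := P.lowR_nonneg (k - M) ξ
          have := P.lowR_le_one (k + M) ξ
          linarith
    _ = ((C' ^ |s|).toNNReal * jw s ξ) * ∑' j, ∑' k,
        if k ≤ j + M ∧ j ≤ k + M then ENNReal.ofReal (P.symR j ξ) else 0 := by
        rw [ENNReal.tsum_mul_left, ENNReal.tsum_comm]
        simp only [and_comm]
    _ ≤ ((C' ^ |s|).toNNReal * jw s ξ) * ∑' j, ((2 * M + 1 : ℕ) : ℝ≥0∞)
        * ENNReal.ofReal (P.symR j ξ) := by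
        gcongr with j
        exact tsum_ite_near_le j M _
    _ = ((2 * M + 1 : ℕ) : ℝ≥0∞) * (C' ^ |s|).toNNReal * jw s ξ := by
        rw [ENNReal.tsum_mul_left, tsum_ofReal_symR]
        ring
    _ ≤ _ := by
        gcongr
        rw [ENNReal.coe_mul]
        refine le_trans (le_of_eq (by simp)) (le_self_pow₀ (one_le_mul ?_ hC1) two_ne_zero)
        simp

/-- On a ball only 1 + ξ² ≲ 4^k is known, so infinitely many k may contribute at a given ξ. The
geometric series converges because s > 0. -/
theorem exists_tsum_dy_ball_le {s : ℝ} (hs : 0 < s) : ∃ C : ℝ≥0, ∀ ξ,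
    ∑' k, dy (-s) k * ENNReal.ofReal (P.lowR (k + 2 * M) ξ) ^ 2
      ≤ (C : ℝ≥0∞) ^ 2 * jw (-s) ξ := by
  obtain ⟨C, hC, -, h2, -⟩ := h.exists_const
  obtain ⟨D, hD⟩ := exists_tsum_dy_le (C := C * 4 ^ (2 * M)) hs (by positivity)
  refine ⟨D + 1, fun ξ ↦ le_trans (ENNReal.tsum_le_tsum fun k ↦ ?_) ((hD ξ).trans ?_)⟩
  · split_ifs with hk
    · refine mul_le_of_le_one_right' (pow_le_one₀ bot_le ?_)
      exact ENNReal.ofReal_le_one.2 (P.lowR_le_one _ ξ)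
    · have : P.lowR (k + 2 * M) ξ = 0 := by
        by_contra h0
        refine hk ((h2 _ _ h0).trans (le_of_eq ?_))
        rw [pow_add]; ring
      simp [this]
  · gcongr
    have : D ≤ (D + 1) ^ 2 := by nlinarith [D.2, sq_nonneg D]
    exact_mod_cast this

/-- The paraproduct by a bounded function. -/
theorem exists_farSum_Linfty_le (s : ℝ) : ∃ C : ℝ≥0, ∀ (g : Lp ℂ ∞ (volume : Measure ℝ))
    (u : 𝓢'(ℝ, ℂ)) (U : ℝ → ℂ) (_ : FourierRep u U) (ψ : 𝓢(ℝ, ℂ)),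
    farSum P M (g : 𝓢'(ℝ, ℂ)) u ψ
      ≤ C * ‖g‖ₑ * wN s (fun ξ ↦ ‖U ξ‖ₑ) * wN (-s) (fun ξ ↦ ‖𝓕⁻ ψ ξ‖ₑ) := by
  obtain ⟨C, hC⟩ := h.exists_tsum_dy_symR_le s
  obtain ⟨D, hD⟩ := h.exists_tsum_dy_annulus_le (-s)
  refine ⟨P.lowConst.toNNReal * (C * D), fun g u U hU ψ ↦ ?_⟩
  refine (ENNReal.tsum_le_tsum fun k ↦ h.enorm_form_annulus_le g hU k ψ).trans ?_
  rw [ENNReal.tsum_mul_left, ENNReal.coe_mul, ENNReal.coe_toNNReal P.lowConst_lt_top.ne]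
  calc _ ≤ P.lowConst * ‖g‖ₑ * (C * D * (wN s (fun ξ ↦ ‖U ξ‖ₑ)
        * wN (-s) (fun ξ ↦ ‖𝓕⁻ ψ ξ‖ₑ))) := by
        gcongr
        exact tsum_n2_mul_n2_le measurable_ofReal_symR
          (fun k ↦ ((P.continuous_lowR _).sub (P.continuous_lowR _)).measurable.ennreal_ofReal)
          hC hD hU.measurable.enorm (measurable_schwartz _).enorm
    _ = _ := by push_cast; ring

/-- The remainder with a bounded function. -/
theorem exists_nearSum_Linfty_le {s : ℝ} (hs : 0 < s) : ∃ C : ℝ≥0,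
    ∀ (g : Lp ℂ ∞ (volume : Measure ℝ)) (u : 𝓢'(ℝ, ℂ)) (U : ℝ → ℂ) (_ : FourierRep u U)
    (ψ : 𝓢(ℝ, ℂ)), nearSum P M (g : 𝓢'(ℝ, ℂ)) u ψ
      ≤ C * ‖g‖ₑ * wN s (fun ξ ↦ ‖U ξ‖ₑ) * wN (-s) (fun ξ ↦ ‖𝓕⁻ ψ ξ‖ₑ) := by
  obtain ⟨C, hC⟩ := h.exists_tsum_dy_symR_le s
  obtain ⟨D, hD⟩ := h.exists_tsum_dy_ball_le hs
  refine ⟨((2 * M + 1 : ℕ) : ℝ≥0) * (2 * P.lowConst.toNNReal) * (C * D), fun g u U hU ψ ↦ ?_⟩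
  set N : ℕ → ℝ≥0∞ := fun k ↦ n2 volume (fun ξ ↦ ENNReal.ofReal (P.symR k ξ) * ‖U ξ‖ₑ)
    * n2 volume (fun ξ ↦ ENNReal.ofReal (P.lowR (k + 2 * M) ξ) * ‖𝓕⁻ ψ ξ‖ₑ) with hN
  have hterm : ∀ j k, j ≤ k + M → ‖form (P.blockFun j (g : 𝓢'(ℝ, ℂ))) (P.blockFun k u) ψ‖ₑ
      ≤ 2 * P.lowConst * ‖g‖ₑ * N k := by
    intro j k hj
    rw [blockFun_eq_fourierInv P hU]
    refine (h.enorm_form_ball_le g (hU.integrable _) (fun ξ hξ ↦ ?_) hj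
      (P.enorm_blockFun_le j g) ψ).trans (le_of_eq ?_)
    · have h1 := right_ne_zero_of_mul hξ
      rw [P.symbolS_apply, Complex.ofReal_ne_zero] at h1
      refine (h.symR_upper k ξ h1).trans ?_
      have := h.pos_b
      gcongr
      · norm_num
      · omega
    · congr 3
      ext ξ
      rw [enorm_mul, enorm_symbolS, mul_comm]
  calc nearSum P M (g : 𝓢'(ℝ, ℂ)) u ψ
      ≤ ∑' k, ∑' j, (if j ≤ k + M ∧ k ≤ j + M then 2 * P.lowConst * ‖g‖ₑ * N k else 0) := by
        refine ENNReal.tsum_le_tsum fun k ↦ ENNReal.tsum_le_tsum fun j ↦ ?_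
        split_ifs with hjk
        · exact hterm j k hjk.1
        · exact le_rfl
    _ ≤ ∑' k, ((2 * M + 1 : ℕ) : ℝ≥0∞) * (2 * P.lowConst * ‖g‖ₑ * N k) :=
        ENNReal.tsum_le_tsum fun k ↦ tsum_ite_near_le k M _
    _ = ((2 * M + 1 : ℕ) : ℝ≥0∞) * (2 * P.lowConst * ‖g‖ₑ) * ∑' k, N k := by
        rw [ENNReal.tsum_mul_left, ENNReal.tsum_mul_left]
        ring
    _ ≤ ((2 * M + 1 : ℕ) : ℝ≥0∞) * (2 * P.lowConst * ‖g‖ₑ) * (C * D * (wN s (fun ξ ↦ ‖U ξ‖ₑ)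
        * wN (-s) (fun ξ ↦ ‖𝓕⁻ ψ ξ‖ₑ))) := by
        gcongr
        exact tsum_n2_mul_n2_le measurable_ofReal_symR (fun k ↦ measurable_ofReal_lowR _)
          hC hD hU.measurable.enorm (measurable_schwartz _).enorm
    _ = _ := by
        rw [ENNReal.coe_mul, ENNReal.coe_mul, ENNReal.coe_mul, ENNReal.coe_mul,
          ENNReal.coe_toNNReal P.lowConst_lt_top.ne]
        push_cast
        ring

end Scales

end DyadicPartition

end ProductLaws

end

noncomputable section

namespace ProductLaws

/-! ### Bounded Sobolev functions -/

theorem ae_eq_of_toTemperedDistribution_eq {p q : ℝ≥0∞} [hp : Fact (1 ≤ p)] [hq : Fact (1 ≤ q)]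
    {f : Lp ℂ p (volume : Measure ℝ)} {g : Lp ℂ q (volume : Measure ℝ)}
    (h : (f : 𝓢'(ℝ, ℂ)) = g) : f =ᵐ[volume] g := by
  refine ae_eq_of_integral_contDiff_smul_eq ((Lp.memLp f).locallyIntegrable hp.out)
    ((Lp.memLp g).locallyIntegrable hq.out) fun e he hec ↦ ?_
  have he₁ : HasCompactSupport (Complex.ofRealCLM ∘ e) := hec.comp_left rfl
  have he₂ : ContDiff ℝ (⊤ : ℕ∞) (Complex.ofRealCLM ∘ e) := by fun_prop
  have := congrArg (fun T : 𝓢'(ℝ, ℂ) ↦ T (he₁.toSchwartzMap he₂)) h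
  simp only [Lp.toTemperedDistribution_apply] at this
  simpa using this

theorem FourierRep.exists_L2 {u : 𝓢'(ℝ, ℂ)} {U : ℝ → ℂ} (hU : FourierRep u U)
    (h : wN 0 (fun ξ ↦ ‖U ξ‖ₑ) < ∞) :
    ∃ f : Lp ℂ 2 (volume : Measure ℝ), u = f ∧ ‖f‖ₑ = wN 0 (fun ξ ↦ ‖U ξ‖ₑ) := by
  rw [wN_zero_eq, n2_eq_eLpNorm] at h ⊢
  have hU2 : MemLp U 2 volume := ⟨hU.measurable.aestronglyMeasurable, h⟩
  refine ⟨𝓕⁻ (hU2.toLp U), ?_, ?_⟩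
  · ext φ
    rw [toTemperedDistribution_fourierInv_apply, hU.rep]
  · rw [← enorm_fourier_eq, FourierTransform.fourier_fourierInv_eq, Lp.enorm_toLp]

theorem exists_L2_of_mem_sobolevSpace {s : ℝ} (hs : 0 ≤ s) {u : 𝓢'(ℝ, ℂ)}
    (hu : u ∈ SobolevSpace s) :
    ∃ f : Lp ℂ 2 (volume : Measure ℝ), u = f ∧ ‖f‖ₑ ≤ sobolevNorm s u := by
  obtain ⟨U, hU, hn⟩ := exists_fourierRep hu
  have h : wN 0 (fun ξ ↦ ‖U ξ‖ₑ) ≤ sobolevNorm s u := hn ▸ wN_mono hs fun _ ↦ le_rfl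
  obtain ⟨f, hf, hfn⟩ := hU.exists_L2 (h.trans_lt (mem_sobolevSpace_iff.1 hu))
  exact ⟨f, hf, hfn ▸ h⟩

theorem mem_sobolevSpace_zero (f : Lp ℂ 2 (volume : Measure ℝ)) :
    (f : 𝓢'(ℝ, ℂ)) ∈ SobolevSpace 0 := by
  rw [mem_sobolevSpace_iff, sobolevNorm_zero, normLp_coe]
  exact enorm_lt_top

theorem n2_Lp (f : Lp ℂ 2 (volume : Measure ℝ)) : n2 volume (fun x ↦ ‖f x‖ₑ) = ‖f‖ₑ := by
  rw [n2_eq_eLpNorm, Lp.enorm_def]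

theorem n2_schwartz_fourierInv (ψ : 𝓢(ℝ, ℂ)) :
    n2 volume (fun x ↦ ‖ψ x‖ₑ) = wN 0 (fun ξ ↦ ‖𝓕⁻ ψ ξ‖ₑ) := by
  have := n2_schwartz_fourier (𝓕⁻ ψ)
  rwa [FourierTransform.fourier_fourierInv_eq, ← wN_zero_eq (fun ξ ↦ ‖𝓕⁻ ψ ξ‖ₑ)] at this

theorem enorm_integral_schwartz_mul_le (f : Lp ℂ 2 (volume : Measure ℝ))
    (g : Lp ℂ ∞ (volume : Measure ℝ)) (ψ : 𝓢(ℝ, ℂ)) :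
    ‖∫ x, ψ x * (f x * g x)‖ₑ ≤ ‖g‖ₑ * ‖f‖ₑ * wN 0 (fun ξ ↦ ‖𝓕⁻ ψ ξ‖ₑ) := by
  calc _ ≤ ∫⁻ x, ‖ψ x * (f x * g x)‖ₑ := enorm_integral_le_lintegral_enorm _
    _ ≤ ∫⁻ x, ‖g‖ₑ * (‖f x‖ₑ * ‖ψ x‖ₑ) := by
        refine lintegral_mono_ae ?_
        filter_upwards [ae_enorm_le_Linfty g] with x hx
        rw [enorm_mul, enorm_mul]
        calc ‖ψ x‖ₑ * (‖f x‖ₑ * ‖g x‖ₑ) ≤ ‖ψ x‖ₑ * (‖f x‖ₑ * ‖g‖ₑ) := by gcongr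
          _ = _ := by ring
    _ = ‖g‖ₑ * ∫⁻ x, ‖f x‖ₑ * ‖ψ x‖ₑ := lintegral_const_mul' _ _ enorm_ne_top
    _ ≤ ‖g‖ₑ * (‖f‖ₑ * wN 0 (fun ξ ↦ ‖𝓕⁻ ψ ξ‖ₑ)) := by
        rw [← n2_Lp, ← n2_schwartz_fourierInv]
        gcongr
        exact lintegral_mul_le_n2 (Lp.aestronglyMeasurable f).enorm
          ψ.continuous.aestronglyMeasurable.enorm
    _ = _ := by ring

theorem normLp_top_mul_le {f : Lp ℂ 2 (volume : Measure ℝ)} {e g : Lp ℂ ∞ (volume : Measure ℝ)}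
    (h : (f : 𝓢'(ℝ, ℂ)) = e) {w : 𝓢'(ℝ, ℂ)} (hw : ∀ ψ : 𝓢(ℝ, ℂ), w ψ = ∫ x, ψ x * (f x * g x)) :
    normLp ∞ w ≤ ‖e‖ₑ * ‖g‖ₑ := by
  have hle : eLpNorm (fun x ↦ e x * g x) ∞ volume ≤ ‖e‖ₑ * ‖g‖ₑ := by
    rw [eLpNorm_exponent_top]
    refine eLpNormEssSup_le_of_ae_enorm_bound ?_
    filter_upwards [ae_enorm_le_Linfty e, ae_enorm_le_Linfty g] with x h1 h2
    rw [enorm_mul]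
    gcongr
  have hm : MemLp (fun x ↦ e x * g x) ∞ volume :=
    ⟨(Lp.aestronglyMeasurable e).mul (Lp.aestronglyMeasurable g),
      hle.trans_lt (ENNReal.mul_lt_top enorm_lt_top enorm_lt_top)⟩
  have : w = (hm.toLp _ : 𝓢'(ℝ, ℂ)) := by
    ext ψ
    rw [hw, Lp.toTemperedDistribution_apply]
    refine integral_congr_ae ?_
    filter_upwards [hm.coeFn_toLp, ae_eq_of_toTemperedDistribution_eq h] with x h1 h2
    rw [h1, h2, smul_eq_mul]
  rw [this, normLp_coe, Lp.enorm_toLp]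
  exact hle

/-- Both factors are in L², so the product exists for every partition by `exists_isProductAt_L2`;
only the norm remains. In each paraproduct and in the remainder one factor is measured in L^∞ and
the other in H^s. The L^∞ norm of the product is read off from the pointwise formula. -/
theorem productContinuous_bounded_sobolev (P : DyadicPartition) {s : ℝ} (hs : 0 ≤ s) :
    ProductContinuous (SobolevSpace s ⊓ LpSpace ∞) (fun u ↦ sobolevNorm s u + normLp ∞ u)
      (SobolevSpace s ⊓ LpSpace ∞) (fun u ↦ sobolevNorm s u + normLp ∞ u)
      (SobolevSpace s ⊓ LpSpace ∞) (fun u ↦ sobolevNorm s u + normLp ∞ u) := by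
  have key : ∃ C : ℝ≥0, ∀ (f e : Lp ℂ 2 (volume : Measure ℝ)) (f' e' : Lp ℂ ∞ (volume : Measure ℝ))
      (w : 𝓢'(ℝ, ℂ)), (f : 𝓢'(ℝ, ℂ)) = f' → (e : 𝓢'(ℝ, ℂ)) = e' →
      (f : 𝓢'(ℝ, ℂ)) ∈ SobolevSpace s → (e : 𝓢'(ℝ, ℂ)) ∈ SobolevSpace s →
      IsProductAt P (f : 𝓢'(ℝ, ℂ)) (e : 𝓢'(ℝ, ℂ)) w → ∀ ψ : 𝓢(ℝ, ℂ),
      ‖w ψ‖ₑ ≤ C * (sobolevNorm s f + ‖f'‖ₑ) * (sobolevNorm s e + ‖e'‖ₑ)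
        * wN (-s) (fun ξ ↦ ‖𝓕⁻ ψ ξ‖ₑ) := by
    -- The remainder estimate needs s > 0; at s = 0 the pointwise product is bounded directly in L².
    rcases hs.eq_or_lt with rfl | hs
    · refine ⟨1, fun f e f' e' w hf he _ _ hw ψ ↦ ?_⟩
      rw [((hw.agreesWithPointwise f rfl).2 e' he ψ), neg_zero, sobolevNorm_zero, normLp_coe,
        ENNReal.coe_one, one_mul]
      refine (enorm_integral_schwartz_mul_le f e' ψ).trans ?_
      rw [mul_comm ‖e'‖ₑ]
      gcongr
      · exact le_self_add
      · exact le_add_self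
    · obtain ⟨a, b, M, h⟩ := P.exists_scales
      obtain ⟨C, hC⟩ := h.exists_farSum_Linfty_le s
      obtain ⟨D, hD⟩ := h.exists_nearSum_Linfty_le hs
      refine ⟨C + C + 3 * D, fun f e f' e' w hf he hfs hes hw ψ ↦ ?_⟩
      obtain ⟨U, hU, hUn⟩ := exists_fourierRep hfs
      obtain ⟨V, hV, hVn⟩ := exists_fourierRep hes
      set X := sobolevNorm s f + ‖f'‖ₑ with hX
      set Y := sobolevNorm s e + ‖e'‖ₑ with hY
      set Z := wN (-s) (fun ξ ↦ ‖𝓕⁻ ψ ξ‖ₑ) with hZ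
      have e1 : farSum P M (f : 𝓢'(ℝ, ℂ)) e ψ ≤ C * X * Y * Z := by
        conv_lhs => rw [hf]
        refine (hC f' e V hV ψ).trans ?_
        rw [hVn]
        gcongr
        · exact le_add_self
        · exact le_self_add
      have e2 : farSum P M (e : 𝓢'(ℝ, ℂ)) f ψ ≤ C * X * Y * Z := by
        conv_lhs => rw [he]
        refine (hC e' f U hU ψ).trans ?_
        rw [hUn, mul_right_comm (C : ℝ≥0∞)]
        gcongr
        · exact le_self_add
        · exact le_add_self
      have e3 : nearSum P M (f : 𝓢'(ℝ, ℂ)) e ψ ≤ D * X * Y * Z := by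
        conv_lhs => rw [hf]
        refine (hD f' e V hV ψ).trans ?_
        rw [hVn]
        gcongr
        · exact le_add_self
        · exact le_self_add
      have h2 := h.two_le
      calc ‖w ψ‖ₑ ≤ _ := hw.enorm_apply_le hU.regular hV.regular (show 1 ≤ M by omega) ψ
        _ ≤ C * X * Y * Z + C * X * Y * Z + 3 * (D * X * Y * Z) := by gcongr
        _ = _ := by push_cast; ring
  obtain ⟨C, hC⟩ := key
  have hreg : ∀ u ∈ SobolevSpace s ⊓ LpSpace ∞, Regular u := fun u hu ↦ by
    obtain ⟨U, hU, -⟩ := exists_fourierRep hu.1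
    exact hU.regular
  refine productContinuous_of_forall_exists P hreg hreg (C + 1) ?_
  rintro u ⟨hu, hu'⟩ v ⟨hv, hv'⟩
  obtain ⟨f, rfl, -⟩ := exists_L2_of_mem_sobolevSpace hs hu
  obtain ⟨e, rfl, -⟩ := exists_L2_of_mem_sobolevSpace hs hv
  obtain ⟨f', hf'⟩ := (normLp_lt_top_iff ∞).1 hu'
  obtain ⟨e', he'⟩ := (normLp_lt_top_iff ∞).1 hv'
  obtain ⟨w, hw⟩ := exists_isProductAt_L2 P (mem_sobolevSpace_zero f) (mem_sobolevSpace_zero e)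
  have hag := (hw P).agreesWithPointwise
  have hb := hC f e f' e' w hf' he' hu hv (hw P)
  have hfin : C * (sobolevNorm s f + ‖f'‖ₑ) * (sobolevNorm s e + ‖e'‖ₑ) ≠ ∞ :=
    ENNReal.mul_ne_top (ENNReal.mul_ne_top ENNReal.coe_ne_top
      (ENNReal.add_ne_top.2 ⟨(mem_sobolevSpace_iff.1 hu).ne, enorm_ne_top⟩))
      (ENNReal.add_ne_top.2 ⟨(mem_sobolevSpace_iff.1 hv).ne, enorm_ne_top⟩)
  obtain ⟨h1, h2⟩ := sobolevNorm_le_of_bound hfin hb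
  have h3 : normLp ∞ w ≤ ‖f'‖ₑ * ‖e'‖ₑ := normLp_top_mul_le hf' ((hag f rfl).2 e' he')
  refine ⟨w, ⟨h1, h3.trans_lt (ENNReal.mul_lt_top enorm_lt_top enorm_lt_top)⟩, hw, hag, ?_⟩
  have hnf : normLp ∞ (f : 𝓢'(ℝ, ℂ)) = ‖f'‖ₑ := by rw [hf', normLp_coe]
  have hne : normLp ∞ (e : 𝓢'(ℝ, ℂ)) = ‖e'‖ₑ := by rw [he', normLp_coe]
  simp only [hnf, hne]
  calc sobolevNorm s w + normLp ∞ w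
      ≤ C * (sobolevNorm s f + ‖f'‖ₑ) * (sobolevNorm s e + ‖e'‖ₑ)
        + (sobolevNorm s f + ‖f'‖ₑ) * (sobolevNorm s e + ‖e'‖ₑ) := by
        gcongr
        refine h3.trans ?_
        gcongr
        · exact le_add_self
        · exact le_add_self
    _ = _ := by push_cast; ring

end ProductLaws

end

noncomputable section

namespace ProductLaws

/-! ### Besov spaces -/

/-- Here `dy (-(σ / 2)) k` is 2^{-kσ}, and 2^σ compensates the shift q = k - 1. -/
theorem normLp_block_le_besovNorm (P : DyadicPartition) (σ : ℝ) (p : ℝ≥0∞) [Fact (1 ≤ p)]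
    (v : 𝓢'(ℝ, ℂ)) (k : ℕ) :
    normLp p (P.block k v) ≤ ENNReal.ofReal (2 ^ σ) * dy (-(σ / 2)) k * besovNorm P σ p ∞ v := by
  have h : besovSeq P σ p v k ≤ besovNorm P σ p ∞ v := by
    rw [besovNorm, eLpNorm_exponent_top]
    have := enorm_ae_le_eLpNormEssSup (besovSeq P σ p v) Measure.count
    rw [Measure.ae_count_iff] at this
    simpa using this k
  have e : ENNReal.ofReal (2 ^ σ) * dy (-(σ / 2)) k
      * ENNReal.ofReal ((2 : ℝ) ^ (((k : ℝ) - 1) * σ)) = 1 := by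
    rw [dy, ← ENNReal.ofReal_mul (by positivity), ← ENNReal.ofReal_mul (by positivity),
      ← Real.rpow_natCast, show (4 : ℝ) = 2 ^ (2 : ℝ) by norm_num, ← Real.rpow_mul (by norm_num),
      ← Real.rpow_mul (by norm_num), ← Real.rpow_add (by norm_num), ← Real.rpow_add (by norm_num)]
    rw [show σ + 2 * ((k : ℝ) * -(σ / 2)) + ((k : ℝ) - 1) * σ = 0 by ring, Real.rpow_zero,
      ENNReal.ofReal_one]
  calc normLp p (P.block k v) = ENNReal.ofReal (2 ^ σ) * dy (-(σ / 2)) k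
        * ENNReal.ofReal ((2 : ℝ) ^ (((k : ℝ) - 1) * σ)) * normLp p (P.block k v) := by
        rw [e, one_mul]
    _ = ENNReal.ofReal (2 ^ σ) * dy (-(σ / 2)) k * besovSeq P σ p v k := by
        rw [mul_assoc, besovSeq]
    _ ≤ _ := by gcongr

theorem dy_neg_le {j k L : ℕ} (h : k ≤ j + L) {r : ℝ} (hr : 0 ≤ r) :
    dy (-r) j ≤ dy r L * dy (-r) k := by
  have e1 : dy (-r) j = dy (-r) j * (dy (-r) L * dy r L) := by rw [dy_neg_mul, mul_one]
  have e2 : dy (-r) j * dy (-r) L = dy (-r) (j + L) := by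
    rw [dy, dy, dy, ← ENNReal.ofReal_mul (by positivity),
      ← Real.mul_rpow (by positivity) (by positivity), ← pow_add]
  rw [e1, ← mul_assoc, e2, mul_comm]
  gcongr
  refine ENNReal.ofReal_le_ofReal (Real.rpow_le_rpow_of_nonpos (by positivity) ?_ (by linarith))
  exact pow_le_pow_right₀ (by norm_num) h

/-- The tail of the dyadic decomposition of a distribution with absolutely summable blocks. -/
theorem exists_tail_of_summable (P : DyadicPartition) {p : ℝ≥0∞} [Fact (1 ≤ p)] {v : 𝓢'(ℝ, ℂ)}
    {g : ℕ → Lp ℂ p (volume : Measure ℝ)} (hg : ∀ k, P.block k v = g k)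
    (hs : ∑' k, ‖g k‖ₑ ≠ ∞) (m : ℕ) :
    ∃ t : Lp ℂ p (volume : Measure ℝ), v - ∑ j ∈ Finset.range m, P.block j v = t ∧
      ‖t‖ₑ ≤ ∑' j, ‖g (j + m)‖ₑ := by
  have hsum : Summable g := Summable.of_enorm hs
  have hsum' : Summable fun j ↦ g (j + m) := (summable_nat_add_iff m).2 hsum
  refine ⟨∑' j, g (j + m), ?_, enorm_tsum_le_tsum_enorm⟩
  ext φ
  let Λ : Lp ℂ p (volume : Measure ℝ) → ℂ := fun f ↦ (f : 𝓢'(ℝ, ℂ)) φ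
  have hΛ : Filter.Tendsto (fun n ↦ Λ (∑ j ∈ Finset.range n, g j)) Filter.atTop
      (nhds (Λ (∑' j, g j))) := by
    have hc : Continuous Λ := by
      have h1 : Continuous fun f : Lp ℂ p (volume : Measure ℝ) ↦ (f : 𝓢'(ℝ, ℂ)) :=
        (Lp.toTemperedDistributionCLM ℂ (volume : Measure ℝ) p).continuous
      exact (PointwiseConvergenceCLM.evalCLM (RingHom.id ℂ) ℂ φ).continuous.comp h1
    exact (hc.tendsto _).comp hsum.hasSum.tendsto_sum_nat
  have hΛs : ∀ s : Finset ℕ, Λ (∑ j ∈ s, g j) = ∑ j ∈ s, P.block j v φ := by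
    intro s
    simp only [hg]
    change (Lp.toTemperedDistributionCLM ℂ (volume : Measure ℝ) p (∑ j ∈ s, g j) : 𝓢'(ℝ, ℂ)) φ = _
    rw [map_sum]
    simp
  have hv : v φ = Λ (∑' j, g j) := by
    refine tendsto_nhds_unique (P.tendsto_sum_block v φ) ?_
    simpa only [hΛs] using hΛ
  have hsplit : Λ (∑' j, g j) = Λ (∑ j ∈ Finset.range m, g j) + Λ (∑' j, g (j + m)) := by
    rw [← hsum.sum_add_tsum_nat_add m]
    change (Lp.toTemperedDistributionCLM ℂ (volume : Measure ℝ) p (_ + _) : 𝓢'(ℝ, ℂ)) φ = _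
    rw [map_add]
    rfl
  change v φ - (∑ j ∈ Finset.range m, P.block j v) φ = Λ (∑' j, g (j + m))
  rw [hv, hsplit, hΛs]
  simp

/-- For σ > 0 the L^p norms of the blocks are dominated by a geometric series. The case m = 0 is the
embedding of the Besov space in L^p. -/
theorem exists_tail_of_besovNorm (P : DyadicPartition) {σ : ℝ} (hσ : 0 < σ) (p : ℝ≥0∞)
    [Fact (1 ≤ p)] : ∃ C : ℝ≥0, ∀ v : 𝓢'(ℝ, ℂ), besovNorm P σ p ∞ v < ∞ → ∀ m,
      ∃ t : Lp ℂ p (volume : Measure ℝ), v - ∑ j ∈ Finset.range m, P.block j v = t ∧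
        ‖t‖ₑ ≤ C * dy (-(σ / 2)) m * besovNorm P σ p ∞ v := by
  have hS := tsum_dy_lt_top (half_pos hσ)
  set C := ENNReal.ofReal (2 ^ σ) * ∑' j, dy (-(σ / 2)) j with hC
  have hCfin : C ≠ ∞ := ENNReal.mul_ne_top ENNReal.ofReal_ne_top hS.ne
  refine ⟨C.toNNReal, fun v hv m ↦ ?_⟩
  rw [ENNReal.coe_toNNReal hCfin]
  have hb : ∀ k, ∃ g : Lp ℂ p (volume : Measure ℝ), P.block k v = g := fun k ↦
    (normLp_lt_top_iff p).1 ((normLp_block_le_besovNorm P σ p v k).trans_lt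
      (ENNReal.mul_lt_top (ENNReal.mul_lt_top ENNReal.ofReal_lt_top ENNReal.ofReal_lt_top) hv))
  choose g hg using hb
  have hgn : ∀ k, ‖g k‖ₑ ≤ ENNReal.ofReal (2 ^ σ) * dy (-(σ / 2)) k * besovNorm P σ p ∞ v :=
    fun k ↦ by
      rw [← normLp_coe, ← hg]
      exact normLp_block_le_besovNorm P σ p v k
  have hsum : ∀ m, ∑' j, ‖g (j + m)‖ₑ ≤ C * dy (-(σ / 2)) m * besovNorm P σ p ∞ v := by
    intro m
    calc ∑' j, ‖g (j + m)‖ₑ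
        ≤ ∑' j, ENNReal.ofReal (2 ^ σ) * dy (-(σ / 2)) m * besovNorm P σ p ∞ v
          * dy (-(σ / 2)) j := by
          refine ENNReal.tsum_le_tsum fun j ↦ (hgn _).trans (le_of_eq ?_)
          rw [dy_idx_add, show dy (-(σ / 2)) j = dy (-(σ / 2)) 1 ^ j by
            have := dy_idx_add (-(σ / 2)) j 0
            rw [add_zero] at this
            rw [this]
            simp [dy]]
          ring
      _ = _ := by rw [ENNReal.tsum_mul_left, hC]; ring
  have hfin : ∑' k, ‖g k‖ₑ ≠ ∞ := ((hsum 0).trans_lt (ENNReal.mul_lt_top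
    (ENNReal.mul_lt_top hCfin.lt_top ENNReal.ofReal_lt_top) hv)).ne
  obtain ⟨t, ht, htn⟩ := exists_tail_of_summable P hg hfin m
  exact ⟨t, ht, htn.trans (hsum m)⟩

/-- A block of a block vanishes if the supports of the two symbols are disjoint. -/
theorem blockFun_block_eq_zero (P P' : DyadicPartition) {j k : ℕ}
    (h : ∀ ξ, P'.symR k ξ ≠ 0 → P.symR j ξ = 0) (v : 𝓢'(ℝ, ℂ)) (x : ℝ) :
    P'.blockFun k (P.block j v) x = 0 := by
  rw [DyadicPartition.blockFun, DyadicPartition.block, fourierMultiplierCLM_apply_apply]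
  have : SchwartzMap.smulLeftCLM ℂ (P.symbol j)
      (𝓕⁻ (SchwartzMap.compSubConstCLM ℂ x (𝓕 (P'.symbolS k)))) = 0 := by
    ext ξ
    refine (SchwartzMap.smulLeftCLM_apply_apply (P.symbolS j).hasTemperateGrowth _ ξ).trans ?_
    rw [fourierInv_compSubConst, FourierTransform.fourierInv_fourier_eq, P.symbolS_apply,
      P'.symbolS_apply]
    by_cases hξ : P'.symR k ξ = 0
    · simp [hξ]
    · simp [h ξ hξ]
  rw [this]
  have h0 : 𝓕 (0 : 𝓢(ℝ, ℂ)) = 0 := map_zero (fourierCLM ℂ 𝓢(ℝ, ℂ))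
  rw [h0]
  exact map_zero v

/-- Existence is required for every partition `P'`, while the norm is taken in `P`. A block of `P'`
at scale k does not see the blocks of `P` below k - L, so it equals the block of a tail, which is of
size 2^{-kσ} in L^∞. -/
theorem exists_enorm_blockFun_besov_le (P P' : DyadicPartition) {σ : ℝ} (hσ : 0 < σ) :
    ∃ C : ℝ≥0, ∀ v : 𝓢'(ℝ, ℂ), besovNorm P σ ∞ ∞ v < ∞ → ∀ k x,
      ‖P'.blockFun k v x‖ₑ ≤ C * dy (-(σ / 2)) k * besovNorm P σ ∞ ∞ v := by
  obtain ⟨a, b, M, h⟩ := P.exists_scales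
  obtain ⟨a', b', M', h'⟩ := P'.exists_scales
  obtain ⟨C, hC⟩ := exists_tail_of_besovNorm P hσ ∞
  -- With b < 2^L a' the outer radius of block j of `P` stays below the inner radius of block k of
  -- `P'` whenever j < k - L.
  obtain ⟨L, hL⟩ := pow_unbounded_of_one_lt (b / a') (by norm_num : (1 : ℝ) < 2)
  rw [div_lt_iff₀ h'.pos_a] at hL
  refine ⟨2 * P'.lowConst.toNNReal * C * (dy (σ / 2) L).toNNReal, fun v hv k x ↦ ?_⟩
  obtain ⟨t, ht, htn⟩ := hC v hv (k - L)
  have hz : ∀ j < k - L, P'.blockFun k (P.block j v) x = 0 := by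
    intro j hj
    refine blockFun_block_eq_zero P P' (fun ξ hξ ↦ ?_) v x
    by_contra hne
    have h1 := h.symR_upper j ξ hne
    have h2 := h'.symR_lower k ξ (by omega) hξ
    have h3 : (2 : ℝ) ^ k = 2 ^ (k - L) * 2 ^ L := by rw [← pow_add]; congr 1; omega
    have h4 : (2 : ℝ) ^ j ≤ 2 ^ (k - L) := pow_le_pow_right₀ (by norm_num) hj.le
    have h5 : b * 2 ^ j ≤ b * 2 ^ (k - L) := mul_le_mul_of_nonneg_left h4 h.pos_b.le
    have h6 : (0 : ℝ) < 2 ^ (k - L) := by positivity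
    have h7 : b * 2 ^ (k - L) < 2 ^ L * a' * 2 ^ (k - L) := mul_lt_mul_of_pos_right hL h6
    rw [h3] at h2
    linarith
  have hv' : P'.blockFun k v x = P'.blockFun k (t : 𝓢'(ℝ, ℂ)) x := by
    rw [← ht]
    have : v = (v - ∑ j ∈ Finset.range (k - L), P.block j v)
        + ∑ j ∈ Finset.range (k - L), P.block j v := by abel
    conv_lhs => rw [this]
    rw [blockFun_add_right, Pi.add_apply]
    have h0 : P'.blockFun k (∑ j ∈ Finset.range (k - L), P.block j v) x
        = ∑ j ∈ Finset.range (k - L), P'.blockFun k (P.block j v) x := by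
      simp [DyadicPartition.blockFun]
    rw [h0, Finset.sum_eq_zero fun j hj ↦ hz j (Finset.mem_range.1 hj), add_zero]
  have hdy : dy (-(σ / 2)) (k - L) ≤ dy (σ / 2) L * dy (-(σ / 2)) k :=
    dy_neg_le (by omega) (half_pos hσ).le
  rw [hv']
  calc _ ≤ 2 * P'.lowConst * ‖t‖ₑ := P'.enorm_blockFun_le k t x
    _ ≤ 2 * P'.lowConst * (C * (dy (σ / 2) L * dy (-(σ / 2)) k) * besovNorm P σ ∞ ∞ v) := by
        gcongr
        exact htn.trans (by gcongr)
    _ = _ := by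
        rw [ENNReal.coe_mul, ENNReal.coe_mul, ENNReal.coe_mul,
          ENNReal.coe_toNNReal P'.lowConst_lt_top.ne, ENNReal.coe_toNNReal (dy_ne_top _ _)]
        push_cast
        ring

end ProductLaws

end

noncomputable section

namespace ProductLaws

/-! ### Products with Hölder continuous functions -/

namespace DyadicPartition.Scales

variable {P : DyadicPartition} {a b : ℝ} {M : ℕ} (h : P.Scales a b M)

include h

/-- On a ball of size 2^k the weight ⟨ξ⟩^{-s} is at least a constant times 2^{-ks}, since s ≥ 0. -/
theorem exists_n2_ball_le {s : ℝ} (hs : 0 ≤ s) : ∃ D : ℝ≥0, ∀ (k : ℕ) (f : ℝ → ℝ≥0∞),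
    n2 volume (fun ξ ↦ ENNReal.ofReal (P.lowR (k + 2 * M) ξ) * f ξ)
      ≤ D * dy (s / 2) k * wN (-s) f := by
  obtain ⟨C, hC, -, h2, -⟩ := h.exists_const
  set C' : ℝ := C * 4 ^ (2 * M) with hC'
  have hC'0 : 0 < C' := by positivity
  refine ⟨(C' ^ (s / 2)).toNNReal, fun k f ↦ ?_⟩
  have hfin : ((C' ^ (s / 2)).toNNReal : ℝ≥0∞) * dy (s / 2) k ≠ ∞ :=
    ENNReal.mul_ne_top ENNReal.coe_ne_top (dy_ne_top _ _)
  rw [wN, ← n2_const_mul hfin]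
  refine n2_mono fun ξ ↦ ?_
  rw [← mul_assoc]
  gcongr
  by_cases hξ : P.lowR (k + 2 * M) ξ = 0
  · simp [hξ]
  have e := h2 _ _ hξ
  have e' : jap ξ ≤ C' * 4 ^ k := by
    refine e.trans (le_of_eq ?_)
    rw [hC', pow_add]; ring
  change _ ≤ ENNReal.ofReal (C' ^ (s / 2)) * dy (s / 2) k * jw (-s / 2) ξ
  rw [dy, jw, ← ENNReal.ofReal_mul (by positivity), ← ENNReal.ofReal_mul (by positivity)]
  refine ENNReal.ofReal_le_ofReal ((P.lowR_le_one _ ξ).trans ?_)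
  have hj := jap_pos ξ
  rw [← Real.mul_rpow hC'0.le (by positivity), neg_div, Real.rpow_neg hj.le, ← div_eq_mul_inv,
    one_le_div (by positivity)]
  exact Real.rpow_le_rpow hj.le e' (by linarith)

/-- The paraproduct by g uses only that g is bounded. In the other two parts Δ_k g gains
2^{-k(s+ε)}, u is measured merely in L², and localizing ψ to a ball costs 2^{ks}; the surplus
2^{-kε} is summable, also at s = 0. -/
theorem exists_bony_holder_le (P₀ : DyadicPartition) {s ε : ℝ} (hs : 0 ≤ s) (hε : 0 < ε) :
    ∃ C : ℝ≥0, ∀ (g : Lp ℂ ∞ (volume : Measure ℝ)),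
      besovNorm P₀ (s + ε) ∞ ∞ (g : 𝓢'(ℝ, ℂ)) < ∞ →
      ‖g‖ₑ ≤ C * besovNorm P₀ (s + ε) ∞ ∞ (g : 𝓢'(ℝ, ℂ)) ∧
      ∀ (u : 𝓢'(ℝ, ℂ)) (U : ℝ → ℂ) (_ : FourierRep u U) (ψ : 𝓢(ℝ, ℂ)),
        farSum P M u g ψ + farSum P M g u ψ + 3 * nearSum P M u g ψ
          ≤ C * wN s (fun ξ ↦ ‖U ξ‖ₑ) * besovNorm P₀ (s + ε) ∞ ∞ (g : 𝓢'(ℝ, ℂ))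
            * wN (-s) (fun ξ ↦ ‖𝓕⁻ ψ ξ‖ₑ) := by
  set σ := s + ε with hσ
  have hσ0 : 0 < σ := by linarith
  obtain ⟨A, hA⟩ := exists_tail_of_besovNorm P₀ hσ0 ∞
  obtain ⟨B, hB⟩ := exists_enorm_blockFun_besov_le P₀ P hσ0
  obtain ⟨C, hC⟩ := h.exists_farSum_Linfty_le s
  obtain ⟨D, hD⟩ := h.exists_n2_ball_le hs
  have hS := tsum_dy_lt_top (half_pos hε)
  set S : ℝ≥0 := (∑' k, dy (-(ε / 2)) k).toNNReal with hSdef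
  have hSe : (S : ℝ≥0∞) = ∑' k, dy (-(ε / 2)) k := ENNReal.coe_toNNReal hS.ne
  set E : ℝ≥0 := (dy (σ / 2) M).toNNReal with hEdef
  have hEe : (E : ℝ≥0∞) = dy (σ / 2) M := ENNReal.coe_toNNReal (dy_ne_top _ _)
  set K : ℝ≥0 := B * D * S with hK
  refine ⟨A + (K + C * A + 3 * (((2 * M + 1 : ℕ) : ℝ≥0) * (E * K))), fun g hg ↦ ?_⟩
  set N := besovNorm P₀ σ ∞ ∞ (g : 𝓢'(ℝ, ℂ)) with hN
  have hgn : ‖g‖ₑ ≤ A * N := by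
    obtain ⟨t, ht, htn⟩ := hA g hg 0
    rw [Finset.range_zero, Finset.sum_empty, sub_zero] at ht
    rw [← normLp_coe, ht, normLp_coe]
    refine htn.trans (le_of_eq ?_)
    simp [dy, hN]
  refine ⟨hgn.trans ?_, fun u U hU ψ ↦ ?_⟩
  · gcongr
    exact le_self_add
  set X := wN s (fun ξ ↦ ‖U ξ‖ₑ) with hX
  set Z := wN (-s) (fun ξ ↦ ‖𝓕⁻ ψ ξ‖ₑ) with hZ
  -- One estimate serves twice: W is the symbol of S_{k-M} for the far part and of Δ_k for the near
  -- part.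
  have hterm : ∀ (j k : ℕ) (W : 𝓢(ℝ, ℂ)), j ≤ k + M → (∀ ξ, ‖W ξ‖ₑ ≤ 1) →
      (∀ ξ, W ξ ≠ 0 → |ξ| ≤ b * 2 ^ (k + M)) →
      ‖form (P.blockFun j (g : 𝓢'(ℝ, ℂ))) (𝓕⁻ (fun ξ ↦ U ξ * W ξ)) ψ‖ₑ
        ≤ B * dy (-(σ / 2)) j * N * (X * (D * dy (s / 2) k * Z)) := by
    intro j k W hj hW1 hWs
    refine (h.enorm_form_ball_le g (hU.integrable W) (fun ξ hξ ↦ hWs ξ (right_ne_zero_of_mul hξ))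
      hj (hB g hg j) ψ).trans ?_
    gcongr
    · rw [← wN_zero_eq]
      refine wN_mono hs fun ξ ↦ ?_
      rw [enorm_mul]
      exact mul_le_of_le_one_right' (hW1 ξ)
    · exact hD k _
  have hsd : ∀ k, dy (-(σ / 2)) k * dy (s / 2) k = dy (-(ε / 2)) k := fun k ↦ by
    rw [← dy_add, hσ]; congr 1; ring
  have hb0 := h.pos_b
  have hfar : farSum P M u g ψ ≤ K * X * N * Z := by
    calc farSum P M u g ψ ≤ ∑' k, B * D * X * N * Z * dy (-(ε / 2)) k := by
          refine ENNReal.tsum_le_tsum fun k ↦ ?_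
          rw [form_comm, lowFun_eq_fourierInv P hU]
          refine (hterm k k (P.lowS (k - M)) (by omega) (fun ξ ↦ ?_) fun ξ hξ ↦ ?_).trans
            (le_of_eq ?_)
          · rw [enorm_lowS]
            exact ENNReal.ofReal_le_one.2 (P.lowR_le_one _ ξ)
          · rw [P.lowS_apply, Complex.ofReal_ne_zero] at hξ
            refine (h.lowR_upper _ ξ hξ).trans ?_
            gcongr
            · norm_num
            · omega
          · rw [← hsd]; ring
      _ = K * X * N * Z := by rw [ENNReal.tsum_mul_left, hK, ← hSe]; push_cast; ring
  have hnear : nearSum P M u g ψ ≤ ((2 * M + 1 : ℕ) : ℝ≥0∞) * (E * K) * X * N * Z := by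
    rw [nearSum_comm]
    calc nearSum P M g u ψ
        ≤ ∑' k, ∑' j, (if j ≤ k + M ∧ k ≤ j + M then
          E * (B * D * X * N * Z * dy (-(ε / 2)) k) else 0) := by
          refine ENNReal.tsum_le_tsum fun k ↦ ENNReal.tsum_le_tsum fun j ↦ ?_
          split_ifs with hjk
          · rw [blockFun_eq_fourierInv P hU]
            refine (hterm j k (P.symbolS k) hjk.1 (fun ξ ↦ ?_) fun ξ hξ ↦ ?_).trans ?_
            · rw [enorm_symbolS]
              exact ENNReal.ofReal_le_one.2 (P.symR_le_one _ ξ)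
            · rw [P.symbolS_apply, Complex.ofReal_ne_zero] at hξ
              refine (h.symR_upper _ ξ hξ).trans ?_
              gcongr
              · norm_num
              · omega
            · calc B * dy (-(σ / 2)) j * N * (X * (D * dy (s / 2) k * Z))
                  ≤ B * (dy (σ / 2) M * dy (-(σ / 2)) k) * N * (X * (D * dy (s / 2) k * Z)) := by
                    gcongr
                    exact dy_neg_le hjk.2 (by linarith)
                _ = _ := by rw [hEe, ← hsd]; ring
          · exact le_rfl
      _ ≤ ∑' k, ((2 * M + 1 : ℕ) : ℝ≥0∞) * (E * (B * D * X * N * Z * dy (-(ε / 2)) k)) :=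
          ENNReal.tsum_le_tsum fun k ↦ tsum_ite_near_le k M _
      _ = _ := by
          rw [ENNReal.tsum_mul_left, ENNReal.tsum_mul_left, ENNReal.tsum_mul_left, hK, ← hSe]
          push_cast
          ring
  have hmain : farSum P M g u ψ ≤ C * A * X * N * Z := by
    refine (hC g u U hU ψ).trans ?_
    calc C * ‖g‖ₑ * X * Z ≤ C * (A * N) * X * Z := by gcongr
      _ = _ := by ring
  calc _ ≤ K * X * N * Z + C * A * X * N * Z
        + 3 * (((2 * M + 1 : ℕ) : ℝ≥0∞) * (E * K) * X * N * Z) := by gcongr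
    _ = (K + C * A + 3 * (((2 * M + 1 : ℕ) : ℝ≥0∞) * (E * K))) * X * N * Z := by ring
    _ ≤ _ := by
        gcongr
        rw [ENNReal.coe_add]
        refine le_trans (le_of_eq ?_) le_add_self
        push_cast
        ring

end DyadicPartition.Scales

/-- Products of Sobolev functions with Hölder continuous functions. -/
theorem productContinuous_sobolev_holder (P : DyadicPartition) {s ε : ℝ} (hs : 0 ≤ s)
    (hε : 0 < ε) :
    ProductContinuous (SobolevSpace s) (sobolevNorm s)
      (BesovSpace P (s + ε) ∞ ∞) (besovNorm P (s + ε) ∞ ∞)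
      (SobolevSpace s) (sobolevNorm s) := by
  obtain ⟨a, b, M, h⟩ := P.exists_scales
  obtain ⟨C, hC⟩ := h.exists_bony_holder_le P hs hε
  have hLp : ∀ v ∈ BesovSpace P (s + ε) ∞ ∞, ∃ g : Lp ℂ ∞ (volume : Measure ℝ), v = g := by
    intro v hv
    obtain ⟨A, hA⟩ := exists_tail_of_besovNorm P (σ := s + ε) (by linarith) ∞
    obtain ⟨t, ht, -⟩ := hA v hv 0
    exact ⟨t, by simpa using ht⟩
  refine productContinuous_of_forall_exists P (fun u hu ↦ ?_) (fun v hv ↦ ?_) C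
    fun u hu v hv ↦ ?_
  · obtain ⟨U, hU, -⟩ := exists_fourierRep hu
    exact hU.regular
  · obtain ⟨g, rfl⟩ := hLp v hv
    exact regular_Linfty g
  obtain ⟨U, hU, hUn⟩ := exists_fourierRep hu
  obtain ⟨f, hf, -⟩ := exists_L2_of_mem_sobolevSpace hs hu
  obtain ⟨g, rfl⟩ := hLp v hv
  have hus : sobolevNorm s u ≠ ∞ := (mem_sobolevSpace_iff.1 hu).ne
  have hvn : besovNorm P (s + ε) ∞ ∞ (g : 𝓢'(ℝ, ℂ)) < ∞ := hv
  have hex : ∀ P', ∃ w, IsProductAt P' u g w := by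
    intro P'
    obtain ⟨a', b', M', h'⟩ := P'.exists_scales
    obtain ⟨C', hC'⟩ := h'.exists_bony_holder_le P hs hε
    have hfin : C' * sobolevNorm s u * besovNorm P (s + ε) ∞ ∞ (g : 𝓢'(ℝ, ℂ)) ≠ ∞ :=
      ENNReal.mul_ne_top (ENNReal.mul_ne_top ENNReal.coe_ne_top hus) hvn.ne
    have h2 := h'.two_le
    refine exists_isProductAt hU.regular (regular_Linfty g) (M := M') (by omega) (m := -s)
      (C := (C' * sobolevNorm s u * besovNorm P (s + ε) ∞ ∞ (g : 𝓢'(ℝ, ℂ))).toNNReal) fun ψ ↦ ?_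
    rw [ENNReal.coe_toNNReal hfin, ← hUn]
    exact (hC' g hvn).2 u U hU ψ
  choose w hw using hex
  -- Since s ≥ 0, u is an L² function, and the pointwise formula shows that all partitions give the
  -- same product.
  have hag : ∀ P' ψ, w P' ψ = ∫ x, ψ x * (f x * g x) := fun P' ψ ↦
    ((hw P').agreesWithPointwise f hf).2 g rfl ψ
  have hall : ∀ P', IsProductAt P' u g (w P) := fun P' ↦ by
    have : w P = w P' := by ext ψ; rw [hag, hag]
    rw [this]
    exact hw P'
  have hfin : C * sobolevNorm s u * besovNorm P (s + ε) ∞ ∞ (g : 𝓢'(ℝ, ℂ)) ≠ ∞ :=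
    ENNReal.mul_ne_top (ENNReal.mul_ne_top ENNReal.coe_ne_top hus) hvn.ne
  have h2 := h.two_le
  obtain ⟨h3, h4⟩ := sobolevNorm_le_of_bound hfin fun ψ ↦ by
    refine ((hw P).enorm_apply_le hU.regular (regular_Linfty g) (show 1 ≤ M by omega) ψ).trans ?_
    rw [← hUn]
    exact (hC g hvn).2 u U hU ψ
  exact ⟨w P, h3, hall, (hw P).agreesWithPointwise, h4⟩

end ProductLaws

end

noncomputable section

namespace ProductLaws

/-! ### Products of Sobolev functions with functions in a critical Besov space -/

theorem FourierRep.sub_sum_block (P : DyadicPartition) {v : 𝓢'(ℝ, ℂ)} {V : ℝ → ℂ}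
    (hV : FourierRep v V) (m : ℕ) :
    FourierRep (v - ∑ j ∈ Finset.range m, P.block j v) (fun ξ ↦ V ξ * (1 - P.lowS m ξ)) where
  measurable := hV.measurable.mul (measurable_const.sub (P.lowS m).continuous.measurable)
  integrable φ := by
    have h := (hV.integrable φ).sub
      (hV.integrable (SchwartzMap.smulLeftCLM ℂ (P.lowS m) φ))
    refine h.congr (ae_of_all _ fun ξ ↦ ?_)
    simp only [Pi.sub_apply, SchwartzMap.smulLeftCLM_apply_apply (P.lowS m).hasTemperateGrowth,
      smul_eq_mul]
    ring
  rep φ := by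
    have hb : ∀ j, P.block j v φ = ∫ ξ, V ξ * (P.symbolS j ξ * 𝓕⁻ φ ξ) := fun j ↦ by
      rw [DyadicPartition.block, fourierMultiplierCLM_apply_apply, hV.rep]
      refine integral_congr_ae (ae_of_all _ fun ξ ↦ ?_)
      dsimp only
      rw [FourierTransform.fourierInv_fourier_eq]
      congr 1
      exact SchwartzMap.smulLeftCLM_apply_apply (P.symbolS j).hasTemperateGrowth _ ξ
    have hi : ∀ j, Integrable fun ξ ↦ V ξ * (P.symbolS j ξ * 𝓕⁻ φ ξ) := fun j ↦ by
      refine (hV.integrable (SchwartzMap.smulLeftCLM ℂ (P.symbolS j) (𝓕⁻ φ))).congr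
        (ae_of_all _ fun ξ ↦ ?_)
      simp only [SchwartzMap.smulLeftCLM_apply_apply (P.symbolS j).hasTemperateGrowth, smul_eq_mul]
    change v φ - (∑ j ∈ Finset.range m, P.block j v) φ = _
    rw [sum_apply, hV.rep, Finset.sum_congr rfl fun j _ ↦ hb j,
      ← integral_finsetSum _ fun j _ ↦ hi j,
      ← integral_sub (hV.integrable (𝓕⁻ φ)) (integrable_finsetSum _ fun j _ ↦ hi j)]
    refine integral_congr_ae (ae_of_all _ fun ξ ↦ ?_)
    simp only [P.lowS_apply, DyadicPartition.lowR, P.symbolS_apply, ← Finset.mul_sum,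
      ← Finset.sum_mul, Complex.ofReal_sum]
    ring

theorem FourierRep.n2_eq_normLp {u : 𝓢'(ℝ, ℂ)} {U : ℝ → ℂ} (hU : FourierRep u U)
    (h : n2 volume (fun ξ ↦ ‖U ξ‖ₑ) < ∞) : n2 volume (fun ξ ↦ ‖U ξ‖ₑ) = normLp 2 u := by
  rw [← wN_zero_eq] at h ⊢
  obtain ⟨f, rfl, hf⟩ := hU.exists_L2 h
  rw [normLp_coe, hf]

/-- The norm of B^{1/2}_{2,∞} controls the L² tail of V beyond 2^m by 2^{-m/2}. Covering ⟨η⟩ ≳ ⟨x⟩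
by such tails, with weight ⟨η⟩^{1-2δ}, leaves the sum of 2^{-2δm} over 2^m ≳ ⟨x⟩. The loss δ makes
up for the missing summability in ℓ^∞. -/
theorem exists_lintegral_tail_besov_le (P : DyadicPartition) {δ c : ℝ} (hδ : 0 < δ)
    (hδ' : δ ≤ 1 / 2) (hc : 0 < c) : ∃ K : ℝ≥0, ∀ v : 𝓢'(ℝ, ℂ), besovNorm P (1 / 2) 2 ∞ v < ∞ →
      ∃ V, MemLp V 2 volume ∧ FourierRep v V ∧ ∀ x, ∫⁻ η, (if jap x ≤ c * jap η then
        ‖V η‖ₑ ^ 2 * jw (1 / 2 - δ) η else 0)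
        ≤ (K * besovNorm P (1 / 2) 2 ∞ v) ^ 2 * jw (-δ) x := by
  obtain ⟨A, hA⟩ := exists_tail_of_besovNorm P (σ := 1 / 2) (by norm_num) 2
  obtain ⟨a, b, M, h⟩ := P.exists_scales
  obtain ⟨L, hL1, -, hL, -⟩ := h.exists_const
  obtain ⟨D, hD⟩ := exists_tsum_dy_le (s := δ) (C := c * (4 * L)) hδ (by positivity)
  set E : ℝ≥0 := ((4 * L) ^ (1 / 2 - δ)).toNNReal with hE
  have hE' : (E : ℝ≥0∞) = ENNReal.ofReal ((4 * L) ^ (1 / 2 - δ)) := rfl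
  set K : ℝ≥0 := A ^ 2 * E * D with hK
  refine ⟨K + 1, fun v hv ↦ ?_⟩
  set N := besovNorm P (1 / 2) 2 ∞ v with hN
  obtain ⟨t, ht, -⟩ := hA v hv 0
  rw [Finset.range_zero, Finset.sum_empty, sub_zero] at ht
  obtain ⟨V, hV2, hV, -⟩ := exists_fourierRep_L2 t
  rw [← ht] at hV
  refine ⟨V, hV2, hV, fun x ↦ ?_⟩
  have hVm := hV.measurable
  have htail : ∀ m, ∫⁻ η, ‖V η * (1 - P.lowS m η)‖ₑ ^ 2 ≤ (A * N) ^ 2 * dy (-(1 / 2)) m := by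
    intro m
    obtain ⟨t', ht', htn'⟩ := hA v hv m
    have hlt : n2 volume (fun η ↦ ‖V η * (1 - P.lowS m η)‖ₑ) < ∞ := by
      refine lt_of_le_of_lt (n2_mono (g := fun η ↦ ‖V η‖ₑ) fun η ↦ ?_) ?_
      · rw [enorm_mul]
        refine mul_le_of_le_one_right' ?_
        rw [P.lowS_apply, ← Complex.ofReal_one, ← Complex.ofReal_sub, ← ofReal_norm,
          Complex.norm_real, Real.norm_of_nonneg (by linarith [P.lowR_le_one m η])]
        exact ENNReal.ofReal_le_one.2 (by linarith [P.lowR_nonneg m η])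
      · rw [n2_eq_eLpNorm]
        exact hV2.2
    rw [← n2_sq, (hV.sub_sum_block P m).n2_eq_normLp hlt, ht', normLp_coe]
    calc ‖t'‖ₑ ^ 2 ≤ (A * dy (-(1 / 2 / 2)) m * N) ^ 2 := by gcongr
      _ = _ := by
        rw [mul_pow, mul_pow, mul_pow, dy_sq]
        ring_nf
  have hpt : ∀ η, (if jap x ≤ c * jap η then ‖V η‖ₑ ^ 2 * jw (1 / 2 - δ) η else 0)
      ≤ ∑' m, (if jap x ≤ c * (4 * L) * 4 ^ m then E * dy (1 / 2 - δ) m else 0)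
        * ‖V η * (1 - P.lowS m η)‖ₑ ^ 2 := by
    intro η
    split_ifs with hx
    swap
    · exact bot_le
    -- Choose the scale just below the first n with 1 + η² ≤ L4^n: the low symbol still vanishes at
    -- η, so tail m contains V(η) in full, and the weight loses only a factor 4. If that n is 0,
    -- take m = 0, where the low symbol is identically zero.
    obtain ⟨m, hm0, hm⟩ : ∃ m, P.lowR m η = 0 ∧ jap η ≤ 4 * L * 4 ^ m := by
      have hex : ∃ n : ℕ, jap η ≤ L * 4 ^ n := by
        obtain ⟨n, hn⟩ := pow_unbounded_of_one_lt (jap η) (by norm_num : (1 : ℝ) < 4)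
        exact ⟨n, hn.le.trans (le_mul_of_one_le_left (by positivity) hL1)⟩
      classical
      rcases hn : Nat.find hex with _ | n
      · refine ⟨0, P.lowR_zero η, ?_⟩
        have := Nat.find_spec hex
        rw [hn] at this
        linarith [pow_pos (show (0 : ℝ) < 4 by norm_num) 0]
      · refine ⟨n, ?_, ?_⟩
        · by_contra hne
          exact Nat.find_min hex (m := n) (by omega) (hL n η hne)
        · have := Nat.find_spec hex
          rw [hn, pow_succ] at this
          linarith
    refine le_trans ?_ (ENNReal.le_tsum m)
    have hxm : jap x ≤ c * (4 * L) * 4 ^ m := by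
      rw [mul_assoc]
      exact hx.trans (mul_le_mul_of_nonneg_left hm hc.le)
    rw [if_pos hxm, P.lowS_apply, hm0]
    simp only [Complex.ofReal_zero, sub_zero, mul_one]
    rw [mul_comm]
    gcongr
    rw [jw, hE', dy, ← ENNReal.ofReal_mul (by positivity), ← Real.mul_rpow (by positivity)
      (by positivity)]
    exact ENNReal.ofReal_le_ofReal (Real.rpow_le_rpow (jap_pos η).le hm (by linarith))
  calc _ ≤ ∫⁻ η, ∑' m, (if jap x ≤ c * (4 * L) * 4 ^ m then E * dy (1 / 2 - δ) m else 0)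
        * ‖V η * (1 - P.lowS m η)‖ₑ ^ 2 := lintegral_mono hpt
    _ = ∑' m, (if jap x ≤ c * (4 * L) * 4 ^ m then E * dy (1 / 2 - δ) m else 0)
        * ∫⁻ η, ‖V η * (1 - P.lowS m η)‖ₑ ^ 2 := by
        have hm (m : ℕ) : Measurable fun η ↦ ‖V η * (1 - P.lowS m η)‖ₑ ^ 2 :=
          ((hV.sub_sum_block P m).measurable.enorm).pow_const 2
        rw [lintegral_tsum fun m ↦ ((hm m).const_mul _).aemeasurable]
        exact tsum_congr fun m ↦ lintegral_const_mul _ (hm m)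
    _ ≤ ∑' m, (A * N) ^ 2 * E * (if jap x ≤ c * (4 * L) * 4 ^ m then dy (-δ) m else 0) := by
        refine ENNReal.tsum_le_tsum fun m ↦ ?_
        split_ifs
        · calc _ ≤ E * dy (1 / 2 - δ) m * ((A * N) ^ 2 * dy (-(1 / 2)) m) := by
                gcongr
                exact htail m
            _ = _ := by
              rw [show -δ = (1 / 2 - δ) + -(1 / 2) by ring, dy_add]
              ring
        · simp
    _ ≤ (A * N) ^ 2 * E * (D * jw (-δ) x) := by
        rw [ENNReal.tsum_mul_left]
        gcongr
        exact hD x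
    _ = K * N ^ 2 * jw (-δ) x := by rw [hK]; push_cast; ring
    _ ≤ ((K + 1 : ℝ≥0) * N) ^ 2 * jw (-δ) x := by
        rw [mul_pow]
        gcongr
        rw [← ENNReal.coe_pow, ENNReal.coe_le_coe]
        have : 0 ≤ K := zero_le
        nlinarith

/-- Split ⟨x⟩^{-p} = ⟨x⟩^δ⟨x⟩^{-(p+δ)} and, with y = x + η, ⟨y⟩^p = ⟨y⟩^{1/2-δ}⟨y⟩^{p+δ-1/2}. The
factor ⟨y⟩^{1/2-δ} is moved to η, where the tail hypothesis exactly cancels ⟨x⟩^δ. The remaining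
powers form `lowKernel` with exponent p + δ < 1/2, and Cauchy–Schwarz in both variables concludes.
-/
theorem exists_lintegral_tail_le {p δ c : ℝ} (hδ : p + δ < 1 / 2) (hδ' : δ ≤ 1 / 2) (hc : 0 < c) :
    ∃ C : ℝ≥0, ∀ (G : ℝ≥0∞) (g a b : ℝ → ℝ≥0∞), Measurable g → Measurable a → Measurable b →
      (∀ x, ∫⁻ η, (if jap x ≤ c * jap η then g η ^ 2 * jw (1 / 2 - δ) η else 0)
        ≤ G ^ 2 * jw (-δ) x) →
      ∫⁻ q : ℝ × ℝ, (if jap q.1 ≤ jap (q.1 + q.2) ∧ jap (q.1 + q.2) ≤ c * jap q.2 then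
        a q.1 * g q.2 * b (q.1 + q.2) * (jw (-(p / 2)) q.1 * jw (p / 2) (q.1 + q.2)) else 0)
      ≤ C * G * (n2 volume a * n2 volume b) := by
  obtain ⟨C, hC⟩ := exists_lowKernel_sq_le hδ
  set E : ℝ≥0 := (c ^ (1 / 4 - δ / 2)).toNNReal with hE
  refine ⟨E * C, fun G g a b hg ha hb hG ↦ ?_⟩
  set A : ℝ × ℝ → ℝ≥0∞ := fun q ↦ if jap q.1 ≤ c * jap q.2 then
    a q.1 * jw (δ / 2) q.1 * (g q.2 * jw (1 / 4 - δ / 2) q.2) else 0 with hA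
  set B : ℝ × ℝ → ℝ≥0∞ := fun q ↦ b q.2 * lowKernel (p + δ) q.1 q.2 with hB
  have hjm := continuous_jap.measurable
  have hAm : Measurable A := by
    refine Measurable.ite (measurableSet_le (by fun_prop) (by fun_prop)) ?_ measurable_const
    have h1 : Measurable fun q : ℝ × ℝ ↦ jw (δ / 2) q.1 := (measurable_jw _).comp measurable_fst
    have h2 : Measurable fun q : ℝ × ℝ ↦ jw (1 / 4 - δ / 2) q.2 :=
      (measurable_jw _).comp measurable_snd
    exact ((ha.comp measurable_fst).mul h1).mul ((hg.comp measurable_snd).mul h2)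
  have hBm : Measurable B := (hb.comp measurable_snd).mul (measurable_lowKernel _)
  have hAn : n2 volume A ≤ G * n2 volume a := by
    refine n2_le_of_sq_le ?_
    rw [Measure.volume_eq_prod, lintegral_prod _ (hAm.pow_const 2).aemeasurable, mul_pow, n2_sq,
      ← lintegral_const_mul _ (ha.pow_const 2)]
    refine lintegral_mono fun x ↦ ?_
    calc ∫⁻ η, A (x, η) ^ 2 = ∫⁻ η, a x ^ 2 * jw δ x *
          (if jap x ≤ c * jap η then g η ^ 2 * jw (1 / 2 - δ) η else 0) := by
          refine lintegral_congr fun η ↦ ?_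
          simp only [hA]
          split_ifs
          · rw [mul_pow, mul_pow, mul_pow, jw_sq, jw_sq]
            ring_nf
          · simp
      _ = a x ^ 2 * jw δ x *
          ∫⁻ η, (if jap x ≤ c * jap η then g η ^ 2 * jw (1 / 2 - δ) η else 0) := by
          refine lintegral_const_mul _ ?_
          exact Measurable.ite (measurableSet_le (by fun_prop) (by fun_prop))
            ((hg.pow_const 2).mul (measurable_jw _)) measurable_const
      _ ≤ a x ^ 2 * jw δ x * (G ^ 2 * jw (-δ) x) := by
          gcongr
          exact hG x
      _ = G ^ 2 * a x ^ 2 * (jw (-δ) x * jw δ x) := by ring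
      _ = _ := by rw [jw_neg_mul, mul_one]
  have hBn : n2 volume (fun q : ℝ × ℝ ↦ B (q.1, q.1 + q.2)) ≤ C * n2 volume b := by
    rw [n2_comp_measurePreserving measurePreserving_fst_add hBm]
    exact n2_prod_kernel_le hb (measurable_lowKernel _) hC
  have hBm' : Measurable fun q : ℝ × ℝ ↦ B (q.1, q.1 + q.2) :=
    hBm.comp measurePreserving_fst_add.measurable
  have hpt : ∀ q : ℝ × ℝ, (if jap q.1 ≤ jap (q.1 + q.2) ∧ jap (q.1 + q.2) ≤ c * jap q.2 then
      a q.1 * g q.2 * b (q.1 + q.2) * (jw (-(p / 2)) q.1 * jw (p / 2) (q.1 + q.2)) else 0)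
      ≤ E * (A q * B (q.1, q.1 + q.2)) := by
    rintro ⟨x, η⟩
    dsimp only
    split_ifs with hx
    swap
    · exact bot_le
    simp only [hA, hB, lowKernel, if_pos hx.1, if_pos (hx.1.trans hx.2)]
    have e1 : jw (-(p / 2)) x = jw (δ / 2) x * jw (-((p + δ) / 2)) x := by
      rw [← jw_add]; ring_nf
    have e2 : jw (p / 2) (x + η)
        = jw (1 / 4 - δ / 2) (x + η) * jw (-((1 / 2 - (p + δ)) / 2)) (x + η) := by
      rw [← jw_add]; ring_nf
    rw [e1, e2]
    calc _ ≤ a x * g η * b (x + η) * (jw (δ / 2) x * jw (-((p + δ) / 2)) x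
          * (E * jw (1 / 4 - δ / 2) η * jw (-((1 / 2 - (p + δ)) / 2)) (x + η))) := by
          gcongr
          exact jw_le_of_nonneg hc.le hx.2 (by linarith)
      _ = _ := by ring
  calc _ ≤ ∫⁻ q : ℝ × ℝ, E * (A q * B (q.1, q.1 + q.2)) := lintegral_mono hpt
    _ = E * ∫⁻ q : ℝ × ℝ, A q * B (q.1, q.1 + q.2) := lintegral_const_mul _ (hAm.mul hBm')
    _ ≤ E * ((G * n2 volume a) * (C * n2 volume b)) := by
        gcongr
        exact (lintegral_mul_le_n2 hAm.aemeasurable hBm'.aemeasurable).trans (mul_le_mul' hAn hBn)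
    _ = _ := by push_cast; ring

end ProductLaws

end

noncomputable section

namespace ProductLaws

/-! ### Trilinear estimates for the critical Besov space -/

theorem measurePreserving_add_neg :
    MeasurePreserving (fun p : ℝ × ℝ ↦ (p.1 + p.2, -p.2)) volume volume :=
  ((MeasurePreserving.id (volume : Measure ℝ)).prod
    (Measure.measurePreserving_neg (volume : Measure ℝ))).comp measurePreserving_add_snd

namespace DyadicPartition

variable {P : DyadicPartition} {a b : ℝ} {M : ℕ}

/-- When the blocks of u are not much higher than those of v, both ξ and ξ+η are dominated by η. If
⟨ξ⟩ ≤ ⟨ξ+η⟩, the tail estimate applies with p = s. Otherwise u and ψ exchange roles and it applies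
with p = -s. Boundedness of v is not needed for this part. -/
theorem Scales.exists_dblSum_besov_le (h : P.Scales a b M) (P₀ : DyadicPartition) {s : ℝ}
    (hs : |s| < 1 / 2) : ∃ C : ℝ≥0, ∀ v : 𝓢'(ℝ, ℂ), besovNorm P₀ (1 / 2) 2 ∞ v < ∞ →
      ∀ (u : 𝓢'(ℝ, ℂ)) (U : ℝ → ℂ), FourierRep u U → ∀ ψ : 𝓢(ℝ, ℂ),
        dblSum P (fun j k ↦ j ≤ k + M) u v ψ ≤ C * besovNorm P₀ (1 / 2) 2 ∞ v
          * wN s (fun ξ ↦ ‖U ξ‖ₑ) * wN (-s) (fun ξ ↦ ‖𝓕⁻ ψ ξ‖ₑ) := by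
  obtain ⟨L, hL1, hL, -, -⟩ := h.exists_const
  set c₀ : ℝ := L ^ 2 * 4 ^ M with hc₀
  have hc₀1 : 1 ≤ c₀ := one_le_mul_of_one_le_of_one_le (one_le_pow₀ hL1)
    (one_le_pow₀ (by norm_num))
  set c : ℝ := 4 * c₀ with hc
  have hcpos : 0 < c := by positivity
  -- This choice makes δ positive and both s + δ and -s + δ smaller than 1/2.
  set δ : ℝ := (1 / 2 - |s|) / 2 with hδ
  have hs1 := le_abs_self s
  have hs2 := neg_le_abs s
  have hs0 := abs_nonneg s
  have hδ' : δ ≤ 1 / 2 := by rw [hδ]; linarith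
  obtain ⟨K, hK⟩ := exists_lintegral_tail_besov_le P₀ (δ := δ) (by rw [hδ]; linarith) hδ' hcpos
  obtain ⟨C₁, hC₁⟩ := exists_lintegral_tail_le (p := s) (δ := δ) (by rw [hδ]; linarith) hδ' hcpos
  obtain ⟨C₂, hC₂⟩ := exists_lintegral_tail_le (p := -s) (δ := δ) (by rw [hδ]; linarith) hδ' hcpos
  refine ⟨(C₁ + C₂) * K, fun v hv u U hU ψ ↦ ?_⟩
  obtain ⟨V, -, hV, hVK⟩ := hK v hv
  set N := besovNorm P₀ (1 / 2) 2 ∞ v with hN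
  have hjm := continuous_jap.measurable
  set F : ℝ → ℝ≥0∞ := fun ξ ↦ jw (s / 2) ξ * ‖U ξ‖ₑ with hF
  set H : ℝ → ℝ≥0∞ := fun ξ ↦ jw (-s / 2) ξ * ‖𝓕⁻ ψ ξ‖ₑ with hH
  have hFm : Measurable F := (measurable_jw _).mul hU.measurable.enorm
  have hHm : Measurable H := (measurable_jw _).mul (measurable_schwartz (𝓕⁻ ψ)).enorm
  have hgm : Measurable fun η ↦ ‖V η‖ₑ := hV.measurable.enorm
  set I₁ : ℝ × ℝ → ℝ≥0∞ := fun q ↦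
    if jap q.1 ≤ jap (q.1 + q.2) ∧ jap (q.1 + q.2) ≤ c * jap q.2 then
      F q.1 * ‖V q.2‖ₑ * H (q.1 + q.2) * (jw (-(s / 2)) q.1 * jw (s / 2) (q.1 + q.2)) else 0
    with hI₁
  set I₂ : ℝ × ℝ → ℝ≥0∞ := fun q ↦
    if jap q.1 ≤ jap (q.1 + q.2) ∧ jap (q.1 + q.2) ≤ c * jap q.2 then
      H q.1 * ‖V (-q.2)‖ₑ * F (q.1 + q.2) * (jw (-(-s / 2)) q.1 * jw (-s / 2) (q.1 + q.2)) else 0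
    with hI₂
  have hset : MeasurableSet {q : ℝ × ℝ | jap q.1 ≤ jap (q.1 + q.2) ∧
      jap (q.1 + q.2) ≤ c * jap q.2} := by
    refine MeasurableSet.inter (s₁ := {q : ℝ × ℝ | jap q.1 ≤ jap (q.1 + q.2)})
      (s₂ := {q : ℝ × ℝ | jap (q.1 + q.2) ≤ c * jap q.2}) ?_ ?_ <;>
    exact measurableSet_le (by fun_prop) (by fun_prop)
  have hj1 (r : ℝ) : Measurable fun q : ℝ × ℝ ↦ jw r q.1 := (measurable_jw r).comp measurable_fst
  have hj2 (r : ℝ) : Measurable fun q : ℝ × ℝ ↦ jw r (q.1 + q.2) :=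
    (measurable_jw r).comp (measurable_fst.add measurable_snd)
  have hI₁m : Measurable I₁ := by
    refine Measurable.ite hset ?_ measurable_const
    have h1 := hj1 (-(s / 2))
    have h2 := hj2 (s / 2)
    have h3 : Measurable fun q : ℝ × ℝ ↦ ‖V q.2‖ₑ := hgm.comp measurable_snd
    fun_prop
  have hI₂m : Measurable I₂ := by
    refine Measurable.ite hset ?_ measurable_const
    have h1 := hj1 (-(-s / 2))
    have h2 := hj2 (-s / 2)
    have h3 : Measurable fun q : ℝ × ℝ ↦ ‖V (-q.2)‖ₑ := hgm.comp measurable_snd.neg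
    fun_prop
  have hR : ∀ j k ξ η, j ≤ k + M → P.symR j ξ ≠ 0 → P.symR k η ≠ 0 →
      (ξ, η) ∈ {q : ℝ × ℝ | jap q.1 ≤ c₀ * jap q.2} := by
    intro j k ξ η hjk hξ hη
    change jap ξ ≤ c₀ * jap η
    calc jap ξ ≤ L * 4 ^ j := (hL j ξ hξ).1
      _ ≤ L * 4 ^ (k + M) := by gcongr; norm_num
      _ = L * 4 ^ M * 4 ^ k := by rw [pow_add]; ring
      _ ≤ L * 4 ^ M * (L * jap η) := by gcongr; exact (hL k η hη).2
      _ = _ := by rw [hc₀]; ring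
  refine (hU.dblSum_le P hV hR ψ).trans ?_
  rw [← lintegral_indicator (measurableSet_le (by fun_prop) (by fun_prop))]
  have hpt : ∀ q : ℝ × ℝ, {q : ℝ × ℝ | jap q.1 ≤ c₀ * jap q.2}.indicator
      (fun p ↦ ‖U p.1‖ₑ * ‖V p.2‖ₑ * ‖𝓕⁻ ψ (p.1 + p.2)‖ₑ) q
      ≤ I₁ q + I₂ (q.1 + q.2, -q.2) := by
    rintro ⟨ξ, η⟩
    simp only [Set.indicator_apply, Set.mem_ofPred_eq]
    split_ifs with hq
    swap
    · exact bot_le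
    have hη := jap_pos η
    have hηc : jap η ≤ c₀ * jap η := le_mul_of_one_le_left hη.le hc₀1
    have hsum : jap (ξ + η) ≤ c * jap η := by
      refine (jap_add_le ξ η).trans ?_
      rw [hc, mul_assoc]
      gcongr
      exact max_le hq hηc
    have e (t x : ℝ) (z : ℝ≥0∞) : jw (-t) x * (jw t x * z) = z := by
      rw [← mul_assoc, jw_neg_mul, one_mul]
    have e' (t x : ℝ) (z : ℝ≥0∞) : jw t x * (jw (-t) x * z) = z := by
      rw [← mul_assoc, mul_comm (jw t x), jw_neg_mul, one_mul]
    -- The second case is brought to the form of the first by the measure preserving map (ξ, η) ↦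
    -- (ξ+η, -η), under which the sum of the new variables is ξ.
    rcases le_total (jap ξ) (jap (ξ + η)) with hle | hle
    · refine le_trans (le_of_eq ?_) le_self_add
      simp only [hI₁, if_pos (And.intro hle hsum), hF, hH]
      calc _ = (jw (-(s / 2)) ξ * (jw (s / 2) ξ * ‖U ξ‖ₑ)) * ‖V η‖ₑ
            * (jw (s / 2) (ξ + η) * (jw (-(s / 2)) (ξ + η) * ‖𝓕⁻ ψ (ξ + η)‖ₑ)) := by rw [e, e']
        _ = _ := by rw [neg_div]; ring
    · refine le_trans (le_of_eq ?_) le_add_self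
      have h2 : jap (ξ + η) ≤ jap (ξ + η + -η) ∧ jap (ξ + η + -η) ≤ c * jap (-η) := by
        rw [add_neg_cancel_right, jap_neg]
        exact ⟨hle, hq.trans (by rw [hc]; nlinarith [mul_pos (zero_lt_one.trans_le hc₀1) hη])⟩
      simp only [hI₂, if_pos h2, hF, hH, add_neg_cancel_right, neg_neg]
      calc _ = (jw (-(s / 2)) ξ * (jw (s / 2) ξ * ‖U ξ‖ₑ)) * ‖V η‖ₑ
            * (jw (s / 2) (ξ + η) * (jw (-(s / 2)) (ξ + η) * ‖𝓕⁻ ψ (ξ + η)‖ₑ)) := by rw [e, e']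
        _ = _ := by rw [neg_div, neg_neg]; ring
  have hVn : ∀ x, ∫⁻ η, (if jap x ≤ c * jap η then ‖V (-η)‖ₑ ^ 2 * jw (1 / 2 - δ) η else 0)
      ≤ (K * N) ^ 2 * jw (-δ) x := by
    intro x
    refine le_trans (le_of_eq ?_) (hVK x)
    rw [← (Measure.measurePreserving_neg (volume : Measure ℝ)).lintegral_comp
      (f := fun η ↦ if jap x ≤ c * jap η then ‖V η‖ₑ ^ 2 * jw (1 / 2 - δ) η else 0)]
    · simp only [jap_neg, jw_even]
    · exact Measurable.ite (measurableSet_le (by fun_prop) (by fun_prop))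
        ((hgm.pow_const 2).mul (measurable_jw _)) measurable_const
  have b₁ : ∫⁻ q, I₁ q ≤ C₁ * (K * N) * (n2 volume F * n2 volume H) :=
    hC₁ (K * N) (fun η ↦ ‖V η‖ₑ) F H hgm hFm hHm hVK
  have b₂ : ∫⁻ q, I₂ q ≤ C₂ * (K * N) * (n2 volume H * n2 volume F) :=
    hC₂ (K * N) (fun η ↦ ‖V (-η)‖ₑ) H F (hgm.comp measurable_neg) hHm hFm hVn
  have b₂' : ∫⁻ q : ℝ × ℝ, I₂ (q.1 + q.2, -q.2) = ∫⁻ q, I₂ q :=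
    measurePreserving_add_neg.lintegral_comp hI₂m
  calc _ ≤ ∫⁻ q : ℝ × ℝ, (I₁ q + I₂ (q.1 + q.2, -q.2)) := lintegral_mono hpt
    _ = (∫⁻ q, I₁ q) + ∫⁻ q, I₂ q := by rw [lintegral_add_left hI₁m, b₂']
    _ ≤ C₁ * (K * N) * (n2 volume F * n2 volume H)
        + C₂ * (K * N) * (n2 volume H * n2 volume F) := add_le_add b₁ b₂
    _ = ((C₁ + C₂) * K : ℝ≥0) * N * n2 volume F * n2 volume H := by push_cast; ring

/-- The paraproduct by g, where g carries the low frequency, is bounded through L^∞. The paraproduct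
by u and the three near parts lie in the region of `exists_dblSum_besov_le`, hence 4A. -/
theorem Scales.exists_bony_besov_le (h : P.Scales a b M) (P₀ : DyadicPartition) {s : ℝ}
    (hs : |s| < 1 / 2) : ∃ C : ℝ≥0, ∀ g : Lp ℂ ∞ (volume : Measure ℝ),
      besovNorm P₀ (1 / 2) 2 ∞ (g : 𝓢'(ℝ, ℂ)) < ∞ →
      ∀ (u : 𝓢'(ℝ, ℂ)) (U : ℝ → ℂ), FourierRep u U → ∀ ψ : 𝓢(ℝ, ℂ),
        farSum P M u g ψ + farSum P M g u ψ + 3 * nearSum P M u g ψ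
          ≤ C * wN s (fun ξ ↦ ‖U ξ‖ₑ) * (besovNorm P₀ (1 / 2) 2 ∞ (g : 𝓢'(ℝ, ℂ)) + ‖g‖ₑ)
            * wN (-s) (fun ξ ↦ ‖𝓕⁻ ψ ξ‖ₑ) := by
  obtain ⟨A, hA⟩ := h.exists_dblSum_besov_le P₀ hs
  obtain ⟨B, hB⟩ := h.exists_farSum_Linfty_le s
  refine ⟨4 * A + B, fun g hg u U hU ψ ↦ ?_⟩
  set N := besovNorm P₀ (1 / 2) 2 ∞ (g : 𝓢'(ℝ, ℂ))
  set X := wN s (fun ξ ↦ ‖U ξ‖ₑ)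
  set Z := wN (-s) (fun ξ ↦ ‖𝓕⁻ ψ ξ‖ₑ)
  have h1 := hA g hg u U hU ψ
  have h2 := (farSum_le_dblSum (M := M) hU.regular (regular_Linfty g) (P := P)
    (S := fun j k ↦ j ≤ k + M) (fun j k hjk ↦ by omega) ψ).trans h1
  have h3 := (nearSum_le_dblSum (P := P) (M := M) (u := u) (v := (g : 𝓢'(ℝ, ℂ)))
    (S := fun j k ↦ j ≤ k + M) (fun j k hjk ↦ hjk) ψ).trans h1
  calc _ ≤ A * N * X * Z + B * ‖g‖ₑ * X * Z + 3 * (A * N * X * Z) := by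
        gcongr
        exact hB g u U hU ψ
    _ = 4 * A * N * X * Z + B * ‖g‖ₑ * X * Z := by ring
    _ ≤ (4 * A + B) * (N + ‖g‖ₑ) * X * Z := by
        rw [← add_mul, ← add_mul]
        gcongr
        rw [add_mul]
        gcongr
        · exact le_self_add
        · exact le_add_self
    _ = _ := by push_cast; ring

end DyadicPartition

/-- Cutting the frequencies at |ξ| ≤ n makes the weight ⟨ξ⟩^s harmless for either sign of s, so the
retained part is in L². These parts approximate u in H^s. -/
theorem FourierRep.exists_L2_sub {s : ℝ} {u : 𝓢'(ℝ, ℂ)} {U : ℝ → ℂ} (hU : FourierRep u U)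
    (h : wN s (fun ξ ↦ ‖U ξ‖ₑ) < ∞) (n : ℕ) : ∃ f : Lp ℂ 2 (volume : Measure ℝ),
      FourierRep (u - f) ({ξ | (n : ℝ) < |ξ|}.indicator U) := by
  have hm : MeasurableSet {ξ : ℝ | (n : ℝ) < |ξ|} := measurableSet_lt (by fun_prop) (by fun_prop)
  set W := {ξ : ℝ | (n : ℝ) < |ξ|}ᶜ.indicator U with hW
  have hWm : Measurable W := hU.measurable.indicator hm.compl
  have hUW : ∀ ξ, {ξ : ℝ | (n : ℝ) < |ξ|}.indicator U ξ = U ξ - W ξ := fun ξ ↦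
    eq_sub_of_add_eq (congrFun (Set.indicator_self_add_compl _ U) ξ)
  have hW2 : MemLp W 2 volume := by
    refine ⟨hWm.aestronglyMeasurable, ?_⟩
    rw [← n2_eq_eLpNorm]
    set c : ℝ := 1 + (n : ℝ) ^ 2 with hc
    have hc1 : 1 ≤ c := by rw [hc]; nlinarith [sq_nonneg (n : ℝ)]
    refine lt_of_le_of_lt ((n2_mono (g := fun ξ ↦ ENNReal.ofReal (c ^ |-(s / 2)|) *
      (jw (s / 2) ξ * ‖U ξ‖ₑ)) fun ξ ↦ ?_).trans_eq (n2_const_mul ENNReal.ofReal_ne_top _))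
      (ENNReal.mul_lt_top ENNReal.ofReal_lt_top h)
    · by_cases hξ : (n : ℝ) < |ξ|
      · simp [hW, hξ]
      · rw [hW, Set.indicator_of_mem (by simpa using hξ)]
        have h0 : jap 0 = 1 := by simp [jap]
        have hξ' : jap ξ ≤ c * jap 0 := by
          rw [h0, mul_one, hc, jap, ← sq_abs]
          gcongr
          exact not_lt.1 hξ
        have h1 := jw_le_of_comparable hc1 hξ' (by rw [h0]; nlinarith [one_le_jap ξ]) (-(s / 2))
        rw [show jw (-(s / 2)) 0 = 1 by simp [jw, h0], mul_one] at h1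
        calc ‖U ξ‖ₑ = jw (-(s / 2)) ξ * jw (s / 2) ξ * ‖U ξ‖ₑ := by rw [jw_neg_mul, one_mul]
          _ ≤ _ := by
            rw [mul_assoc]
            gcongr
  refine ⟨𝓕⁻ (hW2.toLp W), hU.measurable.indicator hm, fun φ ↦ ?_, fun φ ↦ ?_⟩
  · refine ((hU.integrable φ).indicator hm).congr (ae_of_all _ fun ξ ↦ ?_)
    simp only [Set.indicator_apply]
    split_ifs <;> simp
  · have hWi : Integrable fun ξ ↦ W ξ * 𝓕⁻ φ ξ := by
      refine ((hU.integrable (𝓕⁻ φ)).indicator hm.compl).congr (ae_of_all _ fun ξ ↦ ?_)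
      simp only [hW, Set.indicator_apply]
      split_ifs <;> simp
    change u φ - ((𝓕⁻ (hW2.toLp W) : Lp ℂ 2 (volume : Measure ℝ)) : 𝓢'(ℝ, ℂ)) φ = _
    rw [toTemperedDistribution_fourierInv_apply, hU.rep, ← integral_sub (hU.integrable _) hWi]
    simp only [hUW, sub_mul]

theorem tendsto_wN_indicator {s : ℝ} {U : ℝ → ℂ} (hU : Measurable U)
    (h : wN s (fun ξ ↦ ‖U ξ‖ₑ) < ∞) :
    Filter.Tendsto (fun n : ℕ ↦ wN s (fun ξ ↦ ‖{ξ | (n : ℝ) < |ξ|}.indicator U ξ‖ₑ))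
      Filter.atTop (nhds 0) := by
  have hm (n : ℕ) : MeasurableSet {ξ : ℝ | (n : ℝ) < |ξ|} :=
    measurableSet_lt (by fun_prop) (by fun_prop)
  have hfin : ∫⁻ ξ, (jw (s / 2) ξ * ‖U ξ‖ₑ) ^ 2 ≠ ∞ := by
    rw [← n2_sq]
    exact ENNReal.pow_ne_top h.ne
  have hlim : Filter.Tendsto (fun n : ℕ ↦
      ∫⁻ ξ, (jw (s / 2) ξ * ‖{ξ | (n : ℝ) < |ξ|}.indicator U ξ‖ₑ) ^ 2) Filter.atTop
      (nhds (∫⁻ _ : ℝ, 0)) := by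
    refine tendsto_lintegral_of_dominated_convergence _ (fun n ↦
      ((measurable_jw _).mul (hU.indicator (hm n)).enorm).pow_const 2) (fun n ↦ ae_of_all _ fun ξ ↦ ?_)
      hfin (ae_of_all _ fun ξ ↦ ?_)
    · refine pow_le_pow_left₀ bot_le (mul_le_mul_right ?_ _) 2
      simp only [Set.indicator_apply]
      split_ifs <;> simp
    · refine tendsto_const_nhds.congr' ?_
      filter_upwards [Filter.eventually_ge_atTop ⌈|ξ|⌉₊] with n hn
      have : ¬ (n : ℝ) < |ξ| := not_lt.2 (Nat.ceil_le.1 hn)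
      simp [this]
  have := ((ENNReal.continuous_rpow_const (y := 1 / 2)).tendsto _).comp hlim
  simpa [wN, n2, Function.comp_def] using this

/-- For s < 0 the factor u need not be a function, and the convolution integral is not known to
converge absolutely. Independence of the partition comes by approximation instead: products of L²
truncations of u with g do not depend on it, and for every partition they converge to the product.
-/
theorem productContinuous_sobolev_besov (P : DyadicPartition) {s : ℝ} (hs : |s| < 1 / 2) :
    ProductContinuous (SobolevSpace s) (sobolevNorm s)
      (BesovSpace P (1 / 2) 2 ∞ ⊓ LpSpace ∞)
      (fun v ↦ besovNorm P (1 / 2) 2 ∞ v + normLp ∞ v)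
      (SobolevSpace s) (sobolevNorm s) := by
  obtain ⟨a, b, M, h⟩ := P.exists_scales
  obtain ⟨C, hC⟩ := h.exists_bony_besov_le P hs
  refine productContinuous_of_forall_exists P (fun u hu ↦ ?_) (fun v hv ↦ ?_) C ?_
  · obtain ⟨U, hU, -⟩ := exists_fourierRep hu
    exact hU.regular
  · obtain ⟨g, rfl⟩ := (normLp_lt_top_iff ∞).1 hv.2
    exact regular_Linfty g
  rintro u hu v ⟨hvB, hvL⟩
  obtain ⟨U, hU, hUn⟩ := exists_fourierRep hu
  obtain ⟨g, rfl⟩ := (normLp_lt_top_iff ∞).1 hvL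
  have hus : sobolevNorm s u < ∞ := mem_sobolevSpace_iff.1 hu
  have hvn : besovNorm P (1 / 2) 2 ∞ (g : 𝓢'(ℝ, ℂ)) < ∞ := hvB
  set G := besovNorm P (1 / 2) 2 ∞ (g : 𝓢'(ℝ, ℂ)) + ‖g‖ₑ with hG
  have hGt : G ≠ ∞ := ENNReal.add_ne_top.2 ⟨hvn.ne, enorm_ne_top⟩
  obtain ⟨t, ht⟩ : ∃ t : Lp ℂ 2 (volume : Measure ℝ), (g : 𝓢'(ℝ, ℂ)) = t := by
    obtain ⟨A, hA⟩ := exists_tail_of_besovNorm P (σ := 1 / 2) (by norm_num) 2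
    obtain ⟨t, ht, -⟩ := hA g hvn 0
    exact ⟨t, by simpa using ht⟩
  have hg2 : (g : 𝓢'(ℝ, ℂ)) ∈ SobolevSpace 0 := ht ▸ mem_sobolevSpace_zero t
  choose f hf using hU.exists_L2_sub (hUn ▸ hus)
  choose w hw using fun n ↦ exists_isProductAt_L2 P (mem_sobolevSpace_zero (f n)) hg2
  have hex : ∀ P', ∃ w', IsProductAt P' u g w' ∧ ∀ ψ,
      Filter.Tendsto (fun n ↦ w n ψ) Filter.atTop (nhds (w' ψ)) := by
    intro P'
    obtain ⟨a', b', M', h'⟩ := P'.exists_scales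
    obtain ⟨C', hC'⟩ := h'.exists_bony_besov_le P hs
    have hfin : C' * sobolevNorm s u * G ≠ ∞ :=
      ENNReal.mul_ne_top (ENNReal.mul_ne_top ENNReal.coe_ne_top hus.ne) hGt
    have h2 := h'.two_le
    obtain ⟨w', hw'⟩ := exists_isProductAt hU.regular (regular_Linfty g) (P := P') (M := M')
      (by omega) (m := -s) (C := (C' * sobolevNorm s u * G).toNNReal) fun ψ ↦ by
        rw [ENNReal.coe_toNNReal hfin, ← hUn]
        exact hC' g hvn u U hU ψ
    refine ⟨w', hw', fun ψ ↦ ?_⟩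
    -- By linearity the error is itself a product, of the high frequency part of u with g, so the
    -- same Bony estimate bounds it by a norm that tends to zero.
    have hsub : ∀ n, IsProductAt P' (u - f n) g (w' - w n) := fun n ↦ by
      have := hw'.add_left hU.regular ((regular_L2 (f n)).smul (-1))
        ((hw n P').smul_left (regular_L2 (f n)) (-1))
      have e (x : 𝓢'(ℝ, ℂ)) : (-1 : ℂ) • x = -x := by
        ext φ
        exact neg_one_mul (x φ)
      rwa [e, e, ← sub_eq_add_neg, ← sub_eq_add_neg] at this
    have hbd : ∀ n, ‖w' ψ - w n ψ‖ₑ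
        ≤ C' * wN s (fun ξ ↦ ‖{ξ | (n : ℝ) < |ξ|}.indicator U ξ‖ₑ) * G
          * wN (-s) (fun ξ ↦ ‖𝓕⁻ ψ ξ‖ₑ) := fun n ↦
      ((hsub n).enorm_apply_le (hf n).regular (regular_Linfty g) (show 1 ≤ M' by omega) ψ).trans
        (hC' g hvn _ _ (hf n) ψ)
    have hlim : Filter.Tendsto (fun n : ℕ ↦ C' * wN s (fun ξ ↦ ‖{ξ | (n : ℝ) < |ξ|}.indicator U ξ‖ₑ)
        * G * wN (-s) (fun ξ ↦ ‖𝓕⁻ ψ ξ‖ₑ)) Filter.atTop (nhds 0) := by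
      have h0 := tendsto_wN_indicator hU.measurable (hUn ▸ hus)
      have h1 := ENNReal.Tendsto.const_mul h0 (a := (C' : ℝ≥0∞)) (Or.inr ENNReal.coe_ne_top)
      have h3 := ENNReal.Tendsto.mul_const h1 (b := G) (Or.inr hGt)
      have h4 := ENNReal.Tendsto.mul_const h3 (b := wN (-s) (fun ξ ↦ ‖𝓕⁻ ψ ξ‖ₑ))
        (Or.inr (wN_schwartz_lt_top _ (𝓕⁻ ψ)).ne)
      simpa using h4
    rw [tendsto_iff_edist_tendsto_0]
    refine tendsto_of_tendsto_of_tendsto_of_le_of_le tendsto_const_nhds hlim (fun _ ↦ bot_le)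
      fun n ↦ ?_
    dsimp only
    rw [edist_comm, edist_eq_enorm_sub]
    exact hbd n
  choose w' hw' hlim using hex
  have hall : ∀ P', IsProductAt P' u g (w' P) := fun P' ↦ by
    have : w' P = w' P' := by
      ext ψ
      exact tendsto_nhds_unique (hlim P ψ) (hlim P' ψ)
    rw [this]
    exact hw' P'
  have hfin : C * sobolevNorm s u * G ≠ ∞ :=
    ENNReal.mul_ne_top (ENNReal.mul_ne_top ENNReal.coe_ne_top hus.ne) hGt
  have h2 := h.two_le
  obtain ⟨h3, h4⟩ := sobolevNorm_le_of_bound hfin fun ψ ↦ by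
    refine ((hw' P).enorm_apply_le hU.regular (regular_Linfty g) (show 1 ≤ M by omega) ψ).trans ?_
    rw [← hUn]
    exact hC g hvn u U hU ψ
  refine ⟨w' P, h3, hall, (hw' P).agreesWithPointwise, ?_⟩
  rwa [normLp_coe]

end ProductLaws

end

theorem mainTheorem5 (P : ProductLaws.DyadicPartition) :
    -- a) `H^s × (B^{1/2}_{2,∞} ∩ L^∞) → H^s`
    (∀ s : ℝ, |s| < 1 / 2 →
      ProductLaws.ProductContinuous
        (ProductLaws.SobolevSpace s) (ProductLaws.sobolevNorm s)
        (ProductLaws.BesovSpace P (1 / 2) 2 ∞ ⊓ ProductLaws.LpSpace ∞)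
        (fun v ↦ ProductLaws.besovNorm P (1 / 2) 2 ∞ v + ProductLaws.normLp ∞ v)
        (ProductLaws.SobolevSpace s) (ProductLaws.sobolevNorm s)) ∧
    -- b) `H^s × B^{s+ε}_{∞,∞} → H^s`
    (∀ s ε : ℝ, 0 ≤ s → 0 < ε →
      ProductLaws.ProductContinuous
        (ProductLaws.SobolevSpace s) (ProductLaws.sobolevNorm s)
        (ProductLaws.BesovSpace P (s + ε) ∞ ∞) (ProductLaws.besovNorm P (s + ε) ∞ ∞)
        (ProductLaws.SobolevSpace s) (ProductLaws.sobolevNorm s)) ∧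
    -- c) `H^s × H^{s'} → H^{s+s'-1/2}`
    (∀ s s' : ℝ, s < 1 / 2 → s' < 1 / 2 → 0 < s + s' →
      ProductLaws.ProductContinuous
        (ProductLaws.SobolevSpace s) (ProductLaws.sobolevNorm s)
        (ProductLaws.SobolevSpace s') (ProductLaws.sobolevNorm s')
        (ProductLaws.SobolevSpace (s + s' - 1 / 2))
        (ProductLaws.sobolevNorm (s + s' - 1 / 2))) ∧
    -- d) `H^s ∩ L^∞` is an algebra for `s ≥ 0`, and `H^s` is an algebra for `s > 1/2`
    (∀ s : ℝ, 0 ≤ s →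
      ProductLaws.ProductContinuous
        (ProductLaws.SobolevSpace s ⊓ ProductLaws.LpSpace ∞)
        (fun u ↦ ProductLaws.sobolevNorm s u + ProductLaws.normLp ∞ u)
        (ProductLaws.SobolevSpace s ⊓ ProductLaws.LpSpace ∞)
        (fun u ↦ ProductLaws.sobolevNorm s u + ProductLaws.normLp ∞ u)
        (ProductLaws.SobolevSpace s ⊓ ProductLaws.LpSpace ∞)
        (fun u ↦ ProductLaws.sobolevNorm s u + ProductLaws.normLp ∞ u)) ∧
    (∀ s : ℝ, 1 / 2 < s →
      ProductLaws.ProductContinuous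
        (ProductLaws.SobolevSpace s) (ProductLaws.sobolevNorm s)
        (ProductLaws.SobolevSpace s) (ProductLaws.sobolevNorm s)
        (ProductLaws.SobolevSpace s) (ProductLaws.sobolevNorm s)) := by
  refine ⟨fun s hs ↦ ProductLaws.productContinuous_sobolev_besov P hs,
    fun s ε hs hε ↦ ProductLaws.productContinuous_sobolev_holder P hs hε,
    fun s s' hs hs' h ↦ ProductLaws.productContinuous_sobolev_subcritical P hs hs' h,
    fun s hs ↦ ProductLaws.productContinuous_bounded_sobolev P hs,
    fun s hs ↦ ProductLaws.productContinuous_sobolev_algebra P hs⟩
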